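/- **Setting.** All asymptotics are as $n\to\infty$; the dimension $d=d_n$, the number of factors $k=k_n$, the probability space and every model quantity below may change with $n$. Write $\tau_t=t/n$, $n\vee d=\max(n,d)$, $\|\cdot\|$ for the Euclidean norm of a vector or the operator norm of a matrix, $|\cdot|_1$ for the sum of absolute entries, $\|W\|_1=\max_j\sum_i|w_{ij}|$, $\|\cdot\|_{\max}$ or $|\cdot|_{\max}$ for the largest absolute entry, $\|\cdot\|_F$ for the Frobenius norm. "W.p.a.1" means with probability tending to one. $Y_n=O_P(R_n)$, where $R_n\ge 0$ may be random, means: for each $\eta>0$ there is $M$ with $P(|Y_n|>MR_n)\le\eta$ for all large $n$; $Y_n=o_P(r_n)$ means $P(|Y_n|>\eta r_n)\to0$ for each $\eta>0$. The conditions below are required for all large $n$. **Model.** $X_t=A(\tau_t)X_{t-1}+e_t$, $e_t=\Sigma(\tau_t)^{1/2}\varepsilon_t$ ($1\le t\le n$), where $(\varepsilon_t)_{t\in\mathbb Z}$ are i.i.d. $d$-dimensional with mean $0$ and identity covariance, and $X_t=\sum_{k\ge0}\Phi_{t,k}e_{t-k}$ a.s. ($0\le t\le n$), with $\Phi_{t,0}=I$,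 $\Phi_{t,k}=A(\tau_t)A(\tau_{t-1})\cdots A(\tau_{t-k+1})$ (values of $A=(\alpha_{ij})$ and $\Sigma$ at negative arguments describe the past). Put $\Omega=\Sigma^{-1}$. The observations are $Z_t=\Lambda F_t+X_t$ (constant loadings) or $Z_t=\Lambda(\tau_t)F_t+X_t$ (loadings with twice continuously differentiable entries), $1\le t\le n$, with $k$ latent factors. With constant loadings $\hat X_t=Z_t-\hat\Lambda\hat F_t$, where, with $\mathbf Z=(Z_1,\dots,Z_n)^\top$, $\hat{\mathbf F}=(\hat F_1,\dots,\hat F_n)^\top$ is $\sqrt n$ times a matrix of orthonormal eigenvectors of $\mathbf Z\mathbf Z^\top$ for its $k$ largest eigenvalues and $\hat\Lambda=\mathbf Z^\top\hat{\mathbf F}/n$. With time-varying loadings $\hat X_t=Z_t-\hat\Lambda(\tau_t)\hat F_t(\tau_t)$ with local PCA: for a bandwidth $h_*>0$ let $K_{r,h_*}(\tau)=K_{h_*}(\tau_r-\tau)/\sum_{l=1}^nK_{h_*}(\tau_l-\tau)$, let $\mathbf Z(\tau)$ have rows $K_{r,h_*}(\tau)^{1/2}Z_r^\top$, let $V(\tau)$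 consist of orthonormal eigenvectors of $\mathbf Z(\tau)\mathbf Z(\tau)^\top$ for its $k$ largest eigenvalues; then $\hat\Lambda(\tau)=\mathbf Z(\tau)^\top V(\tau)$ and $K_{t,h_*}(\tau)^{1/2}\hat F_t(\tau)$ is the $t$-th row of $V(\tau)$. **Estimators.** $K_h(x)=K(x/h)/h$. For $1\le i\le d$, $$\mathcal L_i(\alpha,\beta\mid\tau)=\frac1n\sum_{t=2}^n\{\hat x_{t,i}-[\alpha+\beta(\tau_t-\tau)]^\top\hat X_{t-1}\}^2K_h(\tau_t-\tau).$$ *Stage 1:* $(\tilde\alpha^\dagger_{i\bullet}(\tau_t),\tilde\beta^\dagger_{i\bullet}(\tau_t))$ is any minimiser of $\mathcal L_i(\alpha,\beta\mid\tau_t)+\lambda_1(|\alpha|_1+h|\beta|_1)$. *Stage 2:* with $p'_\lambda(z)=\lambda[I(z\le\lambda)+\frac{(a_0\lambda-z)_+}{(a_0-1)\lambda}I(z>\lambda)]$, $a_0=3.7$, $(\hat\alpha^\dagger_{ij}(\tau_t),\hat\beta^\dagger_{ij}(\tau_t))_{t,j}$ is any minimiser over $n\times d$ matrices $\mathbf A=(\alpha_{j|t})$,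 $\mathbf B=(\beta_{j|t})$, whose $t$-th rows are $\alpha_{\bullet t},\beta_{\bullet t}$ and whose $j$-th columns are $\alpha_j,\beta_j$, of $$\mathcal Q_i(\mathbf A,\mathbf B)=\sum_{t=1}^n\mathcal L_i(\alpha_{\bullet t},\beta_{\bullet t}\mid\tau_t)+\sum_{j=1}^dp'_{\lambda_2}(\|\tilde\alpha^\dagger_{i,j}\|)\|\alpha_j\|+\sum_{j=1}^dp'_{\lambda_2}(\tilde D_{i,j})\|h\beta_j\|,$$ where $\tilde\alpha^\dagger_{i,j}=(\tilde\alpha^\dagger_{ij}(\tau_t))_{t\le n}$ and $\tilde D_{i,j}^2=\sum_t[\tilde\alpha^\dagger_{ij}(\tau_t)-\frac1n\sum_r\tilde\alpha^\dagger_{ij}(\tau_r)]^2$; $D_{i,j}$ is the same with the true $\alpha_{ij}$. *Stage 3:* $\hat e_t=\hat X_t-\hat A^\dagger(\tau_t)\hat X_{t-1}$ ($2\le t\le n$), where $\hat A^\dagger(\tau_t)=[\hat\alpha^\dagger_{ij}(\tau_t)]$; $\hat\Sigma^\dagger(\tau)=\sum_{t=2}^n\varpi_{n,t}(\tau)\hat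 e_t\hat e_t^\top/\sum_{t=2}^n\varpi_{n,t}(\tau)$, where $\varpi_{n,t}(\tau)=K(\frac{\tau_t-\tau}b)s_{n,2}(\tau)-K_1(\frac{\tau_t-\tau}b)s_{n,1}(\tau)$, $K_j(x)=x^jK(x)$, $s_{n,j}(\tau)=\sum_{t=2}^nK_j(\frac{\tau_t-\tau}b)$; $\tilde\Omega^\dagger(\tau)$ is any minimiser of $|W|_1$ subject to $\|\hat\Sigma^\dagger(\tau)W-I\|_{\max}\le\lambda_3$ (arbitrary if no $W$ is feasible), and $\hat\Omega^\dagger(\tau)$ is its symmetrisation, keeping of $\tilde\omega_{ij},\tilde\omega_{ji}$ the one of smaller modulus. **Notation.** $J_i(\tau)=\{j:\alpha_{ij}(\tau)\ne0\}$, $J'_i(\tau)=\{j:\alpha'_{ij}(\tau)\neq0\}$, $J_i=\bigcup_{t=1}^nJ_i(\tau_t)$, $J'_i=\bigcup_{t=1}^nJ'_i(\tau_t)$, $s=\max_i|J_i|$; $\Psi(\tau)=\begin{pmatrix}\Psi_0&\Psi_1\\\Psi_1&\Psi_2\end{pmatrix}(\tau)$ with $\Psi_k(\tau)=\frac1n\sum_{t=1}^n(\frac{\tau_t-\tau}h)^kX_{t-1}X_{t-1}^\top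 K_h(\tau_t-\tau)$; $\delta_X=\max_{1\le t\le n}|\hat X_t-X_t|_{\max}$; $\zeta=\log(n\vee d)[(nh)^{-1/2}+sh^2]$, $\zeta^\dagger=\zeta+[\log(n\vee d)]^{1/2}s\,\delta_X$, $\nu^\diamond=[\log(n\vee d)/(nb)]^{1/2}+b^2$, $\nu^\dagger=s\,\zeta^\dagger[\log(n\vee d)]^{1/2}$. **Standing assumptions.** (a) There are constants $\iota_1>0$, $\rho\in(0,1)$, $C_0,C_1,C_\Sigma,M$ not depending on $n$ such that: $\det(I-A(\tau)z)\ne0$ for $\tau\in[0,1]$, $z\in\mathbb C$, $|z|\le1$; $\|\Phi_{t,k}\|\le C_1\rho^k$ for $0\le t\le n$, $k\ge0$; the entries of $A,\Sigma,\Omega$ are twice continuously differentiable on $[0,1]$, with second derivatives of the entries of $A$ and $\Sigma$ bounded by $M$; $\Sigma(\tau)$ is positive definite with $\|\Sigma(\tau)\|\le C_\Sigma$ for all $\tau\le1$; $E\exp\{\iota_1(u^\top\varepsilon_t)^2\}\le C_0$ whenever $\|u\|=1$. (b) $K$ is a symmetric probability density vanishing off $[-1,1]$ and continuous on $[-1,1]$;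 $nh/\log^2(n\vee d)\to\infty$, $sh^2\log(n\vee d)\to0$, $s\ge1$. (c) There is $\kappa_0>0$ such that w.p.a.1, for all $i,t$, $u^\top\Psi(\tau_t)u\ge\kappa_0$ for all $u=(u_1^\top,u_2^\top)^\top$ with $\|u\|=1$ and $|u|_1\le3(\sum_{j\in J_i(\tau_t)}|u_{1,j}|+\sum_{j\in J_i'(\tau_t)}|u_{2,j}|)$. (d) $[\log(n\vee d)]^{1/2}s\,\delta_X=o_P(1)$, $\zeta^\dagger=o_P(\lambda_1)$ and $\sqrt s\lambda_1/h\to0$. **Proposition.** (i) Under (a)–(d), $\displaystyle\max_{1\le i\le d}\max_{1\le t\le n}\sum_{j=1}^d[\tilde\alpha^\dagger_{ij}(\tau_t)-\alpha_{ij}(\tau_t)]^2=O_P(s\lambda_1^2)$. (ii) Suppose in addition that $\sqrt n\,s\log(n\vee d)\zeta^\dagger+\sqrt{ns}\,\lambda_1=o_P(\lambda_2)$; that $\min_i\min_{j\in J_i}(\sum_t\alpha_{ij}^2(\tau_t))^{1/2}\ge(a_0+1)\lambda_2$ and $\min_i\min_{j\in J'_i}D_{i,j}\ge(a_0+1)\lambda_2$;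 and that there is $\kappa_1>0$ such that w.p.a.1 $u^\top\Psi(\tau_t)u\ge\kappa_1$ for all $i,t$ and all unit vectors $u=(u_1^\top,u_2^\top)^\top$ with $u_1$ supported in $J_i$ and $u_2$ supported in $J'_i$. Then the oracle property holds: w.p.a.1, simultaneously for all $i$, $\mathcal Q_i$ has exactly one minimiser, and it equals the oracle estimate, that is, the (unique) minimiser of $\mathcal Q_i$ over the pairs $(\mathbf A,\mathbf B)$ with $\alpha_j=0$ for $j\notin J_i$ and $\beta_j=0$ for $j\notin J'_i$. Moreover $$\max_{1\le i\le d}\frac1n\sum_{t=1}^n\sum_{j=1}^d[\hat\alpha^\dagger_{ij}(\tau_t)-\alpha_{ij}(\tau_t)]^2=O_P\big(s(\zeta^\dagger)^2\big).$$ (iii) Suppose in addition that $K$ is Lipschitz on $[-1,1]$; $0<b\to0$, $nb/[\log(n\vee d)]^3\to\infty$ and $\nu^\dagger=o_P(1)$; and that, for some $q\in[0,1)$ and $C_2$ not depending on $n$ and some $\xi_d$, for all $\tau\in[0,1]$, $\Omega(\tau)$ is positive definite, $\|\Omega(\tau)\|_1\le C_2$ and $\max_i\sum_j|\omega_{ij}(\tau)|^q\le\xi_d$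 (with $0^0=0$). Then there is a constant $\bar C$ such that for each constant $C_3\ge\bar C$, with $\lambda_3=C_3(\nu^\diamond+\nu^\dagger)$, $$\sup_{0\le\tau\le1}\|\hat\Omega^\dagger(\tau)-\Omega(\tau)\|_{\max}=O_P(\nu^\diamond+\nu^\dagger),\qquad \sup_{0\le\tau\le1}\|\hat\Omega^\dagger(\tau)-\Omega(\tau)\|=O_P\big(\xi_d(\nu^\diamond+\nu^\dagger)^{1-q}\big),$$ $$\sup_{0\le\tau\le1}\tfrac1d\|\hat\Omega^\dagger(\tau)-\Omega(\tau)\|_F^2=O_P\big(\xi_d(\nu^\diamond+\nu^\dagger)^{2-q}\big).$$ -/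

import Mathlib

open MeasureTheory ProbabilityTheory Filter Topology Set
open scoped Matrix

namespace TVNet

noncomputable section

/-! ### Stochastic orders along a sequence of probability spaces

The complements of the events below need not be measurable; `μ n` of such a set is then its outer
measure, which makes the assertions at least as strong as the measurable ones. -/

/-- `P n` holds with probability approaching one. -/
def WPA1 {Ω : ℕ → Type*} [∀ n, MeasurableSpace (Ω n)] (μ : ∀ n, Measure (Ω n))
    (P : ∀ n, Ω n → Prop) : Prop :=
  Tendsto (fun n => μ n {ω | ¬ P n ω}) atTop (𝓝 0)

/-- `Y n = o_P(r n)` for a deterministic sequence `r`. -/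
def SmallOP {Ω : ℕ → Type*} [∀ n, MeasurableSpace (Ω n)] (μ : ∀ n, Measure (Ω n))
    (Y : ∀ n, Ω n → ℝ) (r : ℕ → ℝ) : Prop :=
  ∀ η : ℝ, 0 < η → WPA1 μ (fun n ω => |Y n ω| ≤ η * r n)

/-- `sup_x |Y n x| = O_P(R n)`, the rate `R n` possibly being random itself. The supremum is over
an index type that may change with `n`. -/
def BigOP {Ω : ℕ → Type*} [∀ n, MeasurableSpace (Ω n)] (μ : ∀ n, Measure (Ω n))
    {ι : ℕ → Type*} (Y : ∀ n, ι n → Ω n → ℝ) (R : ∀ n, Ω n → ℝ) : Prop :=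
  ∀ η : ℝ, 0 < η → ∃ M : ℝ, 0 < M ∧ ∀ᶠ n in atTop,
    μ n {ω | ¬ ∀ x, |Y n x ω| ≤ M * R n ω} ≤ ENNReal.ofReal η

/-! ### Time, matrices, kernels -/

/-- The observation times `1, …, n`. -/
abbrev Grid (n : ℕ) := {t : ℕ // t ∈ Finset.Icc 1 n}

/-- Rescaled time `τ_t = t / n`. -/
def rt (n t : ℕ) : ℝ := (t : ℝ) / n

/-- Euclidean norm of a finite family of reals. -/
def l2 {ι : Type*} [Fintype ι] (v : ι → ℝ) : ℝ := √(∑ t, v t ^ 2)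

/-- Operator (spectral) norm of a real square matrix. -/
def opNorm {d : ℕ} (W : Matrix (Fin d) (Fin d) ℝ) : ℝ :=
  ‖Matrix.toEuclideanCLM (n := Fin d) (𝕜 := ℝ) W‖

open scoped MatrixOrder in
/-- The symmetric positive semidefinite square root of a positive semidefinite matrix. -/
def matSqrt {d : ℕ} (W : Matrix (Fin d) (Fin d) ℝ) : Matrix (Fin d) (Fin d) ℝ := CFC.sqrt W

/-- A symmetric probability density, vanishing off `[-1,1]` and continuous (hence bounded) on
`[-1,1]`. -/
structure IsKernel (K : ℝ → ℝ) : Prop where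
  cont : ContinuousOn K (Icc (-1) 1)
  supp : ∀ x, x ∉ Icc (-1 : ℝ) 1 → K x = 0
  nonneg : ∀ x, 0 ≤ K x
  symm : ∀ x, K (-x) = K x
  total : ∫ x, K x = 1

/-- `K_h(x) = K(x/h)/h`. -/
def Kh (K : ℝ → ℝ) (h x : ℝ) : ℝ := (1 / h) * K (x / h)

/-! ### The time-varying VAR(1) model -/

/-- Coefficients of the linear (Wold) representation:
`Φ_{t,0} = I` and `Φ_{t,k} = A_t A_{t-1} ⋯ A_{t-k+1}`, where `A_t = A(t/n)`. -/
def Phi {d : ℕ} (n : ℕ) (A : ℝ → Matrix (Fin d) (Fin d) ℝ) : ℤ → ℕ → Matrix (Fin d) (Fin d) ℝ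
  | _, 0 => 1
  | t, k + 1 => A ((t : ℝ) / n) * Phi n A (t - 1) k

/-- The innovation `e_t = Σ_t^{1/2} ε_t`. -/
def innov {Ω : Type*} {d : ℕ} (n : ℕ) (Sig : ℝ → Matrix (Fin d) (Fin d) ℝ)
    (ε : ℤ → Ω → Fin d → ℝ) (t : ℤ) (ω : Ω) : Fin d → ℝ :=
  matSqrt (Sig ((t : ℝ) / n)) *ᵥ ε t ω

/-- `X_0, …, X_n` is the causal solution of the time-varying VAR(1) model
`X_t = A(t/n) X_{t-1} + Σ(t/n)^{1/2} ε_t`, with i.i.d. `ε_t` of mean zero and identity covariance.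
The values of `A` and `Σ` at negative arguments describe the past of the process. -/
structure IsTVVAR {Ω : Type*} [MeasurableSpace Ω] (μ : Measure Ω) {d : ℕ} (n : ℕ)
    (A Sig : ℝ → Matrix (Fin d) (Fin d) ℝ) (ε : ℤ → Ω → Fin d → ℝ)
    (X : ℕ → Ω → Fin d → ℝ) : Prop where
  meas : ∀ t, Measurable (ε t)
  indep : iIndepFun ε μ
  ident : ∀ t, IdentDistrib (ε t) (ε 0) μ μ
  mean : ∀ t i, ∫ ω, ε t ω i ∂μ = 0
  cov : ∀ t i j, ∫ ω, ε t ω i * ε t ω j ∂μ = if i = j then 1 else 0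
  recursion : ∀ t, 1 ≤ t → t ≤ n →
    ∀ᵐ ω ∂μ, X t ω = A (rt n t) *ᵥ X (t - 1) ω + innov n Sig ε t ω
  wold : ∀ t, t ≤ n →
    ∀ᵐ ω ∂μ, HasSum (fun k : ℕ => Phi n A t k *ᵥ innov n Sig ε ((t : ℤ) - k) ω) (X t ω)

/-- Regularity of the model at one sample size, with constants `ι₁, C₀, C₁, ρ, CS, M`:
stability, geometric decay of the coefficients `Φ_{t,k}`, twice continuously differentiable
coefficient functions on `[0,1]` with second derivatives (of the entries of `A` and `Σ`) bounded
by `M`, `Σ` positive definite with operator norm at most `CS`, and sub-Gaussian `ε_t`. -/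
structure IsRegularVAR {Ω : Type*} [MeasurableSpace Ω] (μ : Measure Ω) {d : ℕ} (n : ℕ)
    (A Sig : ℝ → Matrix (Fin d) (Fin d) ℝ) (ε : ℤ → Ω → Fin d → ℝ)
    (ι₁ C₀ C₁ ρ CS M : ℝ) : Prop where
  stable : ∀ τ ∈ Icc (0 : ℝ) 1, ∀ z : ℂ, ‖z‖ ≤ 1 →
    (1 - z • (A τ).map (fun x : ℝ => (x : ℂ))).det ≠ 0
  decay : ∀ t : ℕ, t ≤ n → ∀ k : ℕ, opNorm (Phi n A t k) ≤ C₁ * ρ ^ k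
  smoothA : ∀ i j, ContDiffOn ℝ 2 (fun τ => A τ i j) (Icc 0 1)
  boundA : ∀ i j, ∀ τ ∈ Icc (0 : ℝ) 1,
    |iteratedDerivWithin 2 (fun u => A u i j) (Icc 0 1) τ| ≤ M
  posSig : ∀ τ ≤ (1 : ℝ), (Sig τ).PosDef
  normSig : ∀ τ ≤ (1 : ℝ), opNorm (Sig τ) ≤ CS
  smoothSig : ∀ i j, ContDiffOn ℝ 2 (fun τ => Sig τ i j) (Icc 0 1)
  boundSig : ∀ i j, ∀ τ ∈ Icc (0 : ℝ) 1,
    |iteratedDerivWithin 2 (fun u => Sig u i j) (Icc 0 1) τ| ≤ M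
  smoothOmega : ∀ i j, ContDiffOn ℝ 2 (fun τ => (Sig τ)⁻¹ i j) (Icc 0 1)
  subGauss : ∀ t, ∀ u : Fin d → ℝ, l2 u = 1 →
    ∫⁻ ω, ENNReal.ofReal (Real.exp (ι₁ * (u ⬝ᵥ ε t ω) ^ 2)) ∂μ ≤ ENNReal.ofReal C₀

/-! ### Supports, sparsity and rates -/

/-- `α'_{ij}(τ)`, the derivative of the `(i,j)` entry of `A` on `[0,1]`. -/
def dA {d : ℕ} (A : ℝ → Matrix (Fin d) (Fin d) ℝ) (τ : ℝ) (i j : Fin d) : ℝ :=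
  derivWithin (fun u => A u i j) (Icc 0 1) τ

/-- `J_i(τ)`. -/
def JLoc {d : ℕ} (A : ℝ → Matrix (Fin d) (Fin d) ℝ) (i : Fin d) (τ : ℝ) : Set (Fin d) :=
  {j | A τ i j ≠ 0}

/-- `J'_i(τ)`. -/
def JLoc' {d : ℕ} (A : ℝ → Matrix (Fin d) (Fin d) ℝ) (i : Fin d) (τ : ℝ) : Set (Fin d) :=
  {j | dA A τ i j ≠ 0}

/-- `J_i`, the union of the `J_i(τ_t)`. -/
def J {d : ℕ} (n : ℕ) (A : ℝ → Matrix (Fin d) (Fin d) ℝ) (i : Fin d) : Set (Fin d) :=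
  ⋃ t : Grid n, JLoc A i (rt n t)

/-- `J'_i`, the union of the `J'_i(τ_t)`. -/
def J' {d : ℕ} (n : ℕ) (A : ℝ → Matrix (Fin d) (Fin d) ℝ) (i : Fin d) : Set (Fin d) :=
  ⋃ t : Grid n, JLoc' A i (rt n t)

/-- `s = max_i |J_i|`. -/
def sparsity {d : ℕ} (n : ℕ) (A : ℝ → Matrix (Fin d) (Fin d) ℝ) : ℕ :=
  Finset.univ.sup fun i => (J n A i).ncard

/-- `log (n ∨ d)`. -/
def logND (n d : ℕ) : ℝ := Real.log (max (n : ℝ) (d : ℝ))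

/-- `D = (∑_t (v_t - mean v)²)^{1/2}` for a path `v` on the grid. -/
def devNorm {n : ℕ} (v : Grid n → ℝ) : ℝ := l2 (fun t => v t - (1 / (n : ℝ)) * ∑ r, v r)

/-- `ζ_{n,d} = log(n∨d) [(nh)^{-1/2} + s h²]`. -/
def zeta {d : ℕ} (n : ℕ) (A : ℝ → Matrix (Fin d) (Fin d) ℝ) (h : ℝ) : ℝ :=
  logND n d * (1 / √(n * h) + sparsity n A * h ^ 2)

/-- `δ_X = max_{1≤t≤n} |X̂_t - X_t|_max`. -/
def deltaX {Ω : Type*} {d : ℕ} (n : ℕ) (X Xhat : ℕ → Ω → Fin d → ℝ) (ω : Ω) : ℝ :=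
  ⨆ p : Grid n × Fin d, |Xhat p.1 ω p.2 - X p.1 ω p.2|

/-- `ζ†_{n,d} = ζ_{n,d} + [log(n∨d)]^{1/2} s δ_X`. -/
def zetaDag {Ω : Type*} {d : ℕ} (n : ℕ) (A : ℝ → Matrix (Fin d) (Fin d) ℝ) (h : ℝ)
    (X Xhat : ℕ → Ω → Fin d → ℝ) (ω : Ω) : ℝ :=
  zeta n A h + √(logND n d) * sparsity n A * deltaX n X Xhat ω

/-- `ν⋄_{n,d} = [log(n∨d)/(nb)]^{1/2} + b²`. -/
def nuDiamond (n d : ℕ) (b : ℝ) : ℝ := √(logND n d / (n * b)) + b ^ 2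

/-- `ν†_{n,d} = s ζ†_{n,d} [log(n∨d)]^{1/2}`. -/
def nuDag {Ω : Type*} {d : ℕ} (n : ℕ) (A : ℝ → Matrix (Fin d) (Fin d) ℝ) (h : ℝ)
    (X Xhat : ℕ → Ω → Fin d → ℝ) (ω : Ω) : ℝ :=
  sparsity n A * zetaDag n A h X Xhat ω * √(logND n d)

/-! ### The restricted eigenvalue condition -/

/-- `Ψ_k(τ)`. -/
def PsiBlock {d : ℕ} (n : ℕ) (K : ℝ → ℝ) (h : ℝ) (x : ℕ → Fin d → ℝ) (τ : ℝ) (k : ℕ) :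
    Matrix (Fin d) (Fin d) ℝ :=
  (1 / (n : ℝ)) • ∑ t ∈ Finset.Icc 1 n,
    (((rt n t - τ) / h) ^ k * Kh K h (rt n t - τ)) • Matrix.vecMulVec (x (t - 1)) (x (t - 1))

/-- The `2d × 2d` matrix `Ψ(τ)`. -/
def Psi {d : ℕ} (n : ℕ) (K : ℝ → ℝ) (h : ℝ) (x : ℕ → Fin d → ℝ) (τ : ℝ) :
    Matrix (Fin d ⊕ Fin d) (Fin d ⊕ Fin d) ℝ :=
  Matrix.fromBlocks (PsiBlock n K h x τ 0) (PsiBlock n K h x τ 1)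
    (PsiBlock n K h x τ 1) (PsiBlock n K h x τ 2)

open scoped Classical in
/-- The unit cone `{(u₁,u₂) : ‖u₁‖²+‖u₂‖² = 1, |u₁|₁+|u₂|₁ ≤ 3(|u_{1,S}|₁+|u_{2,S'}|₁)}`. -/
def Cone {d : ℕ} (S S' : Set (Fin d)) : Set (Fin d ⊕ Fin d → ℝ) :=
  {u | l2 u = 1 ∧ ∑ j, (|u (.inl j)| + |u (.inr j)|) ≤
    3 * ((∑ j, if j ∈ S then |u (.inl j)| else 0) + ∑ j, if j ∈ S' then |u (.inr j)| else 0)}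

/-- Unit vectors `(u₁,u₂)` with `u₁` supported in `S` and `u₂` supported in `S'`. -/
def SuppSphere {d : ℕ} (S S' : Set (Fin d)) : Set (Fin d ⊕ Fin d → ℝ) :=
  {u | l2 u = 1 ∧ (∀ j ∉ S, u (.inl j) = 0) ∧ ∀ j ∉ S', u (.inr j) = 0}

/-! ### Principal components and the estimated idiosyncratic components -/

/-- The columns of `V` are orthonormal eigenvectors of the symmetric matrix `W` belonging to its
`k` largest eigenvalues: the Rayleigh quotient of `W` on the orthogonal complement of the columns
does not exceed any of their eigenvalues. -/
def IsTopEigenvectors {ι : Type*} [Fintype ι] {k : ℕ} (W : Matrix ι ι ℝ)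
    (V : Matrix ι (Fin k) ℝ) : Prop :=
  Vᵀ * V = 1 ∧ ∃ ev : Fin k → ℝ, W * V = V * Matrix.diagonal ev ∧
    ∀ x : ι → ℝ, Vᵀ *ᵥ x = 0 → ∀ j, x ⬝ᵥ (W *ᵥ x) ≤ ev j * (x ⬝ᵥ x)

/-- The `n × d` data matrix. -/
def dataMatrix {d : ℕ} (n : ℕ) (z : ℕ → Fin d → ℝ) : Matrix (Grid n) (Fin d) ℝ :=
  Matrix.of fun t j => z t j

/-- PCA with `k` factors: `F̂` is `√n` times the top eigenvectors of `Z Zᵀ`, `Λ̂ = Zᵀ F̂ / n` and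
`X̂_t = Z_t - Λ̂ F̂_t`. -/
def IsPCAResidual {d : ℕ} (n k : ℕ) (z xhat : ℕ → Fin d → ℝ) : Prop :=
  ∃ V Fhat : Matrix (Grid n) (Fin k) ℝ, ∃ Lhat : Matrix (Fin d) (Fin k) ℝ,
    IsTopEigenvectors (dataMatrix n z * (dataMatrix n z)ᵀ) V ∧
    Fhat = √n • V ∧ Lhat = (1 / (n : ℝ)) • ((dataMatrix n z)ᵀ * Fhat) ∧
    ∀ t : Grid n, xhat t = z t - Lhat *ᵥ Fhat t

/-- Normalised kernel weights `K_{t,h*}(τ)`. -/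
def locWeight (n : ℕ) (K : ℝ → ℝ) (hs τ : ℝ) (t : ℕ) : ℝ :=
  Kh K hs (rt n t - τ) / ∑ r ∈ Finset.Icc 1 n, Kh K hs (rt n r - τ)

/-- The localised data matrix `Z(τ)` with rows `K_{t,h*}(τ)^{1/2} Z_t`. -/
def locDataMatrix {d : ℕ} (n : ℕ) (K : ℝ → ℝ) (hs τ : ℝ) (z : ℕ → Fin d → ℝ) :
    Matrix (Grid n) (Fin d) ℝ :=
  Matrix.of fun t j => √(locWeight n K hs τ t) * z t j

/-- Local PCA with `k` factors. At `τ = τ_t`, the top eigenvectors `V` of `Z(τ) Z(τ)ᵀ` estimate the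
localised factors, so that `Λ̂(τ) = Z(τ)ᵀ V` and row `t` of `V` equals
`K_{t,h*}(τ)^{1/2} F̂_t(τ)`; then `X̂_t = Z_t - Λ̂(τ_t) F̂_t(τ_t)`. (In the weighted least squares
normalisation `∑_r K_{r,h*}(τ) F̂_r(τ) F̂_r(τ)ᵀ = I`; with equal weights `1/n` this is ordinary
PCA.) -/
def IsLocalPCAResidual {d : ℕ} (n k : ℕ) (K : ℝ → ℝ) (hs : ℝ) (z xhat : ℕ → Fin d → ℝ) : Prop :=
  ∀ t : Grid n, ∃ V : Matrix (Grid n) (Fin k) ℝ, ∃ Lhat : Matrix (Fin d) (Fin k) ℝ,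
    IsTopEigenvectors
      (locDataMatrix n K hs (rt n t) z * (locDataMatrix n K hs (rt n t) z)ᵀ) V ∧
    Lhat = (locDataMatrix n K hs (rt n t) z)ᵀ * V ∧
    xhat t = z t - Lhat *ᵥ ((1 / √(locWeight n K hs (rt n t) t)) • V t)

/-- The factor model with constant loadings, and `X̂` obtained by PCA. -/
def ConstantLoadings {Ω : ℕ → Type*} [∀ n, MeasurableSpace (Ω n)] (μ : ∀ n, Measure (Ω n))
    (d k : ℕ → ℕ) (X Z Xhat : ∀ n, ℕ → Ω n → Fin (d n) → ℝ)
    (F : ∀ n, ℕ → Ω n → Fin (k n) → ℝ) : Prop :=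
  ∃ L : ∀ n, Matrix (Fin (d n)) (Fin (k n)) ℝ, ∀ᶠ n in atTop,
    (∀ᵐ ω ∂(μ n), ∀ t : Grid n, Z n t ω = L n *ᵥ F n t ω + X n t ω) ∧
    ∀ ω, IsPCAResidual n (k n) (fun t => Z n t ω) (fun t => Xhat n t ω)

/-- The factor model with smoothly time-varying loadings, and `X̂` obtained by local PCA with
bandwidth `hs`. -/
def VaryingLoadings {Ω : ℕ → Type*} [∀ n, MeasurableSpace (Ω n)] (μ : ∀ n, Measure (Ω n))
    (d k : ℕ → ℕ) (K : ℝ → ℝ) (hs : ℕ → ℝ) (X Z Xhat : ∀ n, ℕ → Ω n → Fin (d n) → ℝ)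
    (F : ∀ n, ℕ → Ω n → Fin (k n) → ℝ) : Prop :=
  ∃ L : ∀ n, ℝ → Matrix (Fin (d n)) (Fin (k n)) ℝ, ∀ᶠ n in atTop, 0 < hs n ∧
    (∀ i j, ContDiffOn ℝ 2 (fun τ => L n τ i j) (Icc 0 1)) ∧
    (∀ᵐ ω ∂(μ n), ∀ t : Grid n, Z n t ω = L n (rt n t) *ᵥ F n t ω + X n t ω) ∧
    ∀ ω, IsLocalPCAResidual n (k n) K (hs n) (fun t => Z n t ω) (fun t => Xhat n t ω)

/-! ### The three estimation stages

All are functions of a data path `x` observed at the times `1, …, n`; the pairs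
(response, lagged regressor) available are those with response time `2, …, n`. -/

/-- The local linear loss `L_i(α, β | τ)`. -/
def loss {d : ℕ} (n : ℕ) (K : ℝ → ℝ) (h : ℝ) (x : ℕ → Fin d → ℝ) (i : Fin d)
    (a b : Fin d → ℝ) (τ : ℝ) : ℝ :=
  (1 / (n : ℝ)) * ∑ t ∈ Finset.Icc 2 n,
    (x t i - ∑ j, (a j + b j * (rt n t - τ)) * x (t - 1) j) ^ 2 * Kh K h (rt n t - τ)

/-- The time-varying LASSO objective `L*_i(α, β | τ)`. -/
def lassoObj {d : ℕ} (n : ℕ) (K : ℝ → ℝ) (h lam : ℝ) (x : ℕ → Fin d → ℝ) (i : Fin d)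
    (a b : Fin d → ℝ) (τ : ℝ) : ℝ :=
  loss n K h x i a b τ + lam * (∑ j, |a j| + h * ∑ j, |b j|)

/-- `(a i t, b i t)` minimises `L*_i(·,· | τ_t)` for all `i` and `t`. -/
def IsLasso {d : ℕ} (n : ℕ) (K : ℝ → ℝ) (h lam : ℝ) (x : ℕ → Fin d → ℝ)
    (a b : Fin d → Grid n → Fin d → ℝ) : Prop :=
  ∀ i t, ∀ a' b' : Fin d → ℝ,
    lassoObj n K h lam x i (a i t) (b i t) (rt n t) ≤ lassoObj n K h lam x i a' b' (rt n t)

/-- The SCAD constant `a₀ = 3.7`. -/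
def scadA : ℝ := 37 / 10

/-- The derivative `p'_λ(z)` of the SCAD penalty. -/
def scadDeriv (lam z : ℝ) : ℝ :=
  lam * (if z ≤ lam then 1 else max (scadA * lam - z) 0 / ((scadA - 1) * lam))

/-- The weighted group LASSO objective `Q_i(A, B)`, with weights computed from the preliminary
estimates `pre t j` of `α_{ij}(τ_t)`. -/
def groupObj {d : ℕ} (n : ℕ) (K : ℝ → ℝ) (h lam : ℝ) (x : ℕ → Fin d → ℝ)
    (pre : Grid n → Fin d → ℝ) (i : Fin d) (p : (Grid n → Fin d → ℝ) × (Grid n → Fin d → ℝ)) : ℝ :=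
  (∑ t : Grid n, loss n K h x i (p.1 t) (p.2 t) (rt n t))
    + (∑ j, scadDeriv lam (l2 fun t => pre t j) * l2 fun t => p.1 t j)
    + ∑ j, scadDeriv lam (devNorm fun t => pre t j) * l2 fun t => h * p.2 t j

/-- The class of `(A°, B°)` vanishing off the true supports `J_i` and `J'_i`. -/
def oracleClass {d : ℕ} (n : ℕ) (A : ℝ → Matrix (Fin d) (Fin d) ℝ) (i : Fin d) :
    Set ((Grid n → Fin d → ℝ) × (Grid n → Fin d → ℝ)) :=
  {p | (∀ t, ∀ j ∉ J n A i, p.1 t j = 0) ∧ ∀ t, ∀ j ∉ J' n A i, p.2 t j = 0}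

/-- `p` minimises `f` over `S`. -/
def IsMinimiser {α : Type*} (f : α → ℝ) (S : Set α) (p : α) : Prop :=
  p ∈ S ∧ ∀ q ∈ S, f p ≤ f q

/-- VAR residuals `ê_t = x_t - Â(τ_t) x_{t-1}` (used for `t ≥ 2`). -/
def resid {d : ℕ} (n : ℕ) (x : ℕ → Fin d → ℝ) (ahat : Fin d → Grid n → Fin d → ℝ)
    (t : Grid n) (i : Fin d) : ℝ :=
  x t i - ∑ j, ahat i t j * x (t - 1) j

/-- `s_{n,j}(τ) = ∑_t K_j((τ_t-τ)/b)`, where `K_j(x) = x^j K(x)`. -/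
def kernSum (n : ℕ) (K : ℝ → ℝ) (b : ℝ) (j : ℕ) (τ : ℝ) : ℝ :=
  ∑ t ∈ Finset.Icc 2 n, ((rt n t - τ) / b) ^ j * K ((rt n t - τ) / b)

/-- The local linear weights `ϖ_{n,t}(τ)`. -/
def llWeight (n : ℕ) (K : ℝ → ℝ) (b τ : ℝ) (t : ℕ) : ℝ :=
  K ((rt n t - τ) / b) * kernSum n K b 2 τ
    - ((rt n t - τ) / b) * K ((rt n t - τ) / b) * kernSum n K b 1 τ

/-- The local linear covariance estimate `Σ̂(τ)`. -/
def sigmaHat {d : ℕ} (n : ℕ) (K : ℝ → ℝ) (b : ℝ) (x : ℕ → Fin d → ℝ)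
    (ahat : Fin d → Grid n → Fin d → ℝ) (τ : ℝ) : Matrix (Fin d) (Fin d) ℝ :=
  Matrix.of fun i j =>
    (∑ t : Grid n with 2 ≤ t.1, llWeight n K b τ t * resid n x ahat t i * resid n x ahat t j)
      / ∑ t : Grid n with 2 ≤ t.1, llWeight n K b τ t

/-- The constraint `‖Σ̂ W - I‖_max ≤ λ`. -/
def climeFeasible {d : ℕ} (S : Matrix (Fin d) (Fin d) ℝ) (lam : ℝ) :
    Set (Matrix (Fin d) (Fin d) ℝ) :=
  {W | ∀ i j, |(S * W - 1) i j| ≤ lam}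

/-- `W` is a CLIME solution: it minimises `|W|₁ = ∑ |w_ij|` under the constraint. Where no matrix
satisfies the constraint, the estimate is arbitrary. -/
def IsClime {d : ℕ} (S : Matrix (Fin d) (Fin d) ℝ) (lam : ℝ) (W : Matrix (Fin d) (Fin d) ℝ) :
    Prop :=
  (climeFeasible S lam).Nonempty → IsMinimiser (fun W => ∑ i, ∑ j, |W i j|) (climeFeasible S lam) W

/-- Symmetrisation: of `w_ij` and `w_ji` the one of smaller modulus. -/
def symmetrise {d : ℕ} (W : Matrix (Fin d) (Fin d) ℝ) : Matrix (Fin d) (Fin d) ℝ :=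
  Matrix.of fun i j =>
    if i ≤ j then (if |W i j| ≤ |W j i| then W i j else W j i)
    else (if |W j i| ≤ |W i j| then W j i else W i j)

/-- `{W(τ) : 0 ≤ τ ≤ 1} ∈ S(q, ξ)` with constant `C₂`. For `q = 0` the sum counts the nonzero
entries. -/
def InSparseClass {d : ℕ} (q ξ C₂ : ℝ) (W : ℝ → Matrix (Fin d) (Fin d) ℝ) : Prop :=
  ∀ τ ∈ Icc (0 : ℝ) 1, (W τ).PosDef ∧ (∀ j, ∑ i, |W τ i j| ≤ C₂) ∧
    ∀ i, ∑ j, (if W τ i j = 0 then 0 else |W τ i j| ^ q) ≤ ξ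

end

end TVNet

open TVNet

/-! All randomness is confined to one event. `RegPath` lists the bounds that a path must obey:
entries of the process and of the innovations of order √log(n∨d), kernel-weighted scores of order
log(n∨d)/√(nh), estimation error δ at most 1. `exists_wpa1_regPath` shows that they hold with
probability tending to one. Given them and the eigenvalue conditions, the first two stages are
deterministic inequalities about weighted least squares.

The bounds come from Chernoff's method. The Wold series has geometrically decaying coefficients and
inherits a Gaussian-type exponential moment from the innovations by convexity. The score sums
products of an innovation and a lagged value, which depends on the past only; once the lag is
truncated, each product is conditionally sub-Gaussian and `lintegral_exp_sum_le` multiplies the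
moment generating functions. Tails of order (n∨d)⁻⁴ pay for a union over at most 4(n∨d)³ events.

At the true local linear parameter the score is at most a constant times ζ†
(`RegPath.abs_score_le`): noise, Taylor bias over s coefficients, and the error of the estimated
path. Eigenvalue bounds pass from Ψ to the Gram matrix of the estimated path (`RegPath.wquad_ge`).
As ζ† = o(λ₁), the LASSO error lies in the cone with constant 3 and its square is of order sλ₁².

Summed over time, this preliminary error is below λ₂/2, so the SCAD weights are exactly 0 on the
true supports and exactly λ₂ off them (`RegPath.groupObj_eq`). Least squares restricted to the
supports has zero score there and, elsewhere, a score too small to outweigh the penalty; by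
convexity it is the only minimiser (`groupLS_oracle`). Its squared error is of order s(ζ†)² and its
ℓ¹-error of order sζ†.

The ℓ¹-bound puts the residuals within order ν† of the innovations. Local linear weights remove the
first-order bias, so the covariance estimate has error of order ν⋄ + ν† (`abs_sigmaHat_sub_le`),
uniformly in τ because passing from the grid to all τ costs only boundedly many summands. With λ₃ of
this order the true precision matrix is feasible for CLIME, and `clime_rates` converts entrywise
error and weak sparsity into the three rates. -/

namespace TVNet

/-! ### Probability tending to one and stochastic boundedness. -/

section StochasticOrders

variable {Ω : ℕ → Type*} [∀ n, MeasurableSpace (Ω n)] {μ : ∀ n, Measure (Ω n)}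

theorem WPA1.mono {P Q : ∀ n, Ω n → Prop} (h : WPA1 μ P)
    (hPQ : ∀ᶠ n in atTop, ∀ ω, P n ω → Q n ω) : WPA1 μ Q := by
  refine tendsto_of_tendsto_of_tendsto_of_le_of_le' tendsto_const_nhds h
    (Eventually.of_forall fun _ => zero_le) ?_
  filter_upwards [hPQ] with n hn
  exact measure_mono fun ω hω hP => hω (hn ω hP)

theorem WPA1.and {P Q : ∀ n, Ω n → Prop} (hP : WPA1 μ P) (hQ : WPA1 μ Q) :
    WPA1 μ (fun n ω => P n ω ∧ Q n ω) := by
  have h := Tendsto.add hP hQ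
  rw [add_zero] at h
  refine tendsto_of_tendsto_of_tendsto_of_le_of_le tendsto_const_nhds h
    (fun _ => zero_le) fun n => ?_
  refine (measure_mono fun ω hω => ?_).trans (measure_union_le _ _)
  by_contra hc
  simp only [mem_union, mem_ofPred_eq, not_or, not_not] at hc
  exact hω hc

theorem WPA1.of_ae {P : ∀ n, Ω n → Prop} (h : ∀ᶠ n in atTop, ∀ᵐ ω ∂(μ n), P n ω) :
    WPA1 μ P := by
  refine tendsto_const_nhds.congr' ?_
  filter_upwards [h] with n hn
  exact (ae_iff.1 hn).symm

/-- An event of positive probability is non-empty. Deterministic facts, such as signs of constants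
or inequalities between rates, are read off from probabilistic hypotheses in this way. -/
theorem WPA1.exists [∀ n, IsProbabilityMeasure (μ n)] {P : ∀ n, Ω n → Prop} (h : WPA1 μ P) :
    ∀ᶠ n in atTop, ∃ ω, P n ω := by
  have h1 : ∀ᶠ n in atTop, μ n {ω | ¬ P n ω} < 1 := (tendsto_order.1 h).2 1 zero_lt_one
  filter_upwards [h1] with n hn
  by_contra! hc
  have : {ω | ¬ P n ω} = univ := eq_univ_of_forall hc
  rw [this, measure_univ] at hn
  exact lt_irrefl _ hn

/-- One constant serves every η: the bounds below hold with probability tending to one, which is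
stronger than stochastic boundedness. -/
theorem BigOP.of_wpa1 {ι : ℕ → Type*} {Y : ∀ n, ι n → Ω n → ℝ} {R : ∀ n, Ω n → ℝ} (M : ℝ)
    (hM : 0 < M) (h : WPA1 μ (fun n ω => ∀ x, |Y n x ω| ≤ M * R n ω)) : BigOP μ Y R := by
  intro η hη
  refine ⟨M, hM, ?_⟩
  have := (tendsto_order.1 h).2 (ENNReal.ofReal η) (by simpa using hη)
  filter_upwards [this] with n hn using hn.le

/-- Union bound over finite index sets of growing cardinality. -/
theorem WPA1.forall_of_card {ι : ℕ → Type*} [∀ n, Fintype (ι n)] {P : ∀ n, ι n → Ω n → Prop}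
    (f : ℕ → ℝ) (hf : ∀ᶠ n in atTop, ∀ x, μ n {ω | ¬ P n x ω} ≤ ENNReal.ofReal (f n))
    (hlim : Tendsto (fun n => (Fintype.card (ι n) : ℝ) * f n) atTop (𝓝 0)) :
    WPA1 μ (fun n ω => ∀ x, P n x ω) := by
  have h0 : Tendsto (fun n => ENNReal.ofReal ((Fintype.card (ι n) : ℝ) * f n)) atTop (𝓝 0) := by
    simpa using ENNReal.tendsto_ofReal hlim
  refine tendsto_of_tendsto_of_tendsto_of_le_of_le' tendsto_const_nhds h0
    (Eventually.of_forall fun _ => zero_le) ?_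
  filter_upwards [hf] with n hn
  calc μ n {ω | ¬ ∀ x, P n x ω} = μ n (⋃ x, {ω | ¬ P n x ω}) := by
        congr 1; ext ω; simp
    _ ≤ ∑ x, μ n {ω | ¬ P n x ω} := measure_iUnion_fintype_le _ _
    _ ≤ ∑ _x : ι n, ENNReal.ofReal (f n) := Finset.sum_le_sum fun x _ => hn x
    _ = ENNReal.ofReal ((Fintype.card (ι n) : ℝ) * f n) := by
        rw [ENNReal.ofReal_mul (by positivity)]
        simp

end StochasticOrders

/-! ### Weighted least squares and the deterministic LASSO bound. -/

section LeastSquares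

variable {T ι : Type*} [Fintype ι]

/-- Weighted sum of squares. -/
def wls (I : Finset T) (k r : T → ℝ) (y : T → ι → ℝ) (θ : ι → ℝ) : ℝ :=
  ∑ t ∈ I, k t * (r t - θ ⬝ᵥ y t) ^ 2

/-- Minus one half of the gradient of `wls`. -/
def wlsScore (I : Finset T) (k r : T → ℝ) (y : T → ι → ℝ) (θ : ι → ℝ) (m : ι) : ℝ :=
  ∑ t ∈ I, k t * (r t - θ ⬝ᵥ y t) * y t m

/-- The quadratic form of weighted least squares. -/
def wquad (I : Finset T) (k : T → ℝ) (y : T → ι → ℝ) (v : ι → ℝ) : ℝ :=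
  ∑ t ∈ I, k t * (v ⬝ᵥ y t) ^ 2

/-- The expansion is exact and its quadratic part does not depend on θ, so comparing objectives
reduces to the score at one point and to `wquad`. -/
theorem wls_add (I : Finset T) (k r : T → ℝ) (y : T → ι → ℝ) (θ v : ι → ℝ) :
    wls I k r y (θ + v) = wls I k r y θ + wquad I k y v - 2 * (v ⬝ᵥ wlsScore I k r y θ) := by
  have h : v ⬝ᵥ wlsScore I k r y θ = ∑ t ∈ I, k t * (r t - θ ⬝ᵥ y t) * (v ⬝ᵥ y t) := by
    simp only [dotProduct, wlsScore, Finset.mul_sum]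
    rw [Finset.sum_comm]
    refine Finset.sum_congr rfl fun t _ => Finset.sum_congr rfl fun m _ => ?_
    ring
  rw [h, wls, wls, wquad, Finset.mul_sum, ← Finset.sum_add_distrib, ← Finset.sum_sub_distrib]
  refine Finset.sum_congr rfl fun t _ => ?_
  rw [add_dotProduct]
  ring

theorem abs_dotProduct_le (v g : ι → ℝ) {γ : ℝ} (hg : ∀ m, |g m| ≤ γ) :
    |v ⬝ᵥ g| ≤ γ * ∑ m, |v m| := by
  calc |v ⬝ᵥ g| ≤ ∑ m, |v m * g m| := Finset.abs_sum_le_sum_abs _ _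
    _ ≤ ∑ m, γ * |v m| := by
        refine Finset.sum_le_sum fun m _ => ?_
        rw [abs_mul, mul_comm]
        exact mul_le_mul_of_nonneg_right (hg m) (abs_nonneg _)
    _ = _ := by rw [Finset.mul_sum]

theorem sq_sum_abs_le_card (S : Finset ι) (v : ι → ℝ) :
    (∑ m ∈ S, |v m|) ^ 2 ≤ S.card * ∑ m, v m ^ 2 := by
  calc (∑ m ∈ S, |v m|) ^ 2 ≤ S.card * ∑ m ∈ S, |v m| ^ 2 := sq_sum_le_card_mul_sum_sq
    _ ≤ S.card * ∑ m, v m ^ 2 := by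
        refine mul_le_mul_of_nonneg_left ?_ (by positivity)
        simp only [sq_abs]
        exact Finset.sum_le_sum_of_subset_of_nonneg (Finset.subset_univ _)
          fun _ _ _ => sq_nonneg _

/-- From `κ ‖v‖² ≤ c |v_S|₁` to `‖v‖² ≤ |S| c² / κ²`. -/
theorem sum_sq_le_of_mul_le (S : Finset ι) (v : ι → ℝ) {κ c : ℝ} (hκ : 0 < κ)
    (h : κ * ∑ m, v m ^ 2 ≤ c * ∑ m ∈ S, |v m|) :
    ∑ m, v m ^ 2 ≤ S.card * c ^ 2 / κ ^ 2 := by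
  have h0 : 0 ≤ ∑ m, v m ^ 2 := Finset.sum_nonneg fun _ _ => sq_nonneg _
  have h1 := sq_sum_abs_le_card S v
  -- A factor ‖v‖² is cancelled at the end, hence the separate case v = 0.
  rcases h0.eq_or_lt with h2 | h2
  · rw [← h2]; positivity
  have h3 : (κ * ∑ m, v m ^ 2) ^ 2 ≤ c ^ 2 * (S.card * ∑ m, v m ^ 2) := by
    calc (κ * ∑ m, v m ^ 2) ^ 2 ≤ (c * ∑ m ∈ S, |v m|) ^ 2 :=
          pow_le_pow_left₀ (by positivity) h 2
      _ = c ^ 2 * (∑ m ∈ S, |v m|) ^ 2 := by ring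
      _ ≤ _ := mul_le_mul_of_nonneg_left h1 (sq_nonneg c)
  rw [le_div_iff₀ (by positivity)]
  refine le_of_mul_le_mul_right ?_ h2
  nlinarith

/-- Error bound for the LASSO under a restricted eigenvalue condition with cone constant `3`. -/
theorem lasso_error (I : Finset T) (k r : T → ℝ) (y : T → ι → ℝ) {lam κ : ℝ} (hκ : 0 < κ)
    (hlam : 0 < lam) (S : Finset ι) (θ₀ θ : ι → ℝ) (hS : ∀ m ∉ S, θ₀ m = 0)
    (hg : ∀ m, |wlsScore I k r y θ₀ m| ≤ lam / 6)
    (hmin : wls I k r y θ + lam * ∑ m, |θ m| ≤ wls I k r y θ₀ + lam * ∑ m, |θ₀ m|)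
    (hk : ∀ t ∈ I, 0 ≤ k t)
    (hRE : ∀ v : ι → ℝ, ∑ m, |v m| ≤ 3 * ∑ m ∈ S, |v m| → κ * ∑ m, v m ^ 2 ≤ wquad I k y v) :
    ∑ m, (θ m - θ₀ m) ^ 2 ≤ S.card * (4 / 3 * lam) ^ 2 / κ ^ 2 := by
  classical
  set v : ι → ℝ := θ - θ₀ with hv
  have hθ : θ = θ₀ + v := by simp [hv]
  have hq0 : 0 ≤ wquad I k y v :=
    Finset.sum_nonneg fun t ht => mul_nonneg (hk t ht) (sq_nonneg _)
  have h1 := wls_add I k r y θ₀ v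
  rw [← hθ] at h1
  have h2 := abs_le.1 (abs_dotProduct_le v _ hg)
  have hsplit : ∀ f : ι → ℝ, ∑ m, f m = ∑ m ∈ S, f m + ∑ m ∈ Sᶜ, f m := fun f =>
    (Finset.sum_add_sum_compl S f).symm
  -- Off S the target vanishes and the penalty of θ is that of v; on S the penalty drops by at most
  -- |v|.
  have h3 : ∑ m, |θ₀ m| - ∑ m, |θ m| ≤ ∑ m ∈ S, |v m| - ∑ m ∈ Sᶜ, |v m| := by
    rw [hsplit (fun m => |θ₀ m|), hsplit (fun m => |θ m|)]
    have ha : ∑ m ∈ Sᶜ, |θ₀ m| = 0 := Finset.sum_eq_zero fun m hm => by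
      simp [hS m (Finset.mem_compl.1 hm)]
    have hb : ∑ m ∈ Sᶜ, |θ m| = ∑ m ∈ Sᶜ, |v m| := Finset.sum_congr rfl fun m hm => by
      simp [hv, hS m (Finset.mem_compl.1 hm)]
    have hc : ∑ m ∈ S, |θ₀ m| - ∑ m ∈ S, |θ m| ≤ ∑ m ∈ S, |v m| := by
      rw [← Finset.sum_sub_distrib]
      refine Finset.sum_le_sum fun m _ => ?_
      have := abs_sub_abs_le_abs_sub (θ₀ m) (θ m)
      rw [abs_sub_comm] at this
      simpa [hv] using this
    linarith
  -- The score costs 2·(λ/6) per unit of ‖v‖₁, giving 1 + 1/3 on S and −1 + 1/3 off S. Since the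
  -- form is nonnegative, the mass of v off S is at most twice that on S, which is the cone with
  -- constant 3; outside the cone there is a contradiction.
  have h4 : wquad I k y v ≤ 4 / 3 * lam * ∑ m ∈ S, |v m| - 2 / 3 * lam * ∑ m ∈ Sᶜ, |v m| := by
    have h5 := hsplit (fun m => |v m|)
    nlinarith [mul_le_mul_of_nonneg_left h3 hlam.le]
  have hS0 : 0 ≤ ∑ m ∈ S, |v m| := Finset.sum_nonneg fun _ _ => abs_nonneg _
  have hSc0 : 0 ≤ ∑ m ∈ Sᶜ, |v m| := Finset.sum_nonneg fun _ _ => abs_nonneg _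
  have hgoal : κ * ∑ m, v m ^ 2 ≤ 4 / 3 * lam * ∑ m ∈ S, |v m| := by
    by_cases hcone : ∑ m, |v m| ≤ 3 * ∑ m ∈ S, |v m|
    · have := hRE v hcone
      nlinarith [mul_nonneg hlam.le hSc0]
    · rw [hsplit] at hcone
      push Not at hcone
      nlinarith
  exact sum_sq_le_of_mul_le S v hκ hgoal

end LeastSquares


/-! ### The Euclidean norm of a finite family. -/

theorem l2_nonneg {ι : Type*} [Fintype ι] (v : ι → ℝ) : 0 ≤ l2 v := Real.sqrt_nonneg _

theorem l2_sq {ι : Type*} [Fintype ι] (v : ι → ℝ) : l2 v ^ 2 = ∑ m, v m ^ 2 :=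
  Real.sq_sqrt (Finset.sum_nonneg fun _ _ => sq_nonneg _)

theorem l2_le_of_sq_le {ι : Type*} [Fintype ι] {v : ι → ℝ} {r : ℝ} (hr : 0 ≤ r)
    (h : ∑ m, v m ^ 2 ≤ r ^ 2) : l2 v ≤ r := Real.sqrt_le_iff.2 ⟨hr, h⟩

theorem l2_le_of_abs_le {ι : Type*} [Fintype ι] {v : ι → ℝ} {c : ℝ} (hc : 0 ≤ c)
    (h : ∀ m, |v m| ≤ c) : l2 v ≤ √(Fintype.card ι) * c := by
  refine l2_le_of_sq_le (by positivity) ?_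
  rw [mul_pow, Real.sq_sqrt (by positivity)]
  calc ∑ m, v m ^ 2 ≤ ∑ _m : ι, c ^ 2 := Finset.sum_le_sum fun m _ =>
        sq_le_sq.2 (by rw [abs_of_nonneg hc]; exact h m)
    _ = _ := by simp

theorem l2_eq_norm {ι : Type*} [Fintype ι] (v : ι → ℝ) : l2 v = ‖WithLp.toLp 2 v‖ := by
  simp [l2, EuclideanSpace.norm_eq]

theorem abs_dotProduct_le_l2 {ι : Type*} [Fintype ι] (u v : ι → ℝ) :
    |u ⬝ᵥ v| ≤ l2 u * l2 v := by
  refine abs_le_of_sq_le_sq ?_ (mul_nonneg (l2_nonneg _) (l2_nonneg _))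
  rw [mul_pow, l2_sq, l2_sq]
  exact Finset.sum_mul_sq_le_sq_mul_sq _ _ _

theorem l2_add_le {ι : Type*} [Fintype ι] (u v : ι → ℝ) : l2 (u + v) ≤ l2 u + l2 v := by
  simp only [l2_eq_norm, WithLp.toLp_add]
  exact norm_add_le _ _

theorem l2_eq_zero {ι : Type*} [Fintype ι] {v : ι → ℝ} (h : l2 v = 0) : v = 0 := by
  rw [l2_eq_norm, norm_eq_zero] at h
  simpa using h

/-! ### Restricted least squares and the oracle property of the group LASSO. -/

section LeastSquares

variable {T ι : Type*} [Fintype ι]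

/-- Normal equations of least squares restricted to the coordinates in `S`. -/
theorem exists_restricted_solution (I : Finset T) (k : T → ℝ) (y : T → ι → ℝ) {κ : ℝ}
    (hκ : 0 < κ) (S : Finset ι)
    (hRE : ∀ v : ι → ℝ, (∀ m ∉ S, v m = 0) → κ * ∑ m, v m ^ 2 ≤ wquad I k y v) (g : ι → ℝ) :
    ∃ v : ι → ℝ, (∀ m ∉ S, v m = 0) ∧ ∀ m ∈ S, ∑ t ∈ I, k t * (v ⬝ᵥ y t) * y t m = g m := by
  classical
  let ext : (S → ℝ) →ₗ[ℝ] (ι → ℝ) :=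
    { toFun := fun w m => if h : m ∈ S then w ⟨m, h⟩ else 0
      map_add' := fun a b => by ext m; by_cases h : m ∈ S <;> simp [h]
      map_smul' := fun c a => by ext m; by_cases h : m ∈ S <;> simp [h] }
  have hext0 : ∀ w, ∀ m ∉ S, ext w m = 0 := fun w m hm => by simp [ext, hm]
  have hext1 : ∀ w (m : S), ext w m = w m := fun w m => by simp [ext]
  let G : (S → ℝ) →ₗ[ℝ] (S → ℝ) :=
    { toFun := fun w m => ∑ t ∈ I, k t * (ext w ⬝ᵥ y t) * y t m
      map_add' := fun a b => by
        ext m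
        simp only [map_add, add_dotProduct, Pi.add_apply, ← Finset.sum_add_distrib]
        exact Finset.sum_congr rfl fun t _ => by ring
      map_smul' := fun c a => by
        ext m
        simp only [map_smul, smul_dotProduct, Pi.smul_apply, smul_eq_mul, RingHom.id_apply,
          Finset.mul_sum]
        exact Finset.sum_congr rfl fun t _ => by ring }
  -- Pairing G w with w gives the quadratic form at the extension of w, so the eigenvalue bound
  -- makes the kernel trivial; in finite dimension this yields surjectivity.
  have hinj : Function.Injective G := by
    refine (injective_iff_map_eq_zero G).2 fun w hw => ?_
    have h1 : wquad I k y (ext w) = ∑ m : S, w m * G w m := by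
      have hdot : ∀ t, ext w ⬝ᵥ y t = ∑ m : S, w m * y t m := fun t => by
        rw [dotProduct, ← Finset.sum_subset (Finset.subset_univ S)
          (fun m _ hm => by rw [hext0 w m hm, zero_mul]), ← Finset.sum_coe_sort S]
        exact Finset.sum_congr rfl fun m _ => by rw [hext1]
      calc wquad I k y (ext w)
          = ∑ t ∈ I, ∑ m : S, w m * (k t * (ext w ⬝ᵥ y t) * y t m) := by
            refine Finset.sum_congr rfl fun t _ => ?_
            rw [pow_two]
            nth_rewrite 2 [hdot t]
            rw [Finset.mul_sum, Finset.mul_sum]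
            exact Finset.sum_congr rfl fun m _ => by ring
        _ = ∑ m : S, w m * G w m := by
            rw [Finset.sum_comm]
            exact Finset.sum_congr rfl fun m _ => by rw [← Finset.mul_sum]; rfl
    have h2 := hRE (ext w) (hext0 w)
    rw [h1, hw] at h2
    simp only [Pi.zero_apply, mul_zero, Finset.sum_const_zero] at h2
    have h3 : ∑ m, ext w m ^ 2 ≤ 0 := by
      by_contra! hc
      nlinarith
    ext m
    have h4 := (Finset.sum_eq_zero_iff_of_nonneg (fun m _ => sq_nonneg (ext w m))).1
      (le_antisymm h3 (Finset.sum_nonneg fun _ _ => sq_nonneg _)) m (Finset.mem_univ _)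
    rw [hext1] at h4
    simpa using h4
  obtain ⟨w, hw⟩ := (LinearMap.injective_iff_surjective.1 hinj) (fun m => g m)
  exact ⟨ext w, hext0 w, fun m hm => congrFun hw ⟨m, hm⟩⟩

/-- The error of the least squares estimate restricted to `S`, and its score. -/
theorem exists_oracle (I : Finset T) (k r : T → ℝ) (y : T → ι → ℝ) {κ γ Γ : ℝ}
    (hκ : 0 < κ) (hγ : 0 ≤ γ) (S : Finset ι) (θ₀ : ι → ℝ) (hS : ∀ m ∉ S, θ₀ m = 0)
    (hRE : ∀ v : ι → ℝ, (∀ m ∉ S, v m = 0) → κ * ∑ m, v m ^ 2 ≤ wquad I k y v)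
    (hg : ∀ m, |wlsScore I k r y θ₀ m| ≤ γ)
    (hΓ : ∀ m m', |∑ t ∈ I, k t * y t m * y t m'| ≤ Γ) :
    ∃ θ : ι → ℝ, (∀ m ∉ S, θ m = 0) ∧ (∀ m ∈ S, wlsScore I k r y θ m = 0) ∧
      (∀ m, |wlsScore I k r y θ m| ≤ γ + Γ * (S.card * γ / κ)) ∧
      ∑ m, (θ m - θ₀ m) ^ 2 ≤ S.card * γ ^ 2 / κ ^ 2 ∧
      ∑ m, |θ m - θ₀ m| ≤ S.card * γ / κ := by
  classical
  -- The increment solves the normal equations with the score at θ₀ on the right, so the score at θ₀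
  -- + v vanishes on S.
  obtain ⟨v, hv0, hv⟩ := exists_restricted_solution I k y hκ S hRE (wlsScore I k r y θ₀)
  have hscore : ∀ m, wlsScore I k r y (θ₀ + v) m
      = wlsScore I k r y θ₀ m - ∑ t ∈ I, k t * (v ⬝ᵥ y t) * y t m := fun m => by
    simp only [wlsScore, add_dotProduct, ← Finset.sum_sub_distrib]
    exact Finset.sum_congr rfl fun t _ => by ring
  have hl1S : ∑ m, |v m| = ∑ m ∈ S, |v m| :=
    (Finset.sum_subset (Finset.subset_univ S) fun m _ hm => by rw [hv0 m hm, abs_zero]).symm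
  have hquad : wquad I k y v = ∑ m ∈ S, v m * wlsScore I k r y θ₀ m := by
    have h0 : ∀ t, v ⬝ᵥ y t = ∑ m ∈ S, v m * y t m := fun t =>
      (Finset.sum_subset (Finset.subset_univ S) fun m _ hm => by rw [hv0 m hm, zero_mul]).symm
    calc wquad I k y v = ∑ t ∈ I, ∑ m ∈ S, v m * (k t * (v ⬝ᵥ y t) * y t m) := by
          refine Finset.sum_congr rfl fun t _ => ?_
          rw [pow_two]
          nth_rewrite 2 [h0 t]
          rw [Finset.mul_sum, Finset.mul_sum]
          exact Finset.sum_congr rfl fun m _ => by ring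
      _ = _ := by
          rw [Finset.sum_comm]
          exact Finset.sum_congr rfl fun m hm => by rw [← Finset.mul_sum, hv m hm]
  have hbasic : κ * ∑ m, v m ^ 2 ≤ γ * ∑ m ∈ S, |v m| := by
    refine (hRE v hv0).trans ?_
    rw [hquad, Finset.mul_sum]
    refine Finset.sum_le_sum fun m _ => (le_abs_self _).trans ?_
    rw [abs_mul, mul_comm]
    exact mul_le_mul_of_nonneg_right (hg m) (abs_nonneg _)
  have hl2 := sum_sq_le_of_mul_le S v hκ hbasic
  have hl1 : ∑ m, |v m| ≤ S.card * γ / κ := by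
    rw [hl1S]
    refine abs_le_of_sq_le_sq' ?_ (by positivity) |>.2
    calc (∑ m ∈ S, |v m|) ^ 2 ≤ S.card * ∑ m, v m ^ 2 := sq_sum_abs_le_card S v
      _ ≤ S.card * (S.card * γ ^ 2 / κ ^ 2) := by gcongr
      _ = (S.card * γ / κ) ^ 2 := by ring
  refine ⟨θ₀ + v, fun m hm => by simp [hS m hm, hv0 m hm], fun m hm => ?_, fun m => ?_, ?_, ?_⟩
  · rw [hscore, hv m hm, sub_self]
  · rw [hscore]
    refine (abs_sub _ _).trans (add_le_add (hg m) ?_)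
    -- The score changes by the Gram matrix applied to v, hence by at most Γ per unit of ‖v‖₁.
    have h1 : ∑ t ∈ I, k t * (v ⬝ᵥ y t) * y t m
        = v ⬝ᵥ fun m' => ∑ t ∈ I, k t * y t m' * y t m := by
      simp only [dotProduct, Finset.mul_sum, Finset.sum_mul]
      rw [Finset.sum_comm]
      exact Finset.sum_congr rfl fun m' _ => Finset.sum_congr rfl fun t _ => by ring
    rw [h1]
    have hΓ0 : 0 ≤ Γ := (abs_nonneg _).trans (hΓ m m)
    exact (abs_dotProduct_le v _ fun m' => hΓ m' m).trans
      (mul_le_mul_of_nonneg_left hl1 hΓ0)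
  · simpa using hl2
  · simpa using hl1

variable {Tm : Type*} [Fintype Tm]

open scoped Classical in
/-- Sum of local least squares objectives with a group penalty on the coordinates off `S`. -/
noncomputable def groupLS (I : Finset T) (k r : Tm → T → ℝ) (y : Tm → T → ι → ℝ) (lam : ℝ) (S : Finset ι)
    (θ : Tm → ι → ℝ) : ℝ :=
  ∑ t, wls I (k t) (r t) (y t) (θ t) + ∑ m, if m ∈ S then 0 else lam * l2 fun t => θ t m

/-- Oracle property of the weighted group LASSO: the least squares estimates restricted to the
coordinates in `S` jointly form the only minimiser. -/
theorem groupLS_oracle (I : Finset T) (k r : Tm → T → ℝ) (y : Tm → T → ι → ℝ) {κ γ Γ lam : ℝ}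
    (hκ : 0 < κ) (hγ : 0 ≤ γ) (S : Finset ι) (θ₀ : Tm → ι → ℝ) (hS : ∀ t, ∀ m ∉ S, θ₀ t m = 0)
    (hk : ∀ t, ∀ s ∈ I, 0 ≤ k t s)
    (hRE : ∀ t, ∀ v : ι → ℝ, (∀ m ∉ S, v m = 0) → κ * ∑ m, v m ^ 2 ≤ wquad I (k t) (y t) v)
    (hg : ∀ t m, |wlsScore I (k t) (r t) (y t) (θ₀ t) m| ≤ γ)
    (hΓ : ∀ t m m', |∑ s ∈ I, k t s * y t s m * y t s m'| ≤ Γ) (hΓ0 : 0 ≤ Γ)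
    (hlam : 2 * (√(Fintype.card Tm) * (γ + Γ * (S.card * γ / κ))) < lam) :
    ∃ θ : Tm → ι → ℝ,
      (∀ p, IsMinimiser (groupLS I k r y lam S) univ p ↔ p = θ) ∧
      (∀ p, IsMinimiser (groupLS I k r y lam S) {p | ∀ t, ∀ m ∉ S, p t m = 0} p ↔ p = θ) ∧
      (∀ t, ∑ m, (θ t m - θ₀ t m) ^ 2 ≤ S.card * γ ^ 2 / κ ^ 2) ∧
      ∀ t, ∑ m, |θ t m - θ₀ t m| ≤ S.card * γ / κ := by
  classical
  choose θ h0 h1 h2 h3 h4 using fun t => exists_oracle I (k t) (r t) (y t) hκ hγ S (θ₀ t) (hS t)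
    (hRE t) (hg t) (hΓ t)
  set c : ℝ := 2 * (√(Fintype.card Tm) * (γ + Γ * (S.card * γ / κ))) with hc
  have hscore : ∀ m, l2 (fun t => wlsScore I (k t) (r t) (y t) (θ t) m) ≤ c / 2 := fun m =>
    (l2_le_of_abs_le (by positivity) fun t => h2 t m).trans (by rw [hc]; linarith)
  -- the increment of the objective
  have hkey : ∀ D : Tm → ι → ℝ, groupLS I k r y lam S θ + ∑ t, wquad I (k t) (y t) (D t)
      + ∑ m, (if m ∈ S then 0 else (lam - c) * l2 fun t => D t m)
      ≤ groupLS I k r y lam S (θ + D) := by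
    intro D
    have ha : ∑ t, wls I (k t) (r t) (y t) ((θ + D) t)
        = ∑ t, wls I (k t) (r t) (y t) (θ t) + ∑ t, wquad I (k t) (y t) (D t)
          - 2 * ∑ m, ∑ t, D t m * wlsScore I (k t) (r t) (y t) (θ t) m := by
      rw [Finset.sum_comm, Finset.mul_sum, ← Finset.sum_add_distrib, ← Finset.sum_sub_distrib]
      exact Finset.sum_congr rfl fun t _ => wls_add _ _ _ _ _ _
    have hb : ∀ m, ((if m ∈ S then 0 else lam * l2 fun t => θ t m)
        + if m ∈ S then 0 else (lam - c) * l2 fun t => D t m)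
        ≤ (if m ∈ S then 0 else lam * l2 fun t => (θ + D) t m)
          - 2 * ∑ t, D t m * wlsScore I (k t) (r t) (y t) (θ t) m := by
      intro m
      by_cases hm : m ∈ S
      · simp [hm, h1 _ m hm]
      -- Off S the restricted estimate is zero, so the penalty grows by the full λ‖D_m‖; by
      -- Cauchy–Schwarz over time the score takes back at most c‖D_m‖.
      · have hz : ∀ t, θ t m = 0 := fun t => h0 t m hm
        have hz' : l2 (fun _ : Tm => (0 : ℝ)) = 0 := by simp [l2]
        simp only [hm, if_false, Pi.add_apply, hz, zero_add, hz', mul_zero]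
        have h5 := (abs_le.1 (abs_dotProduct_le_l2 (fun t => D t m)
          (fun t => wlsScore I (k t) (r t) (y t) (θ t) m))).2
        rw [dotProduct] at h5
        nlinarith [mul_le_mul_of_nonneg_left (hscore m) (l2_nonneg fun t => D t m)]
    have hb' := Finset.sum_le_sum fun m (_ : m ∈ Finset.univ) => hb m
    rw [Finset.sum_add_distrib, Finset.sum_sub_distrib, ← Finset.mul_sum] at hb'
    rw [groupLS, groupLS, ha]
    linarith
  have hq : ∀ D : Tm → ι → ℝ, ∀ t, 0 ≤ wquad I (k t) (y t) (D t) := fun D t =>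
    Finset.sum_nonneg fun s hs => mul_nonneg (hk t s hs) (sq_nonneg _)
  have hpen : ∀ D : Tm → ι → ℝ, ∀ m,
      0 ≤ if m ∈ S then 0 else (lam - c) * l2 fun t => D t m := fun D m => by
    split_ifs
    · exact le_rfl
    · exact mul_nonneg (by linarith) (l2_nonneg _)
  have hmin : ∀ p, groupLS I k r y lam S θ ≤ groupLS I k r y lam S p := fun p => by
    have := hkey (p - θ)
    rw [add_sub_cancel] at this
    have e1 := Finset.sum_nonneg fun t (_ : t ∈ Finset.univ) => hq (p - θ) t
    have e2 := Finset.sum_nonneg fun m (_ : m ∈ Finset.univ) => hpen (p - θ) m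
    linarith
  -- A competitor that does no worse makes both nonnegative parts of the increment vanish: the
  -- penalty part removes the coordinates off S, after which the eigenvalue bound applies to the
  -- quadratic part.
  have huniq : ∀ p, groupLS I k r y lam S p ≤ groupLS I k r y lam S θ → p = θ := fun p hp => by
    have := hkey (p - θ)
    rw [add_sub_cancel] at this
    have e1 := Finset.sum_nonneg fun t (_ : t ∈ Finset.univ) => hq (p - θ) t
    have e2 := Finset.sum_nonneg fun m (_ : m ∈ Finset.univ) => hpen (p - θ) m
    have f1 := (Finset.sum_eq_zero_iff_of_nonneg fun t _ => hq (p - θ) t).1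
      (le_antisymm (by linarith) e1)
    have f2 := (Finset.sum_eq_zero_iff_of_nonneg fun m _ => hpen (p - θ) m).1
      (le_antisymm (by linarith) e2)
    have hD : ∀ t, ∀ m ∉ S, (p - θ) t m = 0 := fun t m hm => by
      have h5 := f2 m (Finset.mem_univ _)
      simp only [hm, if_false] at h5
      have h6 : l2 (fun t => (p - θ) t m) = 0 := by
        rcases mul_eq_zero.1 h5 with h | h
        · linarith
        · exact h
      exact congrFun (l2_eq_zero h6) t
    ext t m
    have h7 := hRE t ((p - θ) t) (hD t)
    rw [f1 t (Finset.mem_univ _)] at h7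
    have h8 : ∑ m, (p - θ) t m ^ 2 ≤ 0 := by
      by_contra! hc
      nlinarith
    have h9 := (Finset.sum_eq_zero_iff_of_nonneg (fun m _ => sq_nonneg ((p - θ) t m))).1
      (le_antisymm h8 (Finset.sum_nonneg fun _ _ => sq_nonneg _)) m (Finset.mem_univ _)
    have h10 : (p - θ) t m = 0 := by simpa using h9
    simpa [sub_eq_zero] using h10
  refine ⟨θ, fun p => ⟨fun hp => huniq p (hp.2 θ (mem_univ _)), ?_⟩,
    fun p => ⟨fun hp => huniq p (hp.2 θ h0), ?_⟩, h3, h4⟩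
  · rintro rfl
    exact ⟨mem_univ _, fun q _ => hmin q⟩
  · rintro rfl
    exact ⟨h0, fun q _ => hmin q⟩

end LeastSquares


/-! ### Operator norms, the Schur test and matrix square roots. -/

section Matrices

variable {d : ℕ}

theorem l2_mulVec_le (W : Matrix (Fin d) (Fin d) ℝ) (v : Fin d → ℝ) :
    l2 (W *ᵥ v) ≤ opNorm W * l2 v := by
  have := (Matrix.toEuclideanCLM (n := Fin d) (𝕜 := ℝ) W).le_opNorm (WithLp.toLp 2 v)
  rw [Matrix.toEuclideanCLM_toLp] at this
  rw [l2_eq_norm, l2_eq_norm]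
  exact this

theorem opNorm_nonneg (W : Matrix (Fin d) (Fin d) ℝ) : 0 ≤ opNorm W := norm_nonneg _

theorem abs_apply_le_l2 {ι : Type*} [Fintype ι] (v : ι → ℝ) (i : ι) : |v i| ≤ l2 v := by
  refine Real.abs_le_sqrt ?_
  exact Finset.single_le_sum (f := fun i => v i ^ 2) (fun _ _ => sq_nonneg _) (Finset.mem_univ i)

/-- Applying W to its own i-th row produces the squared norm of that row in coordinate i; dividing
by the norm gives the bound. -/
theorem l2_row_le (W : Matrix (Fin d) (Fin d) ℝ) (i : Fin d) : l2 (W i) ≤ opNorm W := by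
  have h1 : l2 (W i) ^ 2 = (W *ᵥ W i) i := by
    rw [l2_sq]; simp [Matrix.mulVec, dotProduct, pow_two]
  have h2 : (W *ᵥ W i) i ≤ opNorm W * l2 (W i) :=
    (le_abs_self _).trans ((abs_apply_le_l2 _ i).trans (l2_mulVec_le _ _))
  rcases (l2_nonneg (W i)).eq_or_lt with h | h
  · rw [← h]; exact opNorm_nonneg W
  · rw [← h1] at h2
    nlinarith

theorem abs_entry_le_opNorm (W : Matrix (Fin d) (Fin d) ℝ) (i j : Fin d) :
    |W i j| ≤ opNorm W := (abs_apply_le_l2 (W i) j).trans (l2_row_le W i)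

/-- Schur test for symmetric matrices. -/
theorem opNorm_le_of_row_sum (W : Matrix (Fin d) (Fin d) ℝ) (hW : ∀ i j, W i j = W j i) {c : ℝ}
    (hc : 0 ≤ c) (h : ∀ i, ∑ j, |W i j| ≤ c) : opNorm W ≤ c := by
  refine ContinuousLinearMap.opNorm_le_bound _ hc fun v => ?_
  obtain ⟨v, rfl⟩ := WithLp.toLp_surjective 2 v
  rw [Matrix.toEuclideanCLM_toLp, ← l2_eq_norm, ← l2_eq_norm]
  refine l2_le_of_sq_le (mul_nonneg hc (l2_nonneg _)) ?_
  rw [mul_pow, l2_sq]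
  calc ∑ i, (W *ᵥ v) i ^ 2 ≤ ∑ i, c * ∑ j, |W i j| * v j ^ 2 := by
        refine Finset.sum_le_sum fun i _ => ?_
        -- Cauchy–Schwarz with |w_ij| split into two square roots.
        have h1 : (W *ᵥ v) i ^ 2 ≤ (∑ j, |W i j|) * ∑ j, |W i j| * v j ^ 2 := by
          have h2 := Finset.sum_sq_le_sum_mul_sum_of_sq_le_mul (Finset.univ : Finset (Fin d))
            (r := fun j => W i j * v j) (f := fun j => |W i j|)
            (g := fun j => |W i j| * v j ^ 2) (fun _ _ => abs_nonneg _)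
            (fun _ _ => by positivity) (fun j _ => by
              rw [mul_pow, ← sq_abs (W i j)]; exact le_of_eq (by ring))
          exact h2
        refine h1.trans (mul_le_mul_of_nonneg_right (h i) ?_)
        exact Finset.sum_nonneg fun _ _ => by positivity
    _ = c * ∑ j, (∑ i, |W j i|) * v j ^ 2 := by
        rw [← Finset.mul_sum, Finset.sum_comm]
        congr 1
        refine Finset.sum_congr rfl fun j _ => ?_
        rw [Finset.sum_mul]
        exact Finset.sum_congr rfl fun i _ => by rw [hW]
    _ ≤ c * ∑ j, c * v j ^ 2 := by
        gcongr with j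
        exact h j
    _ = c ^ 2 * ∑ j, v j ^ 2 := by rw [← Finset.mul_sum]; ring

open scoped MatrixOrder in
theorem matSqrt_mul_self {W : Matrix (Fin d) (Fin d) ℝ} (hW : W.PosSemidef) :
    matSqrt W * matSqrt W = W := by
  rw [matSqrt]
  exact CFC.sqrt_mul_sqrt_self W hW.nonneg

open scoped MatrixOrder in
theorem matSqrt_transpose (W : Matrix (Fin d) (Fin d) ℝ) : (matSqrt W)ᵀ = matSqrt W := by
  have h : (matSqrt W).PosSemidef := by
    rw [matSqrt, ← Matrix.nonneg_iff_posSemidef]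
    exact CFC.sqrt_nonneg W
  have := h.isHermitian
  rwa [Matrix.IsHermitian, Matrix.conjTranspose_eq_transpose_of_trivial] at this

/-- Rows of `W Σ^{1/2}` have Euclidean norm at most `‖W‖ ‖Σ‖^{1/2}`. -/
theorem l2_row_mul_matSqrt_le (W : Matrix (Fin d) (Fin d) ℝ) {S : Matrix (Fin d) (Fin d) ℝ}
    (hS : S.PosSemidef) (i : Fin d) : l2 ((W * matSqrt S) i) ≤ opNorm W * √(opNorm S) := by
  refine l2_le_of_sq_le (mul_nonneg (opNorm_nonneg _) (Real.sqrt_nonneg _)) ?_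
  rw [mul_pow, Real.sq_sqrt (opNorm_nonneg _)]
  have h1 : ∑ m, (W * matSqrt S) i m ^ 2 = W i ⬝ᵥ (S *ᵥ W i) := by
    have e1 : (W * matSqrt S) i = matSqrt S *ᵥ W i := by
      rw [← Matrix.vecMul_transpose, matSqrt_transpose]; rfl
    have e2 : ∑ m, (W * matSqrt S) i m ^ 2
        = (matSqrt S *ᵥ W i) ⬝ᵥ (matSqrt S *ᵥ W i) := by
      rw [e1]; simp [dotProduct, pow_two]
    rw [e2, Matrix.dotProduct_mulVec, Matrix.vecMul_mulVec, ← Matrix.dotProduct_mulVec,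
      matSqrt_transpose, matSqrt_mul_self hS]
  rw [h1]
  have h2 := l2_row_le W i
  calc W i ⬝ᵥ (S *ᵥ W i) ≤ l2 (W i) * l2 (S *ᵥ W i) :=
        (le_abs_self _).trans (abs_dotProduct_le_l2 _ _)
    _ ≤ l2 (W i) * (opNorm S * l2 (W i)) :=
        mul_le_mul_of_nonneg_left (l2_mulVec_le _ _) (l2_nonneg _)
    _ = l2 (W i) ^ 2 * opNorm S := by ring
    _ ≤ opNorm W ^ 2 * opNorm S := by
        gcongr
        · exact opNorm_nonneg S
        · exact l2_nonneg _

theorem one_le_opNorm_one (i : Fin d) : 1 ≤ opNorm (1 : Matrix (Fin d) (Fin d) ℝ) := by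
  have := abs_entry_le_opNorm (1 : Matrix (Fin d) (Fin d) ℝ) i i
  simpa using this

end Matrices

/-! ### Second-order Taylor bounds on the unit interval. -/

section Taylor

variable {f : ℝ → ℝ} {M : ℝ}

theorem abs_derivWithin_sub_le (hf : ContDiffOn ℝ 2 f (Icc 0 1))
    (hM : ∀ τ ∈ Icc (0 : ℝ) 1, |iteratedDerivWithin 2 f (Icc 0 1) τ| ≤ M) {x y : ℝ}
    (hx : x ∈ Icc (0 : ℝ) 1) (hy : y ∈ Icc (0 : ℝ) 1) :
    |derivWithin f (Icc 0 1) x - derivWithin f (Icc 0 1) y| ≤ M * |x - y| := by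
  have hu : UniqueDiffOn ℝ (Icc (0 : ℝ) 1) := uniqueDiffOn_Icc zero_lt_one
  have h1 : ContDiffOn ℝ 1 (derivWithin f (Icc 0 1)) (Icc 0 1) :=
    hf.derivWithin hu (by norm_num)
  have h2 := (convex_Icc (0 : ℝ) 1).norm_image_sub_le_of_norm_derivWithin_le
    (f := derivWithin f (Icc 0 1)) (C := M) (h1.differentiableOn (by norm_num))
    (fun z hz => by
      have := hM z hz
      rw [iteratedDerivWithin_succ, iteratedDerivWithin_one] at this
      exact this) hy hx
  simpa using h2

/-- The function z ↦ f z − f′(y) z has derivative of modulus at most M|x − y| between y and x, and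
the mean value inequality applies. The factor 1/2 of the sharp remainder plays no role. -/
theorem abs_taylor_le (hf : ContDiffOn ℝ 2 f (Icc 0 1))
    (hM : ∀ τ ∈ Icc (0 : ℝ) 1, |iteratedDerivWithin 2 f (Icc 0 1) τ| ≤ M) {x y : ℝ}
    (hx : x ∈ Icc (0 : ℝ) 1) (hy : y ∈ Icc (0 : ℝ) 1) :
    |f x - f y - derivWithin f (Icc 0 1) y * (x - y)| ≤ M * (x - y) ^ 2 := by
  have hM0 : 0 ≤ M := (abs_nonneg _).trans (hM x hx)
  set c := derivWithin f (Icc 0 1) y with hc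
  have hsub : uIcc y x ⊆ Icc 0 1 := uIcc_subset_Icc hy hx
  have hd : ∀ z ∈ uIcc y x, HasDerivWithinAt (fun z => f z - c * z)
      (derivWithin f (Icc 0 1) z - c) (uIcc y x) z := fun z hz => by
    have h1 : HasDerivWithinAt f (derivWithin f (Icc 0 1) z) (Icc 0 1) z :=
      ((hf.differentiableOn (by norm_num)) z (hsub hz)).hasDerivWithinAt
    have h2 : HasDerivWithinAt (fun z : ℝ => c * z) c (uIcc y x) z := by
      simpa using (hasDerivWithinAt_id z (uIcc y x)).const_mul c
    exact (h1.mono hsub).sub h2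
  have h3 := (convex_uIcc y x).norm_image_sub_le_of_norm_hasDerivWithin_le
    (f := fun z => f z - c * z) (C := M * |x - y|) hd (fun z hz => by
      refine (abs_derivWithin_sub_le hf hM (hsub hz) hy).trans ?_
      refine mul_le_mul_of_nonneg_left ?_ hM0
      exact abs_sub_left_of_mem_uIcc hz) left_mem_uIcc right_mem_uIcc
  have e : f x - c * x - (f y - c * y) = f x - f y - c * (x - y) := by ring
  rw [e, Real.norm_eq_abs, Real.norm_eq_abs, mul_assoc, abs_mul_abs_self] at h3
  rwa [pow_two]

end Taylor

/-! ### Counting time points under a kernel. -/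

section Counting

theorem card_filter_le {a b : ℝ} (hab : a ≤ b) (I : Finset ℕ) :
    ((I.filter fun t : ℕ => a ≤ t ∧ (t : ℝ) ≤ b).card : ℝ) ≤ b - a + 1 := by
  by_cases hb : 0 ≤ b
  · have hsub : (I.filter fun t : ℕ => a ≤ t ∧ (t : ℝ) ≤ b) ⊆ Finset.Icc ⌈a⌉₊ ⌊b⌋₊ := by
      intro t ht
      rw [Finset.mem_filter] at ht
      exact Finset.mem_Icc.2 ⟨Nat.ceil_le.2 ht.2.1, Nat.le_floor ht.2.2⟩
    have h1 := Finset.card_le_card hsub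
    rw [Nat.card_Icc] at h1
    by_cases hle : ⌈a⌉₊ ≤ ⌊b⌋₊ + 1
    · have h2 : ((⌊b⌋₊ + 1 - ⌈a⌉₊ : ℕ) : ℝ) = ⌊b⌋₊ + 1 - ⌈a⌉₊ := by
        rw [Nat.cast_sub hle]; push_cast; ring
      have h3 := Nat.floor_le hb
      have h4 := Nat.le_ceil a
      have h5 : ((I.filter fun t : ℕ => a ≤ t ∧ (t : ℝ) ≤ b).card : ℝ)
          ≤ ((⌊b⌋₊ + 1 - ⌈a⌉₊ : ℕ) : ℝ) := by exact_mod_cast h1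
      linarith
    · have h0 : ⌊b⌋₊ + 1 - ⌈a⌉₊ = 0 := by omega
      rw [h0, Nat.le_zero] at h1
      rw [h1]; push_cast; linarith
  · have h0 : (I.filter fun t : ℕ => a ≤ t ∧ (t : ℝ) ≤ b) = ∅ :=
      Finset.filter_eq_empty_iff.2 fun t _ ht => hb ((Nat.cast_nonneg t).trans ht.2)
    rw [h0]; simp; linarith

/-- The conditions on a and b keep the interval inside the times 2, …, n, so only rounding at the
two ends is lost. -/
theorem le_card_filter {a b : ℝ} {n : ℕ} (ha : 2 ≤ a) (hb : b ≤ n) :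
    b - a - 1 ≤ (((Finset.Icc 2 n).filter fun t : ℕ => a ≤ t ∧ (t : ℝ) ≤ b).card : ℝ) := by
  by_cases hb0 : 0 ≤ b
  · have hsub : Finset.Icc ⌈a⌉₊ ⌊b⌋₊ ⊆ (Finset.Icc 2 n).filter
        fun t : ℕ => a ≤ t ∧ (t : ℝ) ≤ b := by
      intro t ht
      rw [Finset.mem_Icc] at ht
      have h1 : a ≤ t := Nat.ceil_le.1 ht.1
      have h2 : (t : ℝ) ≤ b := (Nat.cast_le.2 ht.2).trans (Nat.floor_le hb0)
      refine Finset.mem_filter.2 ⟨Finset.mem_Icc.2 ⟨?_, ?_⟩, h1, h2⟩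
      · exact_mod_cast ha.trans h1
      · exact_mod_cast h2.trans hb
    have h1 := Finset.card_le_card hsub
    rw [Nat.card_Icc] at h1
    have h2 : (⌊b⌋₊ : ℝ) + 1 - ⌈a⌉₊ ≤ ((⌊b⌋₊ + 1 - ⌈a⌉₊ : ℕ) : ℝ) := by
      have : ⌊b⌋₊ + 1 ≤ (⌊b⌋₊ + 1 - ⌈a⌉₊) + ⌈a⌉₊ := by omega
      have : ((⌊b⌋₊ + 1 : ℕ) : ℝ) ≤ (((⌊b⌋₊ + 1 - ⌈a⌉₊) + ⌈a⌉₊ : ℕ) : ℝ) := by exact_mod_cast this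
      push_cast at this
      linarith
    have h3 := Nat.lt_floor_add_one b
    have h4 := Nat.ceil_lt_add_one (by linarith : 0 ≤ a)
    have h5 : ((⌊b⌋₊ + 1 - ⌈a⌉₊ : ℕ) : ℝ) ≤ (((Finset.Icc 2 n).filter
        fun t : ℕ => a ≤ t ∧ (t : ℝ) ≤ b).card : ℝ) := by exact_mod_cast h1
    linarith
  · have : (0 : ℝ) ≤ (((Finset.Icc 2 n).filter fun t : ℕ => a ≤ t ∧ (t : ℝ) ≤ b).card : ℝ) := by
      positivity
    linarith

/-- Sums of a function of compact support over rescaled time. -/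
theorem sum_abs_kernel_le {g : ℝ → ℝ} {G : ℝ} (hg : ∀ x, |g x| ≤ G)
    (hsupp : ∀ x, x ∉ Icc (-1 : ℝ) 1 → g x = 0) {n : ℕ} {h : ℝ} (hh : 0 < h) (hnh : 1 ≤ n * h)
    (τ : ℝ) (I : Finset ℕ) : ∑ t ∈ I, |g ((rt n t - τ) / h)| ≤ 3 * G * (n * h) := by
  have hG : 0 ≤ G := (abs_nonneg _).trans (hg 0)
  have hn : (0 : ℝ) < n := by
    by_contra! hc
    nlinarith [mul_nonpos_of_nonpos_of_nonneg hc hh.le]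
  have h1 : ∀ t ∈ I, |g ((rt n t - τ) / h)|
      ≤ if n * (τ - h) ≤ t ∧ (t : ℝ) ≤ n * (τ + h) then G else 0 := by
    intro t _
    split_ifs with hc
    · exact hg _
    · rw [hsupp, abs_zero]
      intro hm
      apply hc
      rw [mem_Icc, le_div_iff₀ hh, div_le_iff₀ hh, rt] at hm
      constructor
      · have := hm.1
        have h2 : τ - h ≤ t / n := by linarith
        rw [le_div_iff₀ hn] at h2
        linarith
      · have h2 : t / n ≤ τ + h := by linarith [hm.2]
        rw [div_le_iff₀ hn] at h2
        linarith
  -- A window of length 2nh contains at most 2nh + 1 ≤ 3nh integers; the factors 3G in later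
  -- constants come from here.
  refine (Finset.sum_le_sum h1).trans ?_
  rw [← Finset.sum_filter, Finset.sum_const, nsmul_eq_mul]
  have h3 : (n : ℝ) * (τ - h) ≤ n * (τ + h) := by nlinarith
  have h2 := card_filter_le h3 I
  nlinarith

theorem IsKernel.exists_bound {K : ℝ → ℝ} (hK : IsKernel K) : ∃ G, 0 < G ∧ ∀ x, |K x| ≤ G := by
  obtain ⟨G, hG⟩ := isCompact_Icc.exists_bound_of_continuousOn hK.cont
  refine ⟨max G 1, by positivity, fun x => ?_⟩
  by_cases hx : x ∈ Icc (-1 : ℝ) 1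
  · exact (hG x hx).trans (le_max_left _ _)
  · rw [hK.supp x hx, abs_zero]; positivity

/-- A kernel is bounded below on an interval to the right of zero. -/
theorem IsKernel.exists_lower_bound {K : ℝ → ℝ} (hK : IsKernel K) :
    ∃ c₁ c₂ κ : ℝ, 0 < c₁ ∧ c₁ < c₂ ∧ c₂ ≤ 1 ∧ 0 < κ ∧ ∀ x ∈ Icc c₁ c₂, κ ≤ K x := by
  -- some point of `(0,1)` has positive density
  have h1 : ∃ x ∈ Ioo (0 : ℝ) 1, 0 < K x := by
    by_contra! hc
    have h0 : ∀ x ∈ Ioo (0 : ℝ) 1, K x = 0 := fun x hx => le_antisymm (hc x hx) (hK.nonneg x)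
    -- Symmetry carries the zeros to (−1, 0) and the three remaining points are null, contradicting
    -- total mass one.
    have hae : ∀ᵐ x, K x = 0 := by
      have hfin : ({-1, 0, 1} : Set ℝ).Finite := by simp
      have := hfin.measure_zero volume
      filter_upwards [measure_eq_zero_iff_ae_notMem.1 this] with x hx
      simp only [mem_insert_iff, mem_singleton_iff, not_or] at hx
      by_cases h2 : x ∈ Icc (-1 : ℝ) 1
      · rcases lt_or_gt_of_ne hx.2.1 with h3 | h3
        · rw [← hK.symm]
          exact h0 (-x) ⟨by linarith, by
            have := lt_of_le_of_ne h2.1 (Ne.symm hx.1); linarith⟩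
        · exact h0 x ⟨h3, lt_of_le_of_ne h2.2 hx.2.2⟩
      · exact hK.supp x h2
    have := hK.total
    rw [integral_eq_zero_of_ae hae] at this
    exact zero_ne_one this
  obtain ⟨x, hx, hKx⟩ := h1
  have hcont : ContinuousAt K x :=
    hK.cont.continuousAt (Icc_mem_nhds (by linarith [hx.1]) hx.2)
  have hev : ∀ᶠ y in 𝓝 x, K x / 2 < K y :=
    hcont.eventually (lt_mem_nhds (by linarith))
  obtain ⟨r, hr, hball⟩ := Metric.eventually_nhds_iff.1 hev
  set r' := min (r / 2) (min (x / 2) ((1 - x) / 2)) with hr'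
  have hr'0 : 0 < r' := by
    refine lt_min (by linarith) (lt_min (by linarith [hx.1]) (by linarith [hx.2]))
  have hr1 : r' ≤ r / 2 := min_le_left _ _
  have hr2 : r' ≤ x / 2 := (min_le_right _ _).trans (min_le_left _ _)
  have hr3 : r' ≤ (1 - x) / 2 := (min_le_right _ _).trans (min_le_right _ _)
  refine ⟨x - r', x + r', K x / 2, by linarith [hx.1], by linarith, by linarith [hx.2],
    by linarith, fun y hy => (hball ?_).le⟩
  rw [Real.dist_eq, abs_lt]
  exact ⟨by linarith [hy.1], by linarith [hy.2]⟩

end Counting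


/-! ### Exponential moments and Chernoff bounds. -/

section ExponentialMoments

variable {Ω : Type*} [MeasurableSpace Ω] {μ : Measure Ω}

/-- The linear term is kept exact, so that it integrates to zero for a centred variable and leaves 1
+ O(θ²). -/
theorem exp_le_one_add_sq_mul_exp (x : ℝ) : Real.exp x ≤ 1 + x + x ^ 2 * Real.exp |x| := by
  have h := Complex.norm_exp_sub_sum_le_norm_mul_exp (x : ℂ) 2
  simp only [Finset.sum_range_succ, Finset.sum_range_zero, zero_add, pow_zero, Nat.factorial,
    Nat.cast_one, div_one, pow_one, mul_one, Complex.norm_real, Real.norm_eq_abs, sq_abs] at h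
  have h2 : ‖Complex.exp x - (1 + x)‖ = |Real.exp x - (1 + x)| := by
    rw [← Real.norm_eq_abs, ← Complex.norm_real]
    push_cast
    rfl
  rw [h2] at h
  linarith [le_abs_self (Real.exp x - (1 + x))]

theorem integrable_exp_of_lintegral_le {f : Ω → ℝ} (hf : AEMeasurable f μ) {D : ℝ}
    (hD : ∫⁻ ω, ENNReal.ofReal (Real.exp (f ω)) ∂μ ≤ ENNReal.ofReal D) :
    Integrable (fun ω => Real.exp (f ω)) μ := by
  refine ⟨(Real.measurable_exp.comp_aemeasurable hf).aestronglyMeasurable, ?_⟩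
  rw [hasFiniteIntegral_iff_ofReal (ae_of_all _ fun _ => (Real.exp_pos _).le)]
  exact hD.trans_lt ENNReal.ofReal_lt_top

/-- Moment generating function of a centred variable with an exponential moment. -/
theorem lintegral_exp_mul_le [IsProbabilityMeasure μ] {y : Ω → ℝ} (hy : Measurable y) {a D : ℝ}
    (ha : 0 < a) (hD0 : 0 ≤ D)
    (hD : ∫⁻ ω, ENNReal.ofReal (Real.exp (a * |y ω|)) ∂μ ≤ ENNReal.ofReal D)
    (hmean : ∫ ω, y ω ∂μ = 0) {θ : ℝ} (hθ : |θ| ≤ a / 2) :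
    ∫⁻ ω, ENNReal.ofReal (Real.exp (θ * y ω)) ∂μ
      ≤ ENNReal.ofReal (Real.exp (8 * D / a ^ 2 * θ ^ 2)) := by
  have hint := integrable_exp_of_lintegral_le (μ := μ) (f := fun ω => a * |y ω|)
    (by fun_prop) hD
  have hyint : Integrable y μ := by
    refine (hint.const_mul (1 / a)).mono hy.aestronglyMeasurable (ae_of_all _ fun ω => ?_)
    rw [Real.norm_eq_abs, Real.norm_eq_abs, abs_of_nonneg (by positivity : 0 ≤ 1 / a * _),
      one_div, inv_mul_eq_div, le_div_iff₀ ha]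
    linarith [Real.add_one_le_exp (a * |y ω|)]
  -- Half of the exponential moment pays for exp|θy|, since |θ| ≤ a/2; the other half pays for y²,
  -- since z²/2 ≤ exp z for z ≥ 0.
  have hpt : ∀ ω, Real.exp (θ * y ω)
      ≤ 1 + θ * y ω + θ ^ 2 * (8 / a ^ 2) * Real.exp (a * |y ω|) := by
    intro ω
    refine (exp_le_one_add_sq_mul_exp _).trans ?_
    have h1 : |θ * y ω| ≤ a * |y ω| / 2 := by
      rw [abs_mul]; nlinarith [abs_nonneg (y ω)]
    have h2 : Real.exp |θ * y ω| ≤ Real.exp (a * |y ω| / 2) := Real.exp_le_exp.2 h1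
    have h3 : y ω ^ 2 ≤ 8 / a ^ 2 * Real.exp (a * |y ω| / 2) := by
      have h4 := Real.quadratic_le_exp_of_nonneg (x := a * |y ω| / 2) (by positivity)
      rw [div_mul_eq_mul_div, le_div_iff₀ (by positivity)]
      have h5 : 0 ≤ a * |y ω| := by positivity
      nlinarith [sq_abs (y ω)]
    have h6 : Real.exp (a * |y ω|) = Real.exp (a * |y ω| / 2) * Real.exp (a * |y ω| / 2) := by
      rw [← Real.exp_add]; ring_nf
    have h7 : (θ * y ω) ^ 2 * Real.exp |θ * y ω|
        ≤ θ ^ 2 * (8 / a ^ 2 * Real.exp (a * |y ω| / 2)) * Real.exp (a * |y ω| / 2) := by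
      rw [mul_pow]
      gcongr
    rw [h6]
    linarith
  have hint2 : Integrable (fun ω => 1 + θ * y ω + θ ^ 2 * (8 / a ^ 2) * Real.exp (a * |y ω|)) μ :=
    ((integrable_const 1).add (hyint.const_mul θ)).add (hint.const_mul _)
  have hexp : Integrable (fun ω => Real.exp (θ * y ω)) μ := by
    refine hint2.mono (by fun_prop) (ae_of_all _ fun ω => ?_)
    rw [Real.norm_eq_abs, Real.norm_eq_abs, abs_of_pos (Real.exp_pos _)]
    exact (hpt ω).trans (le_abs_self _)
  rw [← ofReal_integral_eq_lintegral_ofReal hexp (ae_of_all _ fun _ => (Real.exp_pos _).le)]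
  refine ENNReal.ofReal_le_ofReal ?_
  have hDr : ∫ ω, Real.exp (a * |y ω|) ∂μ ≤ D := by
    rw [← ofReal_integral_eq_lintegral_ofReal hint (ae_of_all _ fun _ => (Real.exp_pos _).le)] at hD
    exact (ENNReal.ofReal_le_ofReal_iff hD0).1 hD
  calc ∫ ω, Real.exp (θ * y ω) ∂μ
      ≤ ∫ ω, (1 + θ * y ω + θ ^ 2 * (8 / a ^ 2) * Real.exp (a * |y ω|)) ∂μ :=
        integral_mono hexp hint2 hpt
    _ = 1 + θ ^ 2 * (8 / a ^ 2) * ∫ ω, Real.exp (a * |y ω|) ∂μ := by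
        rw [integral_add (f := fun ω => 1 + θ * y ω)
            ((integrable_const 1).add (hyint.const_mul θ)) (hint.const_mul _),
          integral_add (f := fun _ => (1 : ℝ)) (integrable_const 1) (hyint.const_mul θ),
          integral_const_mul,
          integral_const_mul, hmean]
        simp
    _ ≤ 1 + θ ^ 2 * (8 / a ^ 2) * D := by gcongr
    _ = 8 * D / a ^ 2 * θ ^ 2 + 1 := by ring
    _ ≤ _ := Real.add_one_le_exp _

theorem mul_le_div_add_mul_sq {c : ℝ} (hc : 0 < c) (θ x : ℝ) :
    θ * x ≤ θ ^ 2 / (4 * c) + c * x ^ 2 := by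
  have h : 0 ≤ (θ / (2 * c) - x) ^ 2 * c := by positivity
  have e : (θ / (2 * c) - x) ^ 2 * c = θ ^ 2 / (4 * c) - θ * x + c * x ^ 2 := by
    field_simp; ring
  linarith

/-- A centred variable with a Gaussian-type exponential moment is sub-Gaussian. -/
theorem lintegral_exp_mul_le_of_sq [IsProbabilityMeasure μ] {y : Ω → ℝ} (hy : Measurable y)
    {c D : ℝ} (hc : 0 < c) (hD1 : 1 ≤ D)
    (hD : ∫⁻ ω, ENNReal.ofReal (Real.exp (c * y ω ^ 2)) ∂μ ≤ ENNReal.ofReal D)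
    (hmean : ∫ ω, y ω ∂μ = 0) (θ : ℝ) :
    ∫⁻ ω, ENNReal.ofReal (Real.exp (θ * y ω)) ∂μ
      ≤ ENNReal.ofReal (Real.exp (8 * D / c * θ ^ 2)) := by
  -- For |θ| ≤ √c the preceding bound applies with a = 2√c, because 2√c|y| ≤ 1 + cy². For larger θ
  -- centring is not needed: θy ≤ θ²/(4c) + cy², and D is absorbed into the exponent because θ² ≥ c.
  by_cases hθ : |θ| ≤ √c
  · have h1 : ∫⁻ ω, ENNReal.ofReal (Real.exp (2 * √c * |y ω|)) ∂μ
        ≤ ENNReal.ofReal (Real.exp 1 * D) := by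
      calc ∫⁻ ω, ENNReal.ofReal (Real.exp (2 * √c * |y ω|)) ∂μ
          ≤ ∫⁻ ω, ENNReal.ofReal (Real.exp 1) * ENNReal.ofReal (Real.exp (c * y ω ^ 2)) ∂μ := by
            refine lintegral_mono fun ω => ?_
            rw [← ENNReal.ofReal_mul (Real.exp_pos _).le, ← Real.exp_add]
            refine ENNReal.ofReal_le_ofReal (Real.exp_le_exp.2 ?_)
            nlinarith [sq_nonneg (√c * |y ω| - 1), Real.sq_sqrt hc.le, sq_abs (y ω)]
        _ = ENNReal.ofReal (Real.exp 1) * ∫⁻ ω, ENNReal.ofReal (Real.exp (c * y ω ^ 2)) ∂μ :=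
            lintegral_const_mul' _ _ ENNReal.ofReal_ne_top
        _ ≤ ENNReal.ofReal (Real.exp 1) * ENNReal.ofReal D := by gcongr
        _ = _ := (ENNReal.ofReal_mul (Real.exp_pos _).le).symm
    refine (lintegral_exp_mul_le hy (a := 2 * √c) (by positivity) (by positivity) h1 hmean
      (by linarith)).trans (ENNReal.ofReal_le_ofReal (Real.exp_le_exp.2 ?_))
    refine mul_le_mul_of_nonneg_right ?_ (sq_nonneg θ)
    rw [mul_pow, Real.sq_sqrt hc.le, div_le_div_iff₀ (by positivity) hc]
    have he : Real.exp 1 ≤ 3 := by linarith [Real.exp_one_lt_d9]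
    nlinarith [mul_le_mul_of_nonneg_right he (mul_nonneg (by linarith : 0 ≤ D) hc.le)]
  · push Not at hθ
    have hθ2 : c ≤ θ ^ 2 := by
      rw [← sq_abs, ← Real.sq_sqrt hc.le]
      exact pow_le_pow_left₀ (Real.sqrt_nonneg _) hθ.le 2
    calc ∫⁻ ω, ENNReal.ofReal (Real.exp (θ * y ω)) ∂μ
        ≤ ∫⁻ ω, ENNReal.ofReal (Real.exp (θ ^ 2 / (4 * c))) *
            ENNReal.ofReal (Real.exp (c * y ω ^ 2)) ∂μ := by
          refine lintegral_mono fun ω => ?_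
          rw [← ENNReal.ofReal_mul (Real.exp_pos _).le, ← Real.exp_add]
          exact ENNReal.ofReal_le_ofReal (Real.exp_le_exp.2 (mul_le_div_add_mul_sq hc _ _))
      _ = ENNReal.ofReal (Real.exp (θ ^ 2 / (4 * c))) *
            ∫⁻ ω, ENNReal.ofReal (Real.exp (c * y ω ^ 2)) ∂μ :=
          lintegral_const_mul' _ _ ENNReal.ofReal_ne_top
      _ ≤ ENNReal.ofReal (Real.exp (θ ^ 2 / (4 * c))) * ENNReal.ofReal D := by gcongr
      _ = ENNReal.ofReal (Real.exp (θ ^ 2 / (4 * c)) * D) :=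
          (ENNReal.ofReal_mul (Real.exp_pos _).le).symm
      _ ≤ _ := by
          refine ENNReal.ofReal_le_ofReal ?_
          have h1 : D ≤ Real.exp D := by linarith [Real.add_one_le_exp D]
          have h2 : D ≤ D / c * θ ^ 2 := by
            rw [div_mul_eq_mul_div, le_div_iff₀ hc]
            nlinarith
          have h3 : θ ^ 2 / (4 * c) ≤ D / c * θ ^ 2 := by
            rw [div_mul_eq_mul_div, div_le_div_iff₀ (by positivity) hc]
            nlinarith [mul_nonneg (sq_nonneg θ) hc.le]
          have h4 : 0 ≤ D / c * θ ^ 2 := by positivity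
          calc Real.exp (θ ^ 2 / (4 * c)) * D ≤ Real.exp (θ ^ 2 / (4 * c)) * Real.exp D := by
                gcongr
            _ = Real.exp (θ ^ 2 / (4 * c) + D) := (Real.exp_add _ _).symm
            _ ≤ _ := Real.exp_le_exp.2 (by
                have e : 8 * D / c * θ ^ 2 = 8 * (D / c * θ ^ 2) := by ring
                rw [e]; linarith)

theorem measure_lt_le_of_lintegral_exp {f : Ω → ℝ} (hf : AEMeasurable f μ) {D x : ℝ}
    (hD : ∫⁻ ω, ENNReal.ofReal (Real.exp (f ω)) ∂μ ≤ ENNReal.ofReal D) :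
    μ {ω | x < f ω} ≤ ENNReal.ofReal (D * Real.exp (-x)) := by
  have h0 : AEMeasurable (fun ω => ENNReal.ofReal (Real.exp (f ω))) μ := by fun_prop
  have h1 := meas_ge_le_lintegral_div h0 (ε := ENNReal.ofReal (Real.exp x))
    (by simpa using Real.exp_pos x) ENNReal.ofReal_ne_top
  refine (measure_mono fun ω (hω : x < f ω) => ?_).trans (h1.trans ?_)
  · exact ENNReal.ofReal_le_ofReal (Real.exp_le_exp.2 hω.le)
  · rw [Real.exp_neg, ← div_eq_mul_inv, ENNReal.ofReal_div_of_pos (Real.exp_pos x)]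
    exact ENNReal.div_le_div_right hD _

/-- Tails of a variable with a Gaussian-type exponential moment. -/
theorem measure_not_abs_le_of_sq {y : Ω → ℝ} (hy : AEMeasurable y μ) {c D b : ℝ} (hc : 0 < c)
    (hb : 0 ≤ b)
    (hD : ∫⁻ ω, ENNReal.ofReal (Real.exp (c * y ω ^ 2)) ∂μ ≤ ENNReal.ofReal D) :
    μ {ω | ¬ |y ω| ≤ b} ≤ ENNReal.ofReal (D * Real.exp (-(c * b ^ 2))) := by
  refine (measure_mono fun ω hω => ?_).trans
    (measure_lt_le_of_lintegral_exp (f := fun ω => c * y ω ^ 2) (by fun_prop) hD)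
  have h1 : b < |y ω| := not_le.1 hω
  have h2 : b ^ 2 < y ω ^ 2 := by
    rw [← sq_abs (y ω)]
    exact pow_lt_pow_left₀ h1 hb two_ne_zero
  exact mul_lt_mul_of_pos_left h2 hc

/-- Two-sided Chernoff bound. -/
theorem measure_not_abs_le_of_lintegral_exp {f : Ω → ℝ} (hf : AEMeasurable f μ) {θ v x : ℝ}
    (hθ : 0 < θ)
    (h : ∀ θ' : ℝ, |θ'| = θ →
      ∫⁻ ω, ENNReal.ofReal (Real.exp (θ' * f ω)) ∂μ ≤ ENNReal.ofReal (Real.exp v)) :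
    μ {ω | ¬ |f ω| ≤ x} ≤ ENNReal.ofReal (2 * Real.exp (v - θ * x)) := by
  have h1 := measure_lt_le_of_lintegral_exp (f := fun ω => θ * f ω) (x := θ * x) (by fun_prop)
    (h θ (abs_of_pos hθ))
  have h2 := measure_lt_le_of_lintegral_exp (f := fun ω => -θ * f ω) (x := θ * x) (by fun_prop)
    (h (-θ) (by rw [abs_neg, abs_of_pos hθ]))
  rw [← Real.exp_add, ← sub_eq_add_neg] at h1 h2
  calc μ {ω | ¬ |f ω| ≤ x} ≤ μ ({ω | θ * x < θ * f ω} ∪ {ω | θ * x < -θ * f ω}) := by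
        refine measure_mono fun ω hω => ?_
        rcases lt_abs.1 (not_le.1 hω) with h3 | h3
        · exact Or.inl (mul_lt_mul_of_pos_left h3 hθ)
        · right
          change θ * x < -θ * f ω
          nlinarith
    _ ≤ _ := measure_union_le _ _
    _ ≤ ENNReal.ofReal (Real.exp (v - θ * x)) + ENNReal.ofReal (Real.exp (v - θ * x)) :=
        add_le_add h1 h2
    _ = _ := by
        rw [← ENNReal.ofReal_add (Real.exp_pos _).le (Real.exp_pos _).le, two_mul]

end ExponentialMoments

/-! ### Independence of the present innovation from the past. -/

section Past

variable {Ω E : Type*} [MeasurableSpace E]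

/-- The σ-algebra generated by the `ε s`, `s < t`. -/
abbrev past (ε : ℤ → Ω → E) (t : ℤ) : MeasurableSpace Ω :=
  ⨆ s ∈ Iio t, MeasurableSpace.comap (ε s) inferInstance

theorem past_mono (ε : ℤ → Ω → E) {s t : ℤ} (h : s ≤ t) : past ε s ≤ past ε t :=
  biSup_mono fun _ hr => lt_of_lt_of_le hr h

theorem measurable_past (ε : ℤ → Ω → E) {s t : ℤ} (h : s < t) : Measurable[past ε t] (ε s) :=
  Measurable.mono (comap_measurable (ε s))
    (le_iSup₂ (f := fun s (_ : s ∈ Iio t) => MeasurableSpace.comap (ε s) inferInstance) s h)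
    le_rfl

variable [mΩ : MeasurableSpace Ω] {μ : Measure Ω}

theorem past_le {ε : ℤ → Ω → E} (hε : ∀ t, Measurable (ε t)) (t : ℤ) : past ε t ≤ mΩ :=
  iSup₂_le fun s _ => (hε s).comap_le

theorem indepFun_past {F : Type*} [MeasurableSpace F] {ε : ℤ → Ω → E}
    (hε : ∀ t, Measurable (ε t)) (hind : iIndepFun ε μ) (t : ℤ) {U : Ω → F}
    (hU : Measurable[past ε t] U) : IndepFun U (ε t) μ := by
  rw [IndepFun_iff_Indep]
  have h1 := indep_iSup_of_disjoint (fun s => (hε s).comap_le) hind.iIndep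
    (S := Iio t) (T := {t}) (by simp)
  refine indep_of_indep_of_le_left ?_ hU.comap_le
  simpa [past] using h1

/-- Exponential moments of sums of innovations multiplied by functions of the past. -/
theorem lintegral_exp_sum_le [IsProbabilityMeasure μ] {ε : ℤ → Ω → E}
    (hε : ∀ t, Measurable (ε t)) (hind : iIndepFun ε μ) (u : ℕ → Ω → ℝ)
    (hu : ∀ t : ℕ, Measurable[past ε t] (u t)) (ψ : ℕ → ℝ → E → ℝ)
    (hψ : ∀ t, Measurable (Function.uncurry (ψ t))) (c : ℕ → ℝ) (m N : ℕ) (hm1 : 1 ≤ m)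
    (hstep : ∀ t ∈ Finset.Icc m N, ∀ v,
      ∫⁻ ω, ENNReal.ofReal (Real.exp (ψ t v (ε t ω))) ∂μ ≤ ENNReal.ofReal (Real.exp (c t))) :
    ∫⁻ ω, ENNReal.ofReal (Real.exp (∑ t ∈ Finset.Icc m N, ψ t (u t ω) (ε t ω))) ∂μ
      ≤ ENNReal.ofReal (Real.exp (∑ t ∈ Finset.Icc m N, c t)) := by
  have hmeas : ∀ N : ℕ, Measurable[past ε ((N : ℤ) + 1)]
      (fun ω => ∑ t ∈ Finset.Icc m N, ψ t (u t ω) (ε t ω)) := fun N => by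
    refine Finset.measurable_sum _ fun t ht => ?_
    have htN : (t : ℤ) ≤ N := by exact_mod_cast (Finset.mem_Icc.1 ht).2
    refine (hψ t).comp (Measurable.prodMk ?_ ?_)
    · exact (hu t).mono (past_mono ε (by omega)) le_rfl
    · exact measurable_past ε (by omega)
  induction N with
  | zero =>
    have : Finset.Icc m 0 = ∅ := Finset.Icc_eq_empty (by omega)
    simp [this]
  | succ N ih =>
    by_cases hm : m ≤ N + 1
    · simp only [Finset.sum_Icc_succ_top hm]
      have h0 := hstep (N + 1) (Finset.mem_Icc.2 ⟨hm, le_rfl⟩)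
      have ih' := ih fun t ht => hstep t (Finset.mem_Icc.2
        ⟨(Finset.mem_Icc.1 ht).1, (Finset.mem_Icc.1 ht).2.trans (Nat.le_succ N)⟩)
      set S : Ω → ℝ := fun ω => ∑ t ∈ Finset.Icc m N, ψ t (u t ω) (ε t ω) with hS
      have hSm : Measurable[past ε ((N + 1 : ℕ) : ℤ)] S := hmeas N
      have hU : Measurable[past ε ((N + 1 : ℕ) : ℤ)] (fun ω => (S ω, u (N + 1) ω)) :=
        Measurable.prodMk hSm (hu (N + 1))
      have hind0 := indepFun_past hε hind _ hU
      have hU' := hU.mono (past_le hε _) le_rfl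
      -- The joint law factorises, so the new innovation can be integrated out with (S, u) frozen,
      -- and `hstep` bounds the inner integral uniformly in the frozen value. Product measures thus
      -- replace conditional expectations.
      have hj := (indepFun_iff_map_prod_eq_prod_map_map hU'.aemeasurable
        (hε _).aemeasurable).1 hind0
      have hψ' : Measurable (fun p : (ℝ × ℝ) × E => ψ (N + 1) p.1.2 p.2) :=
        (hψ (N + 1)).comp (measurable_fst.snd.prodMk measurable_snd)
      have hmf : Measurable (fun p : (ℝ × ℝ) × E =>
          ENNReal.ofReal (Real.exp (p.1.1 + ψ (N + 1) p.1.2 p.2))) :=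
        ENNReal.measurable_ofReal.comp (Real.measurable_exp.comp (measurable_fst.fst.add hψ'))
      calc ∫⁻ ω, ENNReal.ofReal (Real.exp (S ω + ψ (N + 1) (u (N + 1) ω) (ε (N + 1 : ℕ) ω))) ∂μ
          = ∫⁻ p, ENNReal.ofReal (Real.exp (p.1.1 + ψ (N + 1) p.1.2 p.2))
              ∂(μ.map fun ω => ((S ω, u (N + 1) ω), ε (N + 1 : ℕ) ω)) := by
            rw [lintegral_map hmf (hU'.prodMk (hε _))]
        _ = ∫⁻ v, ∫⁻ x, ENNReal.ofReal (Real.exp (v.1 + ψ (N + 1) v.2 x))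
              ∂(μ.map (ε (N + 1 : ℕ))) ∂(μ.map fun ω => (S ω, u (N + 1) ω)) := by
            rw [hj, lintegral_prod _ hmf.aemeasurable]
        _ ≤ ∫⁻ v, ENNReal.ofReal (Real.exp v.1) * ENNReal.ofReal (Real.exp (c (N + 1)))
              ∂(μ.map fun ω => (S ω, u (N + 1) ω)) := by
            refine lintegral_mono fun v => ?_
            rw [lintegral_map (f := fun x => ENNReal.ofReal (Real.exp (v.1 + ψ (N + 1) v.2 x)))
              (hmf.comp measurable_prodMk_left) (hε _)]
            simp only [Real.exp_add, ENNReal.ofReal_mul (Real.exp_pos _).le]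
            rw [lintegral_const_mul' _ _ ENNReal.ofReal_ne_top]
            exact mul_le_mul_right (h0 v.2) _
        _ = (∫⁻ ω, ENNReal.ofReal (Real.exp (S ω)) ∂μ) * ENNReal.ofReal (Real.exp (c (N + 1))) := by
            rw [lintegral_mul_const' _ _ ENNReal.ofReal_ne_top, lintegral_map (by fun_prop) hU']
        _ ≤ ENNReal.ofReal (Real.exp (∑ t ∈ Finset.Icc m N, c t)) *
              ENNReal.ofReal (Real.exp (c (N + 1))) := mul_le_mul_left ih' _
        _ = _ := by rw [← ENNReal.ofReal_mul (Real.exp_pos _).le, ← Real.exp_add]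
    · have : Finset.Icc m (N + 1) = ∅ := Finset.Icc_eq_empty (by omega)
      simp [this]

end Past


set_option linter.unusedSectionVars false

/-! ### Exponential moments and deviation bounds for the autoregression. -/

section VAR

variable {Ω : Type*} [MeasurableSpace Ω] {μ : Measure Ω} [IsProbabilityMeasure μ] {d n : ℕ}
  {A Sig : ℝ → Matrix (Fin d) (Fin d) ℝ} {ε : ℤ → Ω → Fin d → ℝ} {X : ℕ → Ω → Fin d → ℝ}
  {ι₁ C₀ C₁ ρ CS M : ℝ}

theorem l2_single (i : Fin d) : l2 (Pi.single i (1 : ℝ)) = 1 := by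
  rw [l2]
  simp [Pi.single_apply]

/-- The integrand is at least one; the index i only ensures that a unit vector exists. -/
theorem IsRegularVAR.one_le_C₀ (hR : IsRegularVAR μ n A Sig ε ι₁ C₀ C₁ ρ CS M) (hι : 0 < ι₁)
    (i : Fin d) : 1 ≤ C₀ := by
  have h1 := hR.subGauss 0 _ (l2_single i)
  have h2 : (1 : ENNReal) ≤ ENNReal.ofReal C₀ := by
    refine le_trans ?_ h1
    calc (1 : ENNReal) = ∫⁻ _ω, 1 ∂μ := by simp
      _ ≤ _ := lintegral_mono fun ω => by
          rw [ENNReal.one_le_ofReal]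
          exact Real.one_le_exp (by positivity)
  exact ENNReal.one_le_ofReal.1 h2

theorem IsRegularVAR.one_le_C₁ (hR : IsRegularVAR μ n A Sig ε ι₁ C₀ C₁ ρ CS M) (i : Fin d) :
    1 ≤ C₁ := by
  have := hR.decay 0 (Nat.zero_le n) 0
  rw [pow_zero, mul_one] at this
  exact (one_le_opNorm_one i).trans this

/-- Homogeneity reduces the bound to the unit sphere, where it is assumed; for u = 0 it says 1 ≤ C₀.
-/
theorem IsRegularVAR.lintegral_exp_linear_le (hR : IsRegularVAR μ n A Sig ε ι₁ C₀ C₁ ρ CS M)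
    (hι : 0 < ι₁) (i : Fin d) {u : Fin d → ℝ} {r : ℝ} (hu : l2 u ≤ r) (t : ℤ) :
    ∫⁻ ω, ENNReal.ofReal (Real.exp (ι₁ / r ^ 2 * (u ⬝ᵥ ε t ω) ^ 2)) ∂μ ≤ ENNReal.ofReal C₀ := by
  rcases (l2_nonneg u).eq_or_lt with h0 | h0
  · have hu0 : u = 0 := l2_eq_zero h0.symm
    subst hu0
    simpa using hR.one_le_C₀ hι i
  · have hu1 : l2 ((l2 u)⁻¹ • u) = 1 := by
      rw [l2_eq_norm, WithLp.toLp_smul, norm_smul, ← l2_eq_norm, norm_inv, Real.norm_eq_abs,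
        abs_of_pos h0, inv_mul_cancel₀ h0.ne']
    refine le_trans (lintegral_mono fun ω => ?_) (hR.subGauss t _ hu1)
    refine ENNReal.ofReal_le_ofReal (Real.exp_le_exp.2 ?_)
    rw [smul_dotProduct, smul_eq_mul, mul_pow, div_mul_eq_mul_div, mul_div_assoc]
    refine mul_le_mul_of_nonneg_left ?_ hι.le
    rw [inv_pow, inv_mul_eq_div]
    exact div_le_div_of_nonneg_left (sq_nonneg _) (by positivity)
      (pow_le_pow_left₀ h0.le hu 2)

theorem mulVec_innov (W : Matrix (Fin d) (Fin d) ℝ) (t : ℤ) (ω : Ω) (j : Fin d) :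
    (W *ᵥ innov n Sig ε t ω) j = ((W * matSqrt (Sig ((t : ℝ) / n))) j) ⬝ᵥ ε t ω := by
  rw [innov, Matrix.mulVec_mulVec]
  rfl

theorem innov_apply (t : ℤ) (ω : Ω) (j : Fin d) :
    innov n Sig ε t ω j = (matSqrt (Sig ((t : ℝ) / n)) j) ⬝ᵥ ε t ω := rfl

theorem IsRegularVAR.opNorm_Sig_le (hR : IsRegularVAR μ n A Sig ε ι₁ C₀ C₁ ρ CS M) {τ : ℝ}
    (hτ : τ ≤ 1) : √(opNorm (Sig τ)) ≤ √(max CS 1) :=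
  Real.sqrt_le_sqrt ((hR.normSig τ hτ).trans (le_max_left _ _))

theorem IsRegularVAR.lintegral_exp_innov_le (hR : IsRegularVAR μ n A Sig ε ι₁ C₀ C₁ ρ CS M)
    (hι : 0 < ι₁) (i : Fin d) {t : ℤ} (ht : (t : ℝ) / n ≤ 1) :
    ∫⁻ ω, ENNReal.ofReal (Real.exp (ι₁ / max CS 1 * innov n Sig ε t ω i ^ 2)) ∂μ
      ≤ ENNReal.ofReal C₀ := by
  have hS : 0 < max CS 1 := by positivity
  have h1 := hR.lintegral_exp_linear_le hι i (u := matSqrt (Sig ((t : ℝ) / n)) i)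
    (r := √(max CS 1)) (by
      have := l2_row_mul_matSqrt_le 1 (hR.posSig _ ht).posSemidef i
      rw [one_mul] at this
      have h1 : opNorm (1 : Matrix (Fin d) (Fin d) ℝ) ≤ 1 := by
        rw [opNorm, map_one]
        exact ContinuousLinearMap.norm_id_le
      calc _ ≤ _ := this
        _ ≤ 1 * √(max CS 1) := by
            gcongr
            exact (hR.normSig _ ht).trans (le_max_left _ _)
        _ = _ := one_mul _) t
  rw [Real.sq_sqrt hS.le] at h1
  exact h1

theorem int_div_le_one {t : ℤ} (ht : t ≤ n) : (t : ℝ) / n ≤ 1 :=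
  div_le_one_of_le₀ (by exact_mod_cast ht) (Nat.cast_nonneg n)

theorem IsTVVAR.measurable_innov (hV : IsTVVAR μ n A Sig ε X) (t : ℤ) (i : Fin d) :
    Measurable fun ω => innov n Sig ε t ω i := by
  simp only [innov_apply, dotProduct]
  exact Finset.measurable_sum _ fun k _ => ((measurable_pi_apply k).comp (hV.meas t)).const_mul _

/-- The Wold series, coordinate by coordinate. -/
theorem IsTVVAR.tendsto_wold (hV : IsTVVAR μ n A Sig ε X) {t : ℕ} (ht : t ≤ n) (j : Fin d) :
    ∀ᵐ ω ∂μ, Tendsto (fun N => ∑ k ∈ Finset.range N,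
      (Phi n A t k *ᵥ innov n Sig ε ((t : ℤ) - k) ω) j) atTop (𝓝 (X t ω j)) := by
  filter_upwards [hV.wold t ht] with ω hω
  exact (Pi.hasSum.1 hω j).tendsto_sum_nat

theorem measurable_past_partial (t : ℕ) (j : Fin d) (N : ℕ) :
    Measurable[past ε ((t : ℤ) + 1)] fun ω => ∑ k ∈ Finset.range N,
      (Phi n A t k *ᵥ innov n Sig ε ((t : ℤ) - k) ω) j := by
  refine Finset.measurable_sum _ fun k _ => ?_
  simp only [mulVec_innov]
  have h1 : Measurable fun x : Fin d → ℝ =>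
      ((Phi n A t k * matSqrt (Sig ((((t : ℤ) - k : ℤ) : ℝ) / n))) j) ⬝ᵥ x := by
    simp only [dotProduct]
    fun_prop
  exact h1.comp (measurable_past ε (by omega))

/-- The process equals its Wold series only almost surely. The limsup of the partial sums is a
version measurable with respect to the innovations up to time t, as the independence argument
requires. -/
theorem IsTVVAR.exists_past_version (hV : IsTVVAR μ n A Sig ε X) {t : ℕ} (ht : t ≤ n)
    (j : Fin d) : ∃ u : Ω → ℝ, Measurable[past ε ((t : ℤ) + 1)] u ∧
      ∀ᵐ ω ∂μ, u ω = X t ω j := by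
  refine ⟨fun ω => limsup (fun N => ∑ k ∈ Finset.range N,
      (Phi n A t k *ᵥ innov n Sig ε ((t : ℤ) - k) ω) j) atTop,
    Measurable.limsup fun N => measurable_past_partial t j N, ?_⟩
  filter_upwards [hV.tendsto_wold ht j] with ω hω
  exact hω.limsup_eq

theorem IsTVVAR.aemeasurable (hV : IsTVVAR μ n A Sig ε X) {t : ℕ} (ht : t ≤ n) (j : Fin d) :
    AEMeasurable (fun ω => X t ω j) μ := by
  obtain ⟨u, hu, hux⟩ := hV.exists_past_version ht j
  exact ⟨u, hu.mono (past_le hV.meas _) le_rfl, hux.mono fun _ h => h.symm⟩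

/-- The process inherits a Gaussian-type exponential moment from the innovations. -/
theorem IsRegularVAR.lintegral_exp_X_le (hR : IsRegularVAR μ n A Sig ε ι₁ C₀ C₁ ρ CS M)
    (hV : IsTVVAR μ n A Sig ε X) (hι : 0 < ι₁) (hρ : 0 < ρ) (hρ1 : ρ < 1) {t : ℕ} (ht : t ≤ n)
    (j : Fin d) :
    ∫⁻ ω, ENNReal.ofReal (Real.exp
        (ι₁ * (1 - ρ) ^ 2 / (C₁ ^ 2 * max CS 1) * X t ω j ^ 2)) ∂μ ≤ ENNReal.ofReal C₀ := by
  set c := ι₁ * (1 - ρ) ^ 2 / (C₁ ^ 2 * max CS 1) with hc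
  set Y : ℕ → Ω → ℝ := fun k ω => (Phi n A t k *ᵥ innov n Sig ε ((t : ℤ) - k) ω) j with hY
  have hC1 : 0 < C₁ := lt_of_lt_of_le one_pos (hR.one_le_C₁ j)
  have hS : 0 < max CS 1 := by positivity
  have hYm : ∀ k, Measurable (Y k) := fun k => by
    simp only [hY, Matrix.mulVec, dotProduct]
    exact Finset.measurable_sum _ fun i _ => (hV.measurable_innov _ i).const_mul _
  have hYexp : ∀ k, ∫⁻ ω, ENNReal.ofReal
      (Real.exp (ι₁ / (C₁ * ρ ^ k * √(max CS 1)) ^ 2 * Y k ω ^ 2)) ∂μ ≤ ENNReal.ofReal C₀ := by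
    intro k
    have hle : (((t : ℤ) - k : ℤ) : ℝ) / n ≤ 1 := int_div_le_one (by omega)
    simp only [hY, mulVec_innov]
    refine hR.lintegral_exp_linear_le hι j ?_ _
    refine (l2_row_mul_matSqrt_le _ (hR.posSig _ hle).posSemidef j).trans ?_
    exact mul_le_mul (hR.decay t ht k) (hR.opNorm_Sig_le hle) (Real.sqrt_nonneg _)
      (by positivity)
  have hpartial : ∀ N : ℕ, ∫⁻ ω, ENNReal.ofReal (Real.exp
      (c * (∑ k ∈ Finset.range (N + 1), Y k ω) ^ 2)) ∂μ ≤ ENNReal.ofReal C₀ := by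
    intro N
    -- The partial sum is a convex combination, with weights ρ^k/G, of the rescaled terms
    -- (G/ρ^k)Y_k, whose scales are all the same. Jensen's inequality is used twice, for the square
    -- and for the exponential; the factor (1 − ρ)² in c compensates G² ≤ (1 − ρ)⁻².
    set G := ∑ k ∈ Finset.range (N + 1), ρ ^ k with hG
    have hG0 : 0 < G := Finset.sum_pos (fun k _ => by positivity) (by simp)
    have hG1 : G * (1 - ρ) ≤ 1 := by
      rw [hG, geom_sum_mul_neg]
      linarith [pow_pos hρ (N + 1)]
    have hp0 : ∀ k ∈ Finset.range (N + 1), 0 ≤ ρ ^ k / G := fun k _ => by positivity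
    have hp1 : ∑ k ∈ Finset.range (N + 1), ρ ^ k / G = 1 := by
      rw [← Finset.sum_div, div_self hG0.ne']
    have hpt : ∀ ω, Real.exp (c * (∑ k ∈ Finset.range (N + 1), Y k ω) ^ 2)
        ≤ ∑ k ∈ Finset.range (N + 1), ρ ^ k / G *
            Real.exp (ι₁ / (C₁ * ρ ^ k * √(max CS 1)) ^ 2 * Y k ω ^ 2) := by
      intro ω
      have h1 : (∑ k ∈ Finset.range (N + 1), Y k ω) ^ 2
          ≤ ∑ k ∈ Finset.range (N + 1), ρ ^ k / G * (G / ρ ^ k * Y k ω) ^ 2 := by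
        have h2 := (even_two.convexOn_pow (𝕜 := ℝ)).map_sum_le hp0 hp1
            (p := fun k => G / ρ ^ k * Y k ω) (fun _ _ => mem_univ _)
        simp only [smul_eq_mul] at h2
        refine le_trans (le_of_eq ?_) h2
        congr 1
        refine Finset.sum_congr rfl fun k _ => ?_
        have : ρ ^ k ≠ 0 := by positivity
        field_simp
      have h3 := convexOn_exp.map_sum_le hp0 hp1
        (p := fun k => ι₁ / (C₁ * ρ ^ k * √(max CS 1)) ^ 2 * Y k ω ^ 2) (fun _ _ => mem_univ _)
      simp only [smul_eq_mul] at h3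
      refine le_trans (Real.exp_le_exp.2 ?_) h3
      refine (mul_le_mul_of_nonneg_left h1 (by positivity)).trans ?_
      rw [Finset.mul_sum]
      refine Finset.sum_le_sum fun k hk => ?_
      have e1 : c * (ρ ^ k / G * (G / ρ ^ k * Y k ω) ^ 2)
          = ρ ^ k / G * (c * G ^ 2 * (Y k ω / ρ ^ k) ^ 2) := by
        field_simp
      rw [e1]
      refine mul_le_mul_of_nonneg_left ?_ (hp0 k hk)
      have e2 : ι₁ / (C₁ * ρ ^ k * √(max CS 1)) ^ 2 * Y k ω ^ 2
          = ι₁ / (C₁ ^ 2 * max CS 1) * (Y k ω / ρ ^ k) ^ 2 := by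
        rw [mul_pow, mul_pow, Real.sq_sqrt hS.le]
        have : ρ ^ k ≠ 0 := by positivity
        field_simp
      rw [e2]
      refine mul_le_mul_of_nonneg_right ?_ (sq_nonneg _)
      rw [hc]
      have e3 : ι₁ * (1 - ρ) ^ 2 / (C₁ ^ 2 * max CS 1) * G ^ 2
          = ι₁ / (C₁ ^ 2 * max CS 1) * (G * (1 - ρ)) ^ 2 := by ring
      rw [e3]
      have h4 : (G * (1 - ρ)) ^ 2 ≤ 1 :=
        pow_le_one₀ (mul_nonneg hG0.le (by linarith)) hG1
      have h5 : 0 ≤ ι₁ / (C₁ ^ 2 * max CS 1) := by positivity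
      nlinarith
    calc ∫⁻ ω, ENNReal.ofReal (Real.exp (c * (∑ k ∈ Finset.range (N + 1), Y k ω) ^ 2)) ∂μ
        ≤ ∫⁻ ω, ∑ k ∈ Finset.range (N + 1), ENNReal.ofReal (ρ ^ k / G) * ENNReal.ofReal
            (Real.exp (ι₁ / (C₁ * ρ ^ k * √(max CS 1)) ^ 2 * Y k ω ^ 2)) ∂μ := by
          refine lintegral_mono fun ω => (ENNReal.ofReal_le_ofReal (hpt ω)).trans (le_of_eq ?_)
          rw [ENNReal.ofReal_sum_of_nonneg fun k hk =>
            mul_nonneg (hp0 k hk) (Real.exp_pos _).le]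
          exact Finset.sum_congr rfl fun k hk => ENNReal.ofReal_mul (hp0 k hk)
      _ = ∑ k ∈ Finset.range (N + 1), ENNReal.ofReal (ρ ^ k / G) * ∫⁻ ω, ENNReal.ofReal
            (Real.exp (ι₁ / (C₁ * ρ ^ k * √(max CS 1)) ^ 2 * Y k ω ^ 2)) ∂μ := by
          rw [lintegral_finsetSum]
          · exact Finset.sum_congr rfl fun k _ =>
              lintegral_const_mul' _ _ ENNReal.ofReal_ne_top
          · intro k _
            have := hYm k
            fun_prop
      _ ≤ ∑ k ∈ Finset.range (N + 1), ENNReal.ofReal (ρ ^ k / G) * ENNReal.ofReal C₀ :=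
          Finset.sum_le_sum fun k _ => by gcongr; exact hYexp k
      _ = ENNReal.ofReal C₀ := by
          rw [← Finset.sum_mul, ← ENNReal.ofReal_sum_of_nonneg hp0, hp1]
          simp
  -- Fatou's lemma carries the bound, which does not depend on N, to the limit.
  have hlim : ∀ᵐ ω ∂μ, Tendsto (fun N : ℕ => ENNReal.ofReal (Real.exp
      (c * (∑ k ∈ Finset.range (N + 1), Y k ω) ^ 2))) atTop
      (𝓝 (ENNReal.ofReal (Real.exp (c * X t ω j ^ 2)))) := by
    filter_upwards [hV.tendsto_wold ht j] with ω hω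
    refine ENNReal.tendsto_ofReal ((Real.continuous_exp.tendsto _).comp ?_)
    exact ((hω.comp (tendsto_add_atTop_nat 1)).pow 2).const_mul c
  calc ∫⁻ ω, ENNReal.ofReal (Real.exp (c * X t ω j ^ 2)) ∂μ
      = ∫⁻ ω, liminf (fun N : ℕ => ENNReal.ofReal (Real.exp
          (c * (∑ k ∈ Finset.range (N + 1), Y k ω) ^ 2))) atTop ∂μ :=
        lintegral_congr_ae (hlim.mono fun ω hω => hω.liminf_eq.symm)
    _ ≤ liminf (fun N : ℕ => ∫⁻ ω, ENNReal.ofReal (Real.exp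
          (c * (∑ k ∈ Finset.range (N + 1), Y k ω) ^ 2)) ∂μ) atTop :=
        lintegral_liminf_le' fun N => by
          have : Measurable fun ω => ∑ k ∈ Finset.range (N + 1), Y k ω :=
            Finset.measurable_sum _ fun k _ => hYm k
          fun_prop
    _ ≤ liminf (fun _ : ℕ => ENNReal.ofReal C₀) atTop :=
        liminf_le_liminf (Eventually.of_forall hpartial)
    _ = ENNReal.ofReal C₀ := liminf_const _

theorem integrable_sq_of_lintegral_exp {y : Ω → ℝ} (hy : Measurable y) {c D : ℝ} (hc : 0 < c)
    (hD : ∫⁻ ω, ENNReal.ofReal (Real.exp (c * y ω ^ 2)) ∂μ ≤ ENNReal.ofReal D) :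
    MemLp y 2 μ := by
  rw [memLp_two_iff_integrable_sq hy.aestronglyMeasurable]
  have hint := integrable_exp_of_lintegral_le (μ := μ) (f := fun ω => c * y ω ^ 2)
    (by fun_prop) hD
  refine (hint.const_mul (1 / c)).mono (by fun_prop) (ae_of_all _ fun ω => ?_)
  rw [Real.norm_eq_abs, Real.norm_eq_abs, abs_of_nonneg (by positivity : 0 ≤ 1 / c * _),
    abs_of_nonneg (sq_nonneg _), one_div, inv_mul_eq_div, le_div_iff₀ hc]
  linarith [Real.add_one_le_exp (c * y ω ^ 2)]

theorem IsRegularVAR.memLp (hR : IsRegularVAR μ n A Sig ε ι₁ C₀ C₁ ρ CS M)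
    (hV : IsTVVAR μ n A Sig ε X) (hι : 0 < ι₁) (t : ℤ) (i : Fin d) :
    MemLp (fun ω => ε t ω i) 2 μ := by
  refine integrable_sq_of_lintegral_exp ((measurable_pi_apply i).comp (hV.meas t)) hι
    (D := C₀) ?_
  simpa using hR.subGauss t _ (l2_single i)

theorem IsRegularVAR.integral_innov (hR : IsRegularVAR μ n A Sig ε ι₁ C₀ C₁ ρ CS M)
    (hV : IsTVVAR μ n A Sig ε X) (hι : 0 < ι₁) (t : ℤ) (i : Fin d) :
    ∫ ω, innov n Sig ε t ω i ∂μ = 0 := by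
  simp only [innov_apply, dotProduct]
  rw [integral_finsetSum _ fun k _ =>
    ((hR.memLp hV hι t k).integrable (by norm_num)).const_mul _]
  exact Finset.sum_eq_zero fun k _ => by rw [integral_const_mul, hV.mean, mul_zero]

theorem IsRegularVAR.integral_innov_mul (hR : IsRegularVAR μ n A Sig ε ι₁ C₀ C₁ ρ CS M)
    (hV : IsTVVAR μ n A Sig ε X) (hι : 0 < ι₁) {t : ℤ} (ht : (t : ℝ) / n ≤ 1) (i j : Fin d) :
    Integrable (fun ω => innov n Sig ε t ω i * innov n Sig ε t ω j) μ ∧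
    ∫ ω, innov n Sig ε t ω i * innov n Sig ε t ω j ∂μ = Sig ((t : ℝ) / n) i j := by
  have hprod : ∀ k l, Integrable (fun ω => ε t ω k * ε t ω l) μ := fun k l =>
    (hR.memLp hV hι t k).integrable_mul (hR.memLp hV hι t l)
  set R := matSqrt (Sig ((t : ℝ) / n)) with hRdef
  have e : ∀ ω, innov n Sig ε t ω i * innov n Sig ε t ω j
      = ∑ k, ∑ l, R i k * R j l * (ε t ω k * ε t ω l) := fun ω => by
    simp only [innov_apply, dotProduct, Finset.sum_mul_sum]
    exact Finset.sum_congr rfl fun k _ => Finset.sum_congr rfl fun l _ => by ring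
  have hint : ∀ k l, Integrable (fun ω => R i k * R j l * (ε t ω k * ε t ω l)) μ :=
    fun k l => (hprod k l).const_mul _
  simp only [e]
  refine ⟨integrable_finsetSum _ fun k _ => integrable_finsetSum _ fun l _ => hint k l, ?_⟩
  rw [integral_finsetSum _ fun k _ => integrable_finsetSum _ fun l _ => hint k l]
  have h1 : ∀ k, ∫ ω, ∑ l, R i k * R j l * (ε t ω k * ε t ω l) ∂μ = R i k * R j k := fun k => by
    rw [integral_finsetSum _ fun l _ => hint k l]
    simp [integral_const_mul, hV.cov]
  simp only [h1]
  have h2 : (R * R) i j = ∑ k, R i k * R j k := by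
    rw [Matrix.mul_apply]
    refine Finset.sum_congr rfl fun k _ => ?_
    congr 1
    exact (congrFun (congrFun (matSqrt_transpose (Sig ((t : ℝ) / n))) k) j).symm
  rw [← h2, hRdef, matSqrt_mul_self (hR.posSig _ ht).posSemidef]

theorem abs_clamp_le {B : ℝ} (hB : 0 ≤ B) (v : ℝ) : |max (-B) (min B v)| ≤ B :=
  abs_le.2 ⟨le_max_left _ _, max_le (by linarith) (min_le_left _ _)⟩

/-- Deviation bound for weighted sums of products of innovations and (clamped) lagged values. -/
theorem IsRegularVAR.score_tail (hR : IsRegularVAR μ n A Sig ε ι₁ C₀ C₁ ρ CS M)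
    (hV : IsTVVAR μ n A Sig ε X) (hι : 0 < ι₁) (i j : Fin d) (w : ℕ → ℝ) {W B x : ℝ}
    (hW : 0 < W) (hw : ∑ t ∈ Finset.Icc 2 n, w t ^ 2 ≤ W) (hB : 0 < B) (hx : 0 < x) :
    μ {ω | ¬ |∑ t ∈ Finset.Icc 2 n, w t * max (-B) (min B (X (t - 1) ω j)) *
        innov n Sig ε t ω i| ≤ x}
      ≤ ENNReal.ofReal (2 * Real.exp (-(x ^ 2 / (4 * (8 * C₀ / (ι₁ / max CS 1)) * B ^ 2 * W)))) := by
  classical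
  set G := 8 * C₀ / (ι₁ / max CS 1) with hG
  have hC0 := hR.one_le_C₀ hι i
  have hG0 : 0 < G := by positivity
  have hver : ∀ t : ℕ, ∃ u : Ω → ℝ, Measurable[past ε (t : ℤ)] u ∧
      (t ∈ Finset.Icc 2 n → ∀ᵐ ω ∂μ, u ω = X (t - 1) ω j) := fun t => by
    by_cases ht : t ∈ Finset.Icc 2 n
    · have ht' := Finset.mem_Icc.1 ht
      obtain ⟨u, hu, hux⟩ := hV.exists_past_version (t := t - 1) (by omega) j
      have e : ((t - 1 : ℕ) : ℤ) + 1 = t := by omega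
      rw [e] at hu
      exact ⟨u, hu, fun _ => hux⟩
    · exact ⟨fun _ => 0, measurable_const, fun h => absurd h ht⟩
  choose u hu hux using hver
  have huX : ∀ᵐ ω ∂μ, ∀ t ∈ Finset.Icc 2 n, u t ω = X (t - 1) ω j := by
    rw [Finset.eventually_all]
    exact fun t ht => hux t ht
  set f : Ω → ℝ := fun ω => ∑ t ∈ Finset.Icc 2 n, w t * max (-B) (min B (u t ω)) *
        innov n Sig ε t ω i with hf
  have hfm : Measurable f := by
    refine Finset.measurable_sum _ fun t _ => ?_
    have h1 := (hu t).mono (past_le hV.meas _) le_rfl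
    have h2 := hV.measurable_innov (t : ℤ) i
    fun_prop
  have hset : μ {ω | ¬ |∑ t ∈ Finset.Icc 2 n, w t * max (-B) (min B (X (t - 1) ω j)) *
        innov n Sig ε t ω i| ≤ x} ≤ μ {ω | ¬ |f ω| ≤ x} := by
    refine measure_mono_ae (huX.mono fun ω hω hx' => ?_)
    have : f ω = ∑ t ∈ Finset.Icc 2 n, w t * max (-B) (min B (X (t - 1) ω j)) *
        innov n Sig ε t ω i := Finset.sum_congr rfl fun t ht => by rw [hω t ht]
    change ¬ |f ω| ≤ x
    rw [this]
    exact hx'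
  refine hset.trans ?_
  -- The minimiser of the Chernoff exponent GB²Wθ² − θx.
  set θ := x / (2 * G * B ^ 2 * W) with hθ
  have hθ0 : 0 < θ := by positivity
  have hv := measure_not_abs_le_of_lintegral_exp (μ := μ) (x := x) hfm.aemeasurable hθ0
    (v := G * θ ^ 2 * B ^ 2 * W) (fun θ' hθ' => ?_)
  · refine hv.trans (ENNReal.ofReal_le_ofReal ?_)
    have e : G * θ ^ 2 * B ^ 2 * W - θ * x = -(x ^ 2 / (4 * G * B ^ 2 * W)) := by
      rw [hθ]; field_simp; ring
    rw [e]
  · have h1 := lintegral_exp_sum_le (μ := μ) hV.meas hV.indep u hu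
      (fun t v z => θ' * (w t * max (-B) (min B v) * (matSqrt (Sig (((t : ℤ) : ℝ) / n)) i ⬝ᵥ z)))
      (fun t => by
        simp only [dotProduct]
        fun_prop)
      (fun t => G * θ ^ 2 * B ^ 2 * w t ^ 2) 2 n (by norm_num) (fun t ht v => ?_)
    · have e : ∀ ω, θ' * f ω = ∑ t ∈ Finset.Icc 2 n, θ' * (w t * max (-B) (min B (u t ω)) *
          (matSqrt (Sig (((t : ℤ) : ℝ) / n)) i ⬝ᵥ ε t ω)) := fun ω => by
        rw [hf, Finset.mul_sum]; rfl
      simp only [e]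
      refine h1.trans (ENNReal.ofReal_le_ofReal (Real.exp_le_exp.2 ?_))
      rw [← Finset.mul_sum]
      gcongr
    · have hle : (((t : ℕ) : ℤ) : ℝ) / n ≤ 1 :=
        int_div_le_one (by exact_mod_cast (Finset.mem_Icc.1 ht).2)
      have h2 := lintegral_exp_mul_le_of_sq (μ := μ) (hV.measurable_innov (t : ℤ) i)
        (by positivity) hC0 (hR.lintegral_exp_innov_le hι i hle)
        (hR.integral_innov hV hι _ i) (θ' * (w t * max (-B) (min B v)))
      simp only [innov_apply] at h2
      have e : ∀ ω, θ' * (w t * max (-B) (min B v) *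
          (matSqrt (Sig (((t : ℤ) : ℝ) / n)) i ⬝ᵥ ε t ω))
          = θ' * (w t * max (-B) (min B v)) *
          (matSqrt (Sig (((t : ℤ) : ℝ) / n)) i ⬝ᵥ ε t ω) := fun ω => by ring
      simp only [e]
      refine h2.trans (ENNReal.ofReal_le_ofReal (Real.exp_le_exp.2 ?_))
      rw [← hG]
      -- The clamp bounds the multiplier for every frozen value v; an unbounded lag would not give a
      -- step bound uniform in v.
      have h3 : max (-B) (min B v) ^ 2 ≤ B ^ 2 := by
        rw [← sq_abs]
        exact pow_le_pow_left₀ (abs_nonneg _) (abs_clamp_le hB.le v) 2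
      have h4 : θ' ^ 2 = θ ^ 2 := by rw [← sq_abs, hθ']
      calc G * (θ' * (w t * max (-B) (min B v))) ^ 2
          = G * θ ^ 2 * w t ^ 2 * max (-B) (min B v) ^ 2 := by rw [← h4]; ring
        _ ≤ G * θ ^ 2 * w t ^ 2 * B ^ 2 := by gcongr
        _ = _ := by ring

/-- Deviation bound for weighted sample covariances of the innovations. -/
theorem IsRegularVAR.cov_tail (hR : IsRegularVAR μ n A Sig ε ι₁ C₀ C₁ ρ CS M)
    (hV : IsTVVAR μ n A Sig ε X) (hι : 0 < ι₁) (i j : Fin d) (w : ℕ → ℝ) {W G θ x : ℝ}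
    (hw : ∑ t ∈ Finset.Icc 2 n, w t ^ 2 ≤ W) (hG : ∀ t, |w t| ≤ G) (hθ : 0 < θ)
    (hθG : θ * G ≤ ι₁ / max CS 1 / 2) :
    μ {ω | ¬ |∑ t ∈ Finset.Icc 2 n, w t * (innov n Sig ε t ω i * innov n Sig ε t ω j
        - Sig (rt n t) i j)| ≤ x}
      ≤ ENNReal.ofReal (2 * Real.exp
          (8 * (Real.exp ι₁ * C₀) / (ι₁ / max CS 1) ^ 2 * θ ^ 2 * W - θ * x)) := by
  set c := ι₁ / max CS 1 with hc
  have hc0 : 0 < c := by positivity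
  have hC0 := hR.one_le_C₀ hι i
  set f : Ω → ℝ := fun ω => ∑ t ∈ Finset.Icc 2 n, w t * (innov n Sig ε t ω i *
    innov n Sig ε t ω j - Sig (rt n t) i j) with hf
  have hym : ∀ t : ℕ, Measurable fun ω => innov n Sig ε t ω i * innov n Sig ε t ω j
      - Sig (rt n t) i j := fun t => by
    have h2 := hV.measurable_innov (t : ℤ) i
    have h3 := hV.measurable_innov (t : ℤ) j
    fun_prop
  have hfm : Measurable f := Finset.measurable_sum _ fun t _ => (hym t).const_mul _
  refine measure_not_abs_le_of_lintegral_exp (μ := μ) (x := x) hfm.aemeasurable hθ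
    (fun θ' hθ' => ?_)
  have h1 := lintegral_exp_sum_le (μ := μ) hV.meas hV.indep (fun _ _ => 0)
    (fun t => measurable_const)
    (fun t _ z => θ' * (w t * ((matSqrt (Sig (((t : ℤ) : ℝ) / n)) i ⬝ᵥ z) *
      (matSqrt (Sig (((t : ℤ) : ℝ) / n)) j ⬝ᵥ z) - Sig (rt n t) i j)))
    (fun t => by
      simp only [dotProduct]
      fun_prop)
    (fun t => 8 * (Real.exp ι₁ * C₀) / c ^ 2 * θ ^ 2 * w t ^ 2) 2 n (by norm_num)
    (fun t ht _ => ?_)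
  · have e : ∀ ω, θ' * f ω = ∑ t ∈ Finset.Icc 2 n,
        θ' * (w t * ((matSqrt (Sig (((t : ℤ) : ℝ) / n)) i ⬝ᵥ ε t ω) *
          (matSqrt (Sig (((t : ℤ) : ℝ) / n)) j ⬝ᵥ ε t ω) - Sig (rt n t) i j)) := fun ω => by
      rw [hf, Finset.mul_sum]; rfl
    simp only [e]
    refine h1.trans (ENNReal.ofReal_le_ofReal (Real.exp_le_exp.2 ?_))
    rw [← Finset.mul_sum]
    gcongr
  · have hle : (((t : ℕ) : ℤ) : ℝ) / n ≤ 1 :=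
      int_div_le_one (by exact_mod_cast (Finset.mem_Icc.1 ht).2)
    have hrt : (((t : ℕ) : ℤ) : ℝ) / n = rt n t := by simp [rt]
    have hSle : |Sig (rt n t) i j| ≤ max CS 1 := by
      rw [← hrt]
      exact (abs_entry_le_opNorm _ _ _).trans ((hR.normSig _ hle).trans (le_max_left _ _))
    -- A product of two sub-Gaussian variables has an exponential moment in its modulus, by |ab| ≤
    -- (a² + b²)/2 and the same inequality for the exponentials. Centring costs c·max CS 1 = ι₁.
    -- Since the moment is only exponential, θ must be limited as in `hθG`.
    have hexp : ∫⁻ ω, ENNReal.ofReal (Real.exp (c * |innov n Sig ε t ω i *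
        innov n Sig ε t ω j - Sig (rt n t) i j|)) ∂μ ≤ ENNReal.ofReal (Real.exp ι₁ * C₀) := by
      have hpt : ∀ ω, Real.exp (c * |innov n Sig ε t ω i * innov n Sig ε t ω j
          - Sig (rt n t) i j|) ≤ Real.exp ι₁ / 2 * Real.exp (c * innov n Sig ε t ω i ^ 2)
            + Real.exp ι₁ / 2 * Real.exp (c * innov n Sig ε t ω j ^ 2) := by
        intro ω
        set a := innov n Sig ε t ω i
        set b := innov n Sig ε t ω j
        have h2 : |a * b - Sig (rt n t) i j| ≤ (a ^ 2 + b ^ 2) / 2 + max CS 1 := by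
          refine (abs_sub _ _).trans (add_le_add ?_ hSle)
          rw [abs_mul]
          nlinarith [sq_nonneg (|a| - |b|), sq_abs a, sq_abs b]
        have h3 : c * |a * b - Sig (rt n t) i j| ≤ ι₁ + c * a ^ 2 / 2 + c * b ^ 2 / 2 := by
          have : c * max CS 1 = ι₁ := by rw [hc]; field_simp
          nlinarith
        have h4 : ∀ z : ℝ, Real.exp z = Real.exp (z / 2) ^ 2 := fun z => by
          rw [← Real.exp_nat_mul]; congr 1; push_cast; ring
        calc Real.exp (c * |a * b - Sig (rt n t) i j|)
            ≤ Real.exp (ι₁ + c * a ^ 2 / 2 + c * b ^ 2 / 2) := Real.exp_le_exp.2 h3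
          _ = Real.exp ι₁ * (Real.exp (c * a ^ 2 / 2) * Real.exp (c * b ^ 2 / 2)) := by
              rw [Real.exp_add, Real.exp_add]; ring
          _ ≤ _ := by
              rw [h4 (c * a ^ 2), h4 (c * b ^ 2)]
              nlinarith [mul_nonneg (Real.exp_pos ι₁).le
                (sq_nonneg (Real.exp (c * a ^ 2 / 2) - Real.exp (c * b ^ 2 / 2)))]
      have hmi := hV.measurable_innov (t : ℤ) i
      have hmj := hV.measurable_innov (t : ℤ) j
      calc _ ≤ ∫⁻ ω, (ENNReal.ofReal (Real.exp ι₁ / 2) *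
            ENNReal.ofReal (Real.exp (c * innov n Sig ε t ω i ^ 2))
            + ENNReal.ofReal (Real.exp ι₁ / 2) *
            ENNReal.ofReal (Real.exp (c * innov n Sig ε t ω j ^ 2))) ∂μ := by
            refine lintegral_mono fun ω => (ENNReal.ofReal_le_ofReal (hpt ω)).trans (le_of_eq ?_)
            rw [ENNReal.ofReal_add (by positivity) (by positivity),
              ENNReal.ofReal_mul (by positivity), ENNReal.ofReal_mul (by positivity)]
        _ ≤ ENNReal.ofReal (Real.exp ι₁ / 2) * ENNReal.ofReal C₀
            + ENNReal.ofReal (Real.exp ι₁ / 2) * ENNReal.ofReal C₀ := by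
            rw [lintegral_add_left (by fun_prop), lintegral_const_mul' _ _ ENNReal.ofReal_ne_top,
              lintegral_const_mul' _ _ ENNReal.ofReal_ne_top]
            gcongr
            · exact hR.lintegral_exp_innov_le hι i hle
            · exact hR.lintegral_exp_innov_le hι j hle
        _ = _ := by
            rw [← ENNReal.ofReal_mul (by positivity), ← ENNReal.ofReal_add (by positivity)
              (by positivity)]
            congr 1; ring
    have hcov := hR.integral_innov_mul hV hι hle i j
    have hmean : ∫ ω, (innov n Sig ε t ω i * innov n Sig ε t ω j - Sig (rt n t) i j) ∂μ = 0 := by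
      rw [integral_sub hcov.1 (integrable_const _), hcov.2, hrt]
      simp
    have hθw : |θ' * w t| ≤ c / 2 := by
      rw [abs_mul, hθ']
      exact (mul_le_mul_of_nonneg_left (hG t) hθ.le).trans hθG
    have h2 := lintegral_exp_mul_le (μ := μ) (hym t) hc0 (by positivity) hexp hmean hθw
    simp only [innov_apply] at h2
    simp only [← mul_assoc] at h2 ⊢
    refine h2.trans (ENNReal.ofReal_le_ofReal (Real.exp_le_exp.2 (le_of_eq ?_)))
    have h4 : θ' ^ 2 = θ ^ 2 := by rw [← sq_abs, hθ']
    rw [mul_pow, h4]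
    ring

end VAR


/-! ### Local linear regression written as weighted least squares. -/

/-- Kernel weights of the local linear loss. -/
noncomputable def kwt (n : ℕ) (K : ℝ → ℝ) (h τ : ℝ) (t : ℕ) : ℝ := (1 / (n : ℝ)) * Kh K h (rt n t - τ)

/-- The local linear regressors `(x_{t-1}, (τ_t - τ)/h · x_{t-1})`. -/
noncomputable def lagReg {d : ℕ} (n : ℕ) (h τ : ℝ) (x : ℕ → Fin d → ℝ) (t : ℕ) : Fin d ⊕ Fin d → ℝ :=
  Sum.elim (fun j => x (t - 1) j) (fun j => (rt n t - τ) / h * x (t - 1) j)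

open scoped Classical in
/-- The local linear parameter `(α_i(τ), h α_i'(τ))`, the slope being restricted to `J_i`. -/
noncomputable def localParam {d : ℕ} (n : ℕ) (A : ℝ → Matrix (Fin d) (Fin d) ℝ) (h : ℝ) (i : Fin d)
    (τ : ℝ) : Fin d ⊕ Fin d → ℝ :=
  Sum.elim (fun j => A τ i j) (fun j => if j ∈ J n A i then h * dA A τ i j else 0)

theorem dotProduct_lagReg {d : ℕ} (n : ℕ) (h τ : ℝ) (x : ℕ → Fin d → ℝ) (t : ℕ)
    (u : Fin d ⊕ Fin d → ℝ) :
    u ⬝ᵥ lagReg n h τ x t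
      = ∑ j, (u (.inl j) + (rt n t - τ) / h * u (.inr j)) * x (t - 1) j := by
  rw [dotProduct, Fintype.sum_sum_type, ← Finset.sum_add_distrib]
  refine Finset.sum_congr rfl fun j _ => ?_
  simp only [lagReg, Sum.elim_inl, Sum.elim_inr]
  ring

/-- With slopes measured in units of h, the regressors are bounded by the lagged values on the
support of the kernel, and levels and slopes carry the same ℓ¹-weight. -/
theorem loss_eq_wls {d : ℕ} (n : ℕ) (K : ℝ → ℝ) {h : ℝ} (hh : h ≠ 0) (x : ℕ → Fin d → ℝ)
    (i : Fin d) (a b : Fin d → ℝ) (τ : ℝ) :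
    loss n K h x i a b τ = wls (Finset.Icc 2 n) (kwt n K h τ) (fun t => x t i)
      (lagReg n h τ x) (Sum.elim a (fun j => h * b j)) := by
  rw [loss, wls, Finset.mul_sum]
  refine Finset.sum_congr rfl fun t _ => ?_
  rw [dotProduct_lagReg, kwt]
  have e : ∀ j, (a j + b j * (rt n t - τ)) * x (t - 1) j
      = (a j + (rt n t - τ) / h * (h * b j)) * x (t - 1) j := fun j => by
    field_simp
  simp only [Sum.elim_inl, Sum.elim_inr, e]
  ring

/-- The form uses the times 1, …, n while the loss starts at 2; `RegPath.wquad_ge` accounts for the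
extra term. -/
theorem dotProduct_Psi {d : ℕ} (n : ℕ) (K : ℝ → ℝ) (h : ℝ) (x : ℕ → Fin d → ℝ) (τ : ℝ)
    (u : Fin d ⊕ Fin d → ℝ) :
    u ⬝ᵥ (Psi n K h x τ *ᵥ u) = wquad (Finset.Icc 1 n) (kwt n K h τ) (lagReg n h τ x) u := by
  have hb : ∀ (k : ℕ) (v w : Fin d → ℝ), v ⬝ᵥ (PsiBlock n K h x τ k *ᵥ w)
      = ∑ t ∈ Finset.Icc 1 n, kwt n K h τ t * ((rt n t - τ) / h) ^ k *
          ((v ⬝ᵥ x (t - 1)) * (w ⬝ᵥ x (t - 1))) := by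
    intro k v w
    rw [PsiBlock, Matrix.smul_mulVec, Matrix.sum_mulVec, dotProduct_smul, dotProduct_sum,
      smul_eq_mul, Finset.mul_sum]
    refine Finset.sum_congr rfl fun t _ => ?_
    rw [Matrix.smul_mulVec, Matrix.vecMulVec_mulVec, dotProduct_smul, kwt, smul_eq_mul,
      dotProduct_comm w]
    simp only [op_smul_eq_smul, dotProduct_smul, smul_eq_mul]
    ring
  set u₁ : Fin d → ℝ := fun j => u (.inl j)
  set u₂ : Fin d → ℝ := fun j => u (.inr j)
  have hu : u = Sum.elim u₁ u₂ := by ext j; cases j <;> rfl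
  rw [hu, Psi, Matrix.fromBlocks_mulVec, Sum.elim_comp_inl, Sum.elim_comp_inr]
  have hd : ∀ v₁ v₂ w₁ w₂ : Fin d → ℝ, Sum.elim v₁ v₂ ⬝ᵥ Sum.elim w₁ w₂ = v₁ ⬝ᵥ w₁ + v₂ ⬝ᵥ w₂ :=
    fun v₁ v₂ w₁ w₂ => by simp [dotProduct, Fintype.sum_sum_type]
  rw [hd, dotProduct_add, dotProduct_add, hb, hb, hb, hb, wquad, ← Finset.sum_add_distrib,
    ← Finset.sum_add_distrib, ← Finset.sum_add_distrib]
  refine Finset.sum_congr rfl fun t _ => ?_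
  have e : Sum.elim u₁ u₂ ⬝ᵥ lagReg n h τ x t
      = u₁ ⬝ᵥ x (t - 1) + (rt n t - τ) / h * (u₂ ⬝ᵥ x (t - 1)) := by
    rw [dotProduct_lagReg, dotProduct, dotProduct, Finset.mul_sum, ← Finset.sum_add_distrib]
    refine Finset.sum_congr rfl fun j _ => ?_
    simp only [Sum.elim_inl, Sum.elim_inr]
    ring
  rw [e]
  ring

/-- A path of the model and its estimate on which the stochastic terms obey their bounds:
`L` stands for `log (n ∨ d)` and `δ` for the estimation error of the path. -/
structure RegPath {d : ℕ} (n : ℕ) (A : ℝ → Matrix (Fin d) (Fin d) ℝ) (K : ℝ → ℝ)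
    (h L δ B M G a : ℝ) (x xhat e : ℕ → Fin d → ℝ) : Prop where
  one_le_s : 1 ≤ sparsity n A
  h_pos : 0 < h
  h_le : h ≤ 1
  one_le_nh : 1 ≤ n * h
  one_le_L : 1 ≤ L
  one_le_B : 1 ≤ B
  a_nonneg : 0 ≤ a
  M_nonneg : 0 ≤ M
  K_le : ∀ x, |K x| ≤ G
  K_nonneg : ∀ x, 0 ≤ K x
  K_supp : ∀ x, x ∉ Icc (-1 : ℝ) 1 → K x = 0
  smooth : ∀ i j, ContDiffOn ℝ 2 (fun τ => A τ i j) (Icc 0 1)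
  bound : ∀ i j, ∀ τ ∈ Icc (0 : ℝ) 1, |iteratedDerivWithin 2 (fun u => A u i j) (Icc 0 1) τ| ≤ M
  A_le : ∀ t ∈ Finset.Icc 1 n, ∀ i j, |A (rt n t) i j| ≤ a
  x_le : ∀ t ≤ n, ∀ j, |x t j| ≤ B * √L
  e_le : ∀ t ∈ Finset.Icc 1 n, ∀ j, |e t j| ≤ B * √L
  recursion : ∀ t ∈ Finset.Icc 1 n, ∀ i, x t i = ∑ j, A (rt n t) i j * x (t - 1) j + e t i
  δ_nonneg : 0 ≤ δ
  δ_le : δ ≤ 1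
  xhat_le : ∀ t ∈ Finset.Icc 1 n, ∀ j, |xhat t j - x t j| ≤ δ
  score_le : ∀ i j, ∀ r ∈ Finset.Icc 1 n, ∀ k < 2,
    |∑ t ∈ Finset.Icc 2 n, kwt n K h (rt n r) t * ((rt n t - rt n r) / h) ^ k * x (t - 1) j * e t i|
      ≤ B * (L / √(n * h))

/-! ### Deterministic consequences of the bounds on a path. -/

namespace RegPath

variable {d n : ℕ} {A : ℝ → Matrix (Fin d) (Fin d) ℝ} {K : ℝ → ℝ} {h L δ B M G a : ℝ}
  {x xhat e : ℕ → Fin d → ℝ}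

theorem one_le_n (P : RegPath n A K h L δ B M G a x xhat e) : 1 ≤ n := by
  rcases Nat.eq_zero_or_pos n with h0 | h0
  · have := P.one_le_nh
    rw [h0] at this
    norm_num at this
  · exact h0

theorem G_nonneg (P : RegPath n A K h L δ B M G a x xhat e) : 0 ≤ G :=
  (abs_nonneg _).trans (P.K_le 0)

theorem one_le_sqrtL (P : RegPath n A K h L δ B M G a x xhat e) : 1 ≤ √L :=
  Real.one_le_sqrt.2 P.one_le_L

theorem one_le_BL (P : RegPath n A K h L δ B M G a x xhat e) : 1 ≤ B * √L := by
  nlinarith [P.one_le_sqrtL, P.one_le_B]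

theorem kwt_nonneg (P : RegPath n A K h L δ B M G a x xhat e) (τ : ℝ) (t : ℕ) :
    0 ≤ kwt n K h τ t := by
  have := P.h_pos
  have := P.K_nonneg ((rt n t - τ) / h)
  rw [kwt, Kh]
  positivity

theorem kwt_le (P : RegPath n A K h L δ B M G a x xhat e) (τ : ℝ) (t : ℕ) :
    kwt n K h τ t ≤ G / (n * h) := by
  have h1 := P.h_pos
  have h2 : (0 : ℝ) < n := by exact_mod_cast P.one_le_n
  have h3 := (le_abs_self _).trans (P.K_le ((rt n t - τ) / h))
  calc kwt n K h τ t = K ((rt n t - τ) / h) / (n * h) := by rw [kwt, Kh]; field_simp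
    _ ≤ _ := by gcongr

theorem kwt_eq_zero (P : RegPath n A K h L δ B M G a x xhat e) {τ : ℝ} {t : ℕ}
    (ht : ¬ |(rt n t - τ) / h| ≤ 1) : kwt n K h τ t = 0 := by
  rw [kwt, Kh, P.K_supp, mul_zero, mul_zero]
  rwa [mem_Icc, ← abs_le]

theorem sum_kwt_le (P : RegPath n A K h L δ B M G a x xhat e) (τ : ℝ) (I : Finset ℕ) :
    ∑ t ∈ I, kwt n K h τ t ≤ 3 * G := by
  have h1 := P.h_pos
  have h2 : (0 : ℝ) < n := by exact_mod_cast P.one_le_n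
  have h3 := sum_abs_kernel_le P.K_le P.K_supp P.h_pos P.one_le_nh τ I
  have e1 : ∑ t ∈ I, kwt n K h τ t = (∑ t ∈ I, |K ((rt n t - τ) / h)|) / (n * h) := by
    rw [Finset.sum_div]
    refine Finset.sum_congr rfl fun t _ => ?_
    rw [kwt, Kh, abs_of_nonneg (P.K_nonneg _)]
    field_simp
  rw [e1, div_le_iff₀ (by positivity)]
  exact h3

/-- Kernel-weighted sums of terms that are bounded on the support of the kernel. -/
theorem abs_sum_kwt_mul_le (P : RegPath n A K h L δ B M G a x xhat e) (τ : ℝ) (I : Finset ℕ)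
    (f : ℕ → ℝ) {c : ℝ} (hc : 0 ≤ c) (hf : ∀ t ∈ I, |(rt n t - τ) / h| ≤ 1 → |f t| ≤ c) :
    |∑ t ∈ I, kwt n K h τ t * f t| ≤ 3 * G * c := by
  calc |∑ t ∈ I, kwt n K h τ t * f t| ≤ ∑ t ∈ I, |kwt n K h τ t * f t| :=
        Finset.abs_sum_le_sum_abs _ _
    _ ≤ ∑ t ∈ I, kwt n K h τ t * c := by
        refine Finset.sum_le_sum fun t ht => ?_
        rw [abs_mul, abs_of_nonneg (P.kwt_nonneg _ _)]
        by_cases h1 : |(rt n t - τ) / h| ≤ 1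
        · exact mul_le_mul_of_nonneg_left (hf t ht h1) (P.kwt_nonneg _ _)
        · rw [P.kwt_eq_zero h1, zero_mul, zero_mul]
    _ = (∑ t ∈ I, kwt n K h τ t) * c := by rw [Finset.sum_mul]
    _ ≤ _ := mul_le_mul_of_nonneg_right (P.sum_kwt_le τ I) hc

theorem rt_mem (P : RegPath n A K h L δ B M G a x xhat e) {t : ℕ} (ht : t ∈ Finset.Icc 1 n) :
    rt n t ∈ Icc (0 : ℝ) 1 := by
  have h2 : (0 : ℝ) < n := by exact_mod_cast P.one_le_n
  have h3 : (t : ℝ) ≤ n := by exact_mod_cast (Finset.mem_Icc.1 ht).2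
  exact ⟨by rw [rt]; positivity, by rw [rt]; exact div_le_one_of_le₀ h3 h2.le⟩

theorem A_eq_zero {i j : Fin d} (hj : j ∉ J n A i) {t : ℕ} (ht : t ∈ Finset.Icc 1 n) :
    A (rt n t) i j = 0 := by
  by_contra hc
  exact hj (mem_iUnion.2 ⟨⟨t, ht⟩, hc⟩)

theorem xhat_abs_le (P : RegPath n A K h L δ B M G a x xhat e) {t : ℕ} (ht : t ∈ Finset.Icc 1 n)
    (j : Fin d) : |xhat t j| ≤ 2 * (B * √L) := by
  have h1 := P.xhat_le t ht j
  have h2 := P.x_le t (Finset.mem_Icc.1 ht).2 j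
  have h3 : |xhat t j| ≤ |xhat t j - x t j| + |x t j| := by
    simpa using abs_add_le (xhat t j - x t j) (x t j)
  linarith [P.δ_le, P.one_le_BL]

theorem card_J_le (i : Fin d) : (J n A i).ncard ≤ sparsity n A :=
  Finset.le_sup (f := fun i => (J n A i).ncard) (Finset.mem_univ i)

-- Sums supported on J_i cost a factor s: this is the s in the bias and in the δ-term of ζ†.
open scoped Classical in
theorem sum_J_le {i : Fin d} {f : Fin d → ℝ} {c : ℝ} (hc : 0 ≤ c)
    (h0 : ∀ j ∉ J n A i, f j = 0) (h1 : ∀ j ∈ J n A i, |f j| ≤ c) :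
    |∑ j, f j| ≤ sparsity n A * c := by
  calc |∑ j, f j| ≤ ∑ j, |f j| := Finset.abs_sum_le_sum_abs _ _
    _ ≤ ∑ j, if j ∈ J n A i then c else 0 := by
        refine Finset.sum_le_sum fun j _ => ?_
        split_ifs with hj
        · exact h1 j hj
        · rw [h0 j hj, abs_zero]
    _ = (J n A i).ncard * c := by
        rw [← Finset.sum_filter, Finset.sum_const, nsmul_eq_mul, Set.ncard_eq_toFinset_card',
          Set.toFinset]
        congr 3
        ext j
        simp
    _ ≤ _ := by
        gcongr
        exact card_J_le i

/-- The residual at the true parameter is the innovation up to bias and estimation error. -/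
theorem abs_resid_sub_le (P : RegPath n A K h L δ B M G a x xhat e) (i : Fin d) {r t : ℕ}
    (hr : r ∈ Finset.Icc 1 n) (ht : t ∈ Finset.Icc 2 n) (hz : |(rt n t - rt n r) / h| ≤ 1) :
    |xhat t i - localParam n A h i (rt n r) ⬝ᵥ lagReg n h (rt n r) xhat t - e t i|
      ≤ sparsity n A * (M * B * h ^ 2 * √L + (1 + a + M) * δ) := by
  classical
  have hs : (1 : ℝ) ≤ sparsity n A := by exact_mod_cast P.one_le_s
  have ht1 : t ∈ Finset.Icc 1 n := Finset.Icc_subset_Icc (by norm_num) le_rfl ht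
  have ht2 : t - 1 ∈ Finset.Icc 1 n := by
    rw [Finset.mem_Icc] at ht ⊢; omega
  have hhp := P.h_pos
  set τ := rt n r
  set D := rt n t - τ with hD
  have hDh : |D| ≤ h := by
    rw [abs_div, abs_of_pos hhp, div_le_one hhp] at hz
    exact hz
  have hD2 : D ^ 2 ≤ h ^ 2 := by rw [← sq_abs]; exact pow_le_pow_left₀ (abs_nonneg _) hDh 2
  have htay : ∀ j, |A (rt n t) i j - A τ i j - dA A τ i j * D| ≤ M * h ^ 2 := fun j =>
    (abs_taylor_le (P.smooth i j) (P.bound i j) (P.rt_mem ht1) (P.rt_mem hr)).trans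
      (mul_le_mul_of_nonneg_left hD2 P.M_nonneg)
  -- Off J_i the level vanishes on the grid and the slope is switched off, so the local predictor
  -- involves J_i only.
  have hloc : localParam n A h i τ ⬝ᵥ lagReg n h τ xhat t
      = ∑ j, (if j ∈ J n A i then A τ i j + dA A τ i j * D else 0) * xhat (t - 1) j := by
    rw [dotProduct_lagReg]
    refine Finset.sum_congr rfl fun j _ => ?_
    congr 1
    simp only [localParam, Sum.elim_inl, Sum.elim_inr]
    split_ifs with hj
    · field_simp
      rw [hD]
      ring
    · rw [A_eq_zero hj hr]; simp
  -- Three errors: that of the response, the Taylor remainder against the true lag, and the local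
  -- coefficients against the error of the lag.
  have hmain : xhat t i - localParam n A h i τ ⬝ᵥ lagReg n h τ xhat t - e t i
      = (xhat t i - x t i)
        + ∑ j, (if j ∈ J n A i then A (rt n t) i j - A τ i j - dA A τ i j * D else 0) * x (t - 1) j
        - ∑ j, (if j ∈ J n A i then A τ i j + dA A τ i j * D else 0) *
            (xhat (t - 1) j - x (t - 1) j) := by
    rw [hloc]
    have h1 := P.recursion t ht1 i
    have h2 : ∑ j, A (rt n t) i j * x (t - 1) j
        = ∑ j, (if j ∈ J n A i then A (rt n t) i j - A τ i j - dA A τ i j * D else 0) * x (t - 1) j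
        - ∑ j, (if j ∈ J n A i then A τ i j + dA A τ i j * D else 0) *
            (xhat (t - 1) j - x (t - 1) j)
        + ∑ j, (if j ∈ J n A i then A τ i j + dA A τ i j * D else 0) * xhat (t - 1) j := by
      rw [← Finset.sum_sub_distrib, ← Finset.sum_add_distrib]
      refine Finset.sum_congr rfl fun j _ => ?_
      split_ifs with hj
      · ring
      · rw [A_eq_zero hj ht1]; ring
    linarith
  have hb1 : |∑ j, (if j ∈ J n A i then A (rt n t) i j - A τ i j - dA A τ i j * D else 0) *
      x (t - 1) j| ≤ sparsity n A * (M * h ^ 2 * (B * √L)) := by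
    have := P.M_nonneg
    have := P.one_le_BL
    refine sum_J_le (i := i) (by positivity) (fun j hj => by simp [hj]) (fun j hj => ?_)
    simp only [hj, if_true]
    rw [abs_mul]
    exact mul_le_mul (htay j) (P.x_le _ (Finset.mem_Icc.1 ht2).2 j) (abs_nonneg _) (by positivity)
  have hb2 : |∑ j, (if j ∈ J n A i then A τ i j + dA A τ i j * D else 0) *
            (xhat (t - 1) j - x (t - 1) j)| ≤ sparsity n A * ((a + M) * δ) := by
    have h1 := P.M_nonneg
    have h2 := P.a_nonneg
    have h3 := P.δ_nonneg
    refine sum_J_le (i := i) (by positivity) (fun j hj => by simp [hj]) (fun j hj => ?_)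
    simp only [hj, if_true]
    rw [abs_mul]
    refine mul_le_mul ?_ (P.xhat_le _ ht2 j) (abs_nonneg _) (by positivity)
    -- The derivative has no bound of its own; the local coefficient is bounded as the coefficient
    -- at τ_t minus a Taylor remainder.
    have e1 : A τ i j + dA A τ i j * D
        = A (rt n t) i j - (A (rt n t) i j - A τ i j - dA A τ i j * D) := by ring
    rw [e1]
    refine (abs_sub _ _).trans (add_le_add (P.A_le t ht1 i j) ((htay j).trans ?_))
    have : h ^ 2 ≤ 1 := pow_le_one₀ P.h_pos.le P.h_le
    nlinarith
  have hb3 := P.xhat_le t ht1 i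
  rw [hmain]
  have hb4 : |xhat t i - x t i| ≤ sparsity n A * δ := hb3.trans (by nlinarith [P.δ_nonneg])
  calc _ ≤ |xhat t i - x t i + ∑ j, (if j ∈ J n A i then A (rt n t) i j - A τ i j - dA A τ i j * D
          else 0) * x (t - 1) j| + |∑ j, (if j ∈ J n A i then A τ i j + dA A τ i j * D else 0) *
            (xhat (t - 1) j - x (t - 1) j)| := abs_sub _ _
    _ ≤ sparsity n A * δ + sparsity n A * (M * h ^ 2 * (B * √L))
        + sparsity n A * ((a + M) * δ) := by
        refine add_le_add ((abs_add_le _ _).trans (add_le_add hb4 hb1)) hb2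
    _ = _ := by ring

/-- The rate `ζ†` in terms of the path. -/
noncomputable def rate (n : ℕ) (A : ℝ → Matrix (Fin d) (Fin d) ℝ) (h L δ : ℝ) : ℝ :=
  L * (1 / √(n * h) + sparsity n A * h ^ 2) + √L * sparsity n A * δ

/-- The constant in the bound of the score by the rate. -/
noncomputable def scoreConst (B M G a : ℝ) : ℝ := B + 3 * G * B + 6 * G * B * (M * B + 1 + a + M)

theorem scoreConst_pos (P : RegPath n A K h L δ B M G a x xhat e) : 0 < scoreConst B M G a := by
  have h1 := P.one_le_B
  have h2 := P.G_nonneg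
  have h3 := P.M_nonneg
  have h4 := P.a_nonneg
  rw [scoreConst]
  positivity

theorem rate_nonneg (P : RegPath n A K h L δ B M G a x xhat e) : 0 ≤ rate n A h L δ := by
  have h1 := P.one_le_L
  have h3 := P.δ_nonneg
  rw [rate]
  positivity

/-- With the residual written as innovation plus error, the score splits into the noise bounded by
`score_le`, the innovations against the error of the lag, and the residual error against the
estimated lag. The lag contributes another √L, which turns the bias s h² √L into L s h² and the
error sδ into √L s δ. -/
theorem abs_score_le (P : RegPath n A K h L δ B M G a x xhat e) (i : Fin d) {r : ℕ}
    (hr : r ∈ Finset.Icc 1 n) (m : Fin d ⊕ Fin d) :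
    |wlsScore (Finset.Icc 2 n) (kwt n K h (rt n r)) (fun t => xhat t i) (lagReg n h (rt n r) xhat)
      (localParam n A h i (rt n r)) m| ≤ scoreConst B M G a * rate n A h L δ := by
  have hL := P.one_le_sqrtL
  have hBL := P.one_le_BL
  have hB := P.one_le_B
  have hG := P.G_nonneg
  have hM := P.M_nonneg
  have ha := P.a_nonneg
  have hδ := P.δ_nonneg
  have hs : (1 : ℝ) ≤ sparsity n A := by exact_mod_cast P.one_le_s
  have hLsq : √L * √L = L := Real.mul_self_sqrt (by linarith [P.one_le_L])
  set τ := rt n r with hτ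
  obtain ⟨k, j, hk, hy⟩ : ∃ (k : ℕ) (j : Fin d), k < 2 ∧ ∀ t,
      lagReg n h τ xhat t m = ((rt n t - τ) / h) ^ k * xhat (t - 1) j := by
    rcases m with j | j
    · exact ⟨0, j, by norm_num, fun t => by simp [lagReg]⟩
    · exact ⟨1, j, by norm_num, fun t => by simp [lagReg]⟩
  set R : ℕ → ℝ := fun t => xhat t i - localParam n A h i τ ⬝ᵥ lagReg n h τ xhat t - e t i with hR
  set c₁ := sparsity n A * (M * B * h ^ 2 * √L + (1 + a + M) * δ) with hc1
  have hc1n : 0 ≤ c₁ := by positivity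
  have hzk : ∀ t, |(rt n t - τ) / h| ≤ 1 → |((rt n t - τ) / h) ^ k| ≤ 1 := fun t ht => by
    rw [abs_pow]; exact pow_le_one₀ (abs_nonneg _) ht
  have hmem : ∀ t ∈ Finset.Icc 2 n, t - 1 ∈ Finset.Icc 1 n ∧ t ∈ Finset.Icc 1 n := fun t ht => by
    rw [Finset.mem_Icc] at *
    rw [Finset.mem_Icc]
    omega
  have e1 : wlsScore (Finset.Icc 2 n) (kwt n K h τ) (fun t => xhat t i) (lagReg n h τ xhat)
      (localParam n A h i τ) m
      = ∑ t ∈ Finset.Icc 2 n, kwt n K h τ t * ((rt n t - τ) / h) ^ k * x (t - 1) j * e t i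
        + ∑ t ∈ Finset.Icc 2 n, kwt n K h τ t *
            (((rt n t - τ) / h) ^ k * ((xhat (t - 1) j - x (t - 1) j) * e t i))
        + ∑ t ∈ Finset.Icc 2 n, kwt n K h τ t *
            (((rt n t - τ) / h) ^ k * (R t * xhat (t - 1) j)) := by
    rw [wlsScore, ← Finset.sum_add_distrib, ← Finset.sum_add_distrib]
    refine Finset.sum_congr rfl fun t _ => ?_
    rw [hy t, hR]
    ring
  have hb2 : |∑ t ∈ Finset.Icc 2 n, kwt n K h τ t *
      (((rt n t - τ) / h) ^ k * ((xhat (t - 1) j - x (t - 1) j) * e t i))|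
      ≤ 3 * G * (1 * (δ * (B * √L))) := by
    refine P.abs_sum_kwt_mul_le τ _ _ (by positivity) fun t ht hz => ?_
    rw [abs_mul, abs_mul]
    exact mul_le_mul (hzk t hz) (mul_le_mul (P.xhat_le _ (hmem t ht).1 j)
      (P.e_le t (hmem t ht).2 i) (abs_nonneg _) hδ) (by positivity) (by norm_num)
  have hb3 : |∑ t ∈ Finset.Icc 2 n, kwt n K h τ t *
      (((rt n t - τ) / h) ^ k * (R t * xhat (t - 1) j))|
      ≤ 3 * G * (1 * (c₁ * (2 * (B * √L)))) := by
    refine P.abs_sum_kwt_mul_le τ _ _ (by positivity) fun t ht hz => ?_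
    rw [abs_mul, abs_mul]
    exact mul_le_mul (hzk t hz) (mul_le_mul (P.abs_resid_sub_le i hr ht hz)
      (P.xhat_abs_le (hmem t ht).1 j) (abs_nonneg _) hc1n) (by positivity) (by norm_num)
  have hb1 := P.score_le i j r hr k hk
  rw [e1]
  refine ((abs_add_le _ _).trans (add_le_add (abs_add_le _ _) le_rfl)).trans ?_
  refine (add_le_add (add_le_add hb1 hb2) hb3).trans ?_
  -- collect the terms
  set q := L / √(n * h) with hq
  have hq0 : 0 ≤ q := by have := P.one_le_L; positivity
  set w := L * (sparsity n A * h ^ 2) with hw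
  have hw0 : 0 ≤ w := by have := P.one_le_L; positivity
  set z := √L * sparsity n A * δ with hz
  have hz0 : 0 ≤ z := by positivity
  have hrate : rate n A h L δ = q + w + z := by rw [rate, hq, hw, hz]; ring
  have hδz : δ * √L ≤ z := by rw [hz]; nlinarith [mul_nonneg hδ (by linarith : 0 ≤ √L)]
  have e3 : 3 * G * (1 * (c₁ * (2 * (B * √L)))) = 6 * G * B * (M * B * w + (1 + a + M) * z) := by
    rw [hc1, hw, hz]
    linear_combination (6 * G * B * M * B * sparsity n A * h ^ 2) * hLsq
  have e2 : 3 * G * (1 * (δ * (B * √L))) ≤ 3 * G * B * z := by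
    have : 3 * G * (1 * (δ * (B * √L))) = 3 * G * B * (δ * √L) := by ring
    rw [this]; gcongr
  rw [e3, hrate, scoreConst]
  have f1 : B * q ≤ B * (q + w + z) := by gcongr; linarith
  have f2 : 3 * G * B * z ≤ 3 * G * B * (q + w + z) := by gcongr; linarith
  have f3 : M * B * w + (1 + a + M) * z ≤ (M * B + 1 + a + M) * (q + w + z) := by
    have : 0 ≤ M * B := by positivity
    nlinarith [mul_nonneg this hz0, mul_nonneg this hq0, mul_nonneg hM hq0, mul_nonneg ha hq0,
      mul_nonneg hM hw0, mul_nonneg ha hw0]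
  have f4 : 6 * G * B * (M * B * w + (1 + a + M) * z)
      ≤ 6 * G * B * ((M * B + 1 + a + M) * (q + w + z)) := by gcongr
  linarith

theorem abs_lagReg_le (P : RegPath n A K h L δ B M G a x xhat e) {τ : ℝ} {t : ℕ}
    (ht : t ∈ Finset.Icc 2 n) (hz : |(rt n t - τ) / h| ≤ 1) (m : Fin d ⊕ Fin d) :
    |lagReg n h τ xhat t m| ≤ 2 * (B * √L) := by
  have ht2 : t - 1 ∈ Finset.Icc 1 n := by
    rw [Finset.mem_Icc] at ht ⊢; omega
  have h1 := fun j => P.xhat_abs_le ht2 j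
  rcases m with j | j
  · simpa [lagReg] using h1 j
  · simp only [lagReg, Sum.elim_inr, abs_mul]
    nlinarith [h1 j, abs_nonneg (xhat (t - 1) j), abs_nonneg ((rt n t - τ) / h)]

/-- Each regressor is at most 2B√L on the support of the kernel, whence 3G·4B²L. This L is the
logarithm in the condition on λ₂. -/
theorem abs_gram_le (P : RegPath n A K h L δ B M G a x xhat e) (τ : ℝ) (m m' : Fin d ⊕ Fin d) :
    |∑ t ∈ Finset.Icc 2 n, kwt n K h τ t * lagReg n h τ xhat t m * lagReg n h τ xhat t m'|
      ≤ 12 * G * B ^ 2 * L := by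
  have hBL := P.one_le_BL
  have h1 := P.abs_sum_kwt_mul_le τ (Finset.Icc 2 n)
    (fun t => lagReg n h τ xhat t m * lagReg n h τ xhat t m')
    (c := 2 * (B * √L) * (2 * (B * √L))) (by positivity) (fun t ht hz => by
      rw [abs_mul]
      exact mul_le_mul (P.abs_lagReg_le ht hz m) (P.abs_lagReg_le ht hz m') (abs_nonneg _)
        (by positivity))
  have hLsq : √L * √L = L := Real.mul_self_sqrt (by linarith [P.one_le_L])
  have e1 : 3 * G * (2 * (B * √L) * (2 * (B * √L))) = 12 * G * B ^ 2 * L := by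
    linear_combination (12 * G * B ^ 2) * hLsq
  rw [e1] at h1
  simpa only [mul_assoc] using h1

/-- The effect on the Gram form of replacing the estimated path by the true one. -/
noncomputable def gramErr (n : ℕ) (h L δ B G : ℝ) : ℝ :=
  9 * G * B * (√L * δ) + G * B ^ 2 * (L / (n * h))

/-- Carries eigenvalue bounds from Ψ to the Gram matrix of the estimated path. The term t = 1,
absent from the loss, has weight at most G/(nh); elsewhere a difference of squares factors into at
most δ‖u‖₁ times 3B√L‖u‖₁. -/
theorem wquad_ge (P : RegPath n A K h L δ B M G a x xhat e) (τ : ℝ) (u : Fin d ⊕ Fin d → ℝ) :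
    wquad (Finset.Icc 1 n) (kwt n K h τ) (lagReg n h τ x) u
        - (∑ m, |u m|) ^ 2 * gramErr n h L δ B G
      ≤ wquad (Finset.Icc 2 n) (kwt n K h τ) (lagReg n h τ xhat) u := by
  have hBL := P.one_le_BL
  have hB := P.one_le_B
  have hG := P.G_nonneg
  have hδ := P.δ_nonneg
  have hn : (0 : ℝ) < n := by exact_mod_cast P.one_le_n
  have hh := P.h_pos
  have hLsq : √L * √L = L := Real.mul_self_sqrt (by linarith [P.one_le_L])
  set U := ∑ m, |u m| with hU
  have hU0 : 0 ≤ U := Finset.sum_nonneg fun _ _ => abs_nonneg _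
  -- linear forms are bounded by the `ℓ¹`-norm
  have hlin : ∀ (y : ℕ → Fin d → ℝ) (t : ℕ) (c : ℝ), 0 ≤ c → |(rt n t - τ) / h| ≤ 1 →
      (∀ j, |y (t - 1) j| ≤ c) → |u ⬝ᵥ lagReg n h τ y t| ≤ c * U := by
    intro y t c hc hz hy
    refine abs_dotProduct_le u _ fun m => ?_
    rcases m with j | j
    · simpa [lagReg] using hy j
    · simp only [lagReg, Sum.elim_inr, abs_mul]
      nlinarith [hy j, abs_nonneg (y (t - 1) j), abs_nonneg ((rt n t - τ) / h)]
  have hsplit : wquad (Finset.Icc 1 n) (kwt n K h τ) (lagReg n h τ x) u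
      = kwt n K h τ 1 * (u ⬝ᵥ lagReg n h τ x 1) ^ 2
        + wquad (Finset.Icc 2 n) (kwt n K h τ) (lagReg n h τ x) u := by
    rw [wquad, wquad, ← Finset.sum_erase_add _ _ (Finset.mem_Icc.2 ⟨le_rfl, P.one_le_n⟩), add_comm,
      Finset.Icc_erase_left]
    rfl
  have hfirst : kwt n K h τ 1 * (u ⬝ᵥ lagReg n h τ x 1) ^ 2
      ≤ G / (n * h) * (B * √L * U) ^ 2 := by
    by_cases hz : |(rt n 1 - τ) / h| ≤ 1
    · have h1 := hlin x 1 (B * √L) (by positivity) hz (fun j => P.x_le _ (by omega) j)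
      have h2 : (u ⬝ᵥ lagReg n h τ x 1) ^ 2 ≤ (B * √L * U) ^ 2 := by
        rw [← sq_abs]
        exact pow_le_pow_left₀ (abs_nonneg _) h1 2
      exact mul_le_mul (P.kwt_le τ 1) h2 (sq_nonneg _) (by positivity)
    · rw [P.kwt_eq_zero hz, zero_mul]
      positivity
  have hdiff : wquad (Finset.Icc 2 n) (kwt n K h τ) (lagReg n h τ x) u
      - wquad (Finset.Icc 2 n) (kwt n K h τ) (lagReg n h τ xhat) u
      ≤ 3 * G * (δ * U * (3 * (B * √L) * U)) := by
    have e1 : wquad (Finset.Icc 2 n) (kwt n K h τ) (lagReg n h τ x) u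
        - wquad (Finset.Icc 2 n) (kwt n K h τ) (lagReg n h τ xhat) u
        = ∑ t ∈ Finset.Icc 2 n, kwt n K h τ t * ((u ⬝ᵥ lagReg n h τ x t) ^ 2
          - (u ⬝ᵥ lagReg n h τ xhat t) ^ 2) := by
      rw [wquad, wquad, ← Finset.sum_sub_distrib]
      exact Finset.sum_congr rfl fun t _ => by ring
    rw [e1]
    refine (le_abs_self _).trans (P.abs_sum_kwt_mul_le τ _ _ (by positivity) fun t ht hz => ?_)
    have ht2 : t - 1 ∈ Finset.Icc 1 n := by
      rw [Finset.mem_Icc] at ht ⊢; omega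
    have h1 := hlin x t (B * √L) (by positivity) hz (fun j => P.x_le _ (Finset.mem_Icc.1 ht2).2 j)
    have h2 := hlin xhat t (2 * (B * √L)) (by positivity) hz (fun j => P.xhat_abs_le ht2 j)
    have h3 := hlin (fun t j => xhat t j - x t j) t δ hδ hz (fun j => P.xhat_le _ ht2 j)
    have e2 : u ⬝ᵥ lagReg n h τ (fun t j => xhat t j - x t j) t
        = u ⬝ᵥ lagReg n h τ xhat t - u ⬝ᵥ lagReg n h τ x t := by
      rw [dotProduct_lagReg, dotProduct_lagReg, dotProduct_lagReg, ← Finset.sum_sub_distrib]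
      exact Finset.sum_congr rfl fun j _ => by ring
    rw [e2] at h3
    have e3 : (u ⬝ᵥ lagReg n h τ x t) ^ 2 - (u ⬝ᵥ lagReg n h τ xhat t) ^ 2
        = -((u ⬝ᵥ lagReg n h τ xhat t - u ⬝ᵥ lagReg n h τ x t) *
          (u ⬝ᵥ lagReg n h τ x t + u ⬝ᵥ lagReg n h τ xhat t)) := by ring
    rw [e3, abs_neg, abs_mul]
    refine mul_le_mul h3 ((abs_add_le _ _).trans ?_) (abs_nonneg _) (by positivity)
    linarith
  have e4 : U ^ 2 * gramErr n h L δ B G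
      = 3 * G * (δ * U * (3 * (B * √L) * U)) + G / (n * h) * (B * √L * U) ^ 2 := by
    rw [gramErr, mul_pow, mul_pow, pow_two (√L), hLsq]; ring
  rw [e4, hsplit]
  linarith

end RegPath


/-! ### Index sets of levels and slopes. -/

section Supports

variable {d n : ℕ} {A : ℝ → Matrix (Fin d) (Fin d) ℝ}

open scoped Classical in
/-- The coordinates `(u₁, u₂)` with `u₁` indexed by `S` and `u₂` by `S'`. -/
noncomputable def pairSupp (S S' : Set (Fin d)) : Finset (Fin d ⊕ Fin d) :=
  Finset.univ.filter fun m => Sum.elim (· ∈ S) (· ∈ S') m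

theorem inl_mem_pairSupp {S S' : Set (Fin d)} {j : Fin d} : .inl j ∈ pairSupp S S' ↔ j ∈ S := by
  simp [pairSupp]

theorem inr_mem_pairSupp {S S' : Set (Fin d)} {j : Fin d} : .inr j ∈ pairSupp S S' ↔ j ∈ S' := by
  simp [pairSupp]

open scoped Classical in
theorem sum_pairSupp (S S' : Set (Fin d)) (f : Fin d ⊕ Fin d → ℝ) :
    ∑ m ∈ pairSupp S S', f m
      = (∑ j, if j ∈ S then f (.inl j) else 0) + ∑ j, if j ∈ S' then f (.inr j) else 0 := by
  rw [pairSupp, Finset.sum_filter, Fintype.sum_sum_type]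
  simp only [Sum.elim_inl, Sum.elim_inr]
  congr 1

theorem card_pairSupp_le {S S' : Set (Fin d)} {i : Fin d} (hS : S ⊆ J n A i) (hS' : S' ⊆ J n A i) :
    ((pairSupp S S').card : ℝ) ≤ 2 * sparsity n A := by
  classical
  have h1 := sum_pairSupp S S' (fun _ => (1 : ℝ))
  have h2 : ∀ T : Set (Fin d), T ⊆ J n A i →
      (∑ j, if j ∈ T then (1 : ℝ) else 0) ≤ sparsity n A := fun T hT => by
    have := RegPath.sum_J_le (n := n) (A := A) (i := i) (f := fun j => if j ∈ T then (1 : ℝ) else 0)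
      zero_le_one (fun j hj => if_neg fun h => hj (hT h))
      (fun j _ => by split_ifs <;> simp)
    exact (le_abs_self _).trans (by simpa using this)
  rw [Finset.sum_const, nsmul_eq_mul, mul_one] at h1
  rw [h1]
  linarith [h2 S hS, h2 S' hS']

theorem wquad_smul {T ι : Type*} [Fintype ι] (I : Finset T) (k : T → ℝ) (y : T → ι → ℝ) (c : ℝ)
    (v : ι → ℝ) : wquad I k y (c • v) = c ^ 2 * wquad I k y v := by
  rw [wquad, wquad, Finset.mul_sum]
  refine Finset.sum_congr rfl fun t _ => ?_
  rw [smul_dotProduct, smul_eq_mul]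
  ring

theorem l2_smul {ι : Type*} [Fintype ι] (c : ℝ) (v : ι → ℝ) : l2 (c • v) = |c| * l2 v := by
  rw [l2_eq_norm, WithLp.toLp_smul, norm_smul, ← l2_eq_norm, Real.norm_eq_abs]

/-- Passing from unit vectors to all vectors. -/
theorem mul_sum_sq_le_wquad {T ι : Type*} [Fintype ι] (I : Finset T) (k : T → ℝ) (y : T → ι → ℝ)
    {κ : ℝ} (v : ι → ℝ)
    (h : v ≠ 0 → l2 ((l2 v)⁻¹ • v) = 1 → κ ≤ wquad I k y ((l2 v)⁻¹ • v)) :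
    κ * ∑ m, v m ^ 2 ≤ wquad I k y v := by
  by_cases hv : v = 0
  · subst hv
    simp [wquad]
  · have hl : 0 < l2 v := lt_of_le_of_ne (l2_nonneg v) fun h0 => hv (l2_eq_zero h0.symm)
    have h1 : l2 ((l2 v)⁻¹ • v) = 1 := by
      rw [l2_smul, abs_of_pos (inv_pos.2 hl), inv_mul_cancel₀ hl.ne']
    have h2 := h hv h1
    rw [wquad_smul, inv_pow, inv_mul_eq_div, le_div_iff₀ (by positivity), l2_sq] at h2
    exact h2

end Supports

/-! ### SCAD weights and deviations from the time average. -/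

section Scad

theorem scadDeriv_of_le {lam z : ℝ} (h : z ≤ lam) : scadDeriv lam z = lam := by
  rw [scadDeriv, if_pos h, mul_one]

theorem scadDeriv_of_ge {lam z : ℝ} (hlam : 0 < lam) (h : scadA * lam ≤ z) :
    scadDeriv lam z = 0 := by
  have h1 : ¬ z ≤ lam := by
    rw [scadA] at h
    intro hc
    linarith
  rw [scadDeriv, if_neg h1, max_eq_right (by linarith), zero_div, mul_zero]

theorem card_grid (n : ℕ) : Fintype.card (Grid n) = n := by
  rw [Fintype.card_coe]
  simp

/-- The mean is the constant that minimises the sum of squared deviations. -/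
theorem devNorm_le_l2_sub {n : ℕ} (hn : 1 ≤ n) (v : Grid n → ℝ) (c : ℝ) :
    devNorm v ≤ l2 (fun t => v t - c) := by
  have hn0 : (0 : ℝ) < n := by exact_mod_cast hn
  refine Real.sqrt_le_sqrt ?_
  set m := (1 / (n : ℝ)) * ∑ r, v r with hm
  have h1 : ∑ r, v r = n * m := by rw [hm]; field_simp
  have h2 : ∑ t, (v t - c) ^ 2 = ∑ t, (v t - m) ^ 2 + n * (m - c) ^ 2 := by
    have e : ∀ t, (v t - c) ^ 2 = (v t - m) ^ 2 + (2 * (m - c) * v t + (c ^ 2 - m ^ 2)) :=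
      fun t => by ring
    simp only [e]
    rw [Finset.sum_add_distrib, Finset.sum_add_distrib, ← Finset.mul_sum, h1, Finset.sum_const,
      Finset.card_univ, card_grid, nsmul_eq_mul]
    ring
  rw [h2]
  have : 0 ≤ (n : ℝ) * (m - c) ^ 2 := by positivity
  linarith

theorem devNorm_le_l2 {n : ℕ} (hn : 1 ≤ n) (v : Grid n → ℝ) : devNorm v ≤ l2 v := by
  simpa using devNorm_le_l2_sub hn v 0

/-- Centring is linear and does not increase the norm. -/
theorem devNorm_le_add {n : ℕ} (hn : 1 ≤ n) (u v : Grid n → ℝ) :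
    devNorm u ≤ devNorm v + l2 (fun t => u t - v t) := by
  have h1 : devNorm u ≤ devNorm v + devNorm (fun t => u t - v t) := by
    have := l2_add_le (fun t => v t - (1 / (n : ℝ)) * ∑ r, v r)
      (fun t => (u t - v t) - (1 / (n : ℝ)) * ∑ r, (u r - v r))
    refine le_trans (le_of_eq ?_) this
    rw [devNorm]
    congr 1
    ext t
    simp only [Pi.add_apply, Finset.sum_sub_distrib]
    ring
  exact h1.trans (add_le_add le_rfl (devNorm_le_l2 hn _))

theorem l2_le_add {ι : Type*} [Fintype ι] (u v : ι → ℝ) :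
    l2 u ≤ l2 v + l2 (fun t => u t - v t) := by
  have := l2_add_le v (fun t => u t - v t)
  have e : v + (fun t => u t - v t) = u := by ext t; simp
  rwa [e] at this

theorem l2_sub_comm {ι : Type*} [Fintype ι] (u v : ι → ℝ) :
    l2 (fun t => u t - v t) = l2 (fun t => v t - u t) := by
  rw [l2, l2]
  congr 1
  exact Finset.sum_congr rfl fun t _ => by ring

end Scad

/-! ### LASSO rate, oracle property and residuals on a good path. -/

namespace RegPath

variable {d n : ℕ} {A : ℝ → Matrix (Fin d) (Fin d) ℝ} {K : ℝ → ℝ} {h L δ B M G a : ℝ}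
  {x xhat e : ℕ → Fin d → ℝ}

theorem gramErr_nonneg (P : RegPath n A K h L δ B M G a x xhat e) : 0 ≤ gramErr n h L δ B G := by
  have h1 := P.one_le_B
  have h2 := P.G_nonneg
  have h3 := P.δ_nonneg
  have h4 := P.one_le_L
  have h5 := P.h_pos
  rw [gramErr]
  positivity

/-- Error bound for the time-varying LASSO. -/
theorem lasso_rate (P : RegPath n A K h L δ B M G a x xhat e) {κ lam : ℝ} (hκ : 0 < κ)
    (hlam : 0 < lam)
    (hRE : ∀ i, ∀ t : Grid n, ∀ u ∈ Cone (JLoc A i (rt n t)) (JLoc' A i (rt n t)),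
      κ ≤ u ⬝ᵥ (Psi n K h x (rt n t) *ᵥ u))
    (hgram : 18 * sparsity n A * gramErr n h L δ B G ≤ κ / 2)
    (hscore : scoreConst B M G a * rate n A h L δ ≤ lam / 6)
    {atil btil : Fin d → Grid n → Fin d → ℝ} (hl : IsLasso n K h lam xhat atil btil)
    (i : Fin d) (t : Grid n) :
    ∑ j, (atil i t j - A (rt n t) i j) ^ 2
      ≤ 2 * sparsity n A * (4 / 3 * lam) ^ 2 / (κ / 2) ^ 2 := by
  classical
  set τ := rt n t with hτ
  -- A derivative may be nonzero at τ_t although the coefficient vanishes at all grid points. Such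
  -- slopes are dropped from the target, so |S| ≤ 2s; the cone over S lies in the cone of the
  -- hypothesis, whose index set is larger.
  set S := pairSupp (JLoc A i τ) (JLoc' A i τ ∩ J n A i) with hS
  have hsub : JLoc A i τ ⊆ J n A i := fun j hj => mem_iUnion.2 ⟨t, hj⟩
  have hcard : (S.card : ℝ) ≤ 2 * sparsity n A := card_pairSupp_le hsub inter_subset_right
  set θ₀ := localParam n A h i τ with hθ₀
  set θ : Fin d ⊕ Fin d → ℝ := Sum.elim (atil i t) (fun j => h * btil i t j) with hθ
  have hsupp : ∀ m ∉ S, θ₀ m = 0 := by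
    rintro (j | j) hj
    · rw [hS, inl_mem_pairSupp] at hj
      simpa [hθ₀, localParam, JLoc] using hj
    · rw [hS, inr_mem_pairSupp] at hj
      simp only [hθ₀, localParam, Sum.elim_inr]
      split_ifs with hJ
      · have : dA A τ i j = 0 := by
          by_contra hc
          exact hj ⟨hc, hJ⟩
        rw [this, mul_zero]
      · rfl
  have hmin := hl i t (fun j => A τ i j) (fun j => if j ∈ J n A i then dA A τ i j else 0)
  rw [lassoObj, lassoObj, loss_eq_wls n K P.h_pos.ne', loss_eq_wls n K P.h_pos.ne'] at hmin
  have hθ₀' : θ₀ = Sum.elim (fun j => A τ i j)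
      (fun j => h * if j ∈ J n A i then dA A τ i j else 0) := by
    ext (j | j)
    · simp [hθ₀, localParam]
    · simp [hθ₀, localParam, mul_ite]
  have hnorm : ∀ u v : Fin d → ℝ, ∑ m, |Sum.elim u (fun j => h * v j) m|
      = ∑ j, |u j| + h * ∑ j, |v j| := fun u v => by
    rw [Fintype.sum_sum_type, Finset.mul_sum]
    simp only [Sum.elim_inl, Sum.elim_inr, abs_mul, abs_of_pos P.h_pos]
  rw [← hnorm, ← hnorm, ← hθ₀', ← hθ] at hmin
  have hRE' : ∀ v : Fin d ⊕ Fin d → ℝ, ∑ m, |v m| ≤ 3 * ∑ m ∈ S, |v m| →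
      κ / 2 * ∑ m, v m ^ 2 ≤ wquad (Finset.Icc 2 n) (kwt n K h τ) (lagReg n h τ xhat) v := by
    intro v hv
    have h1 : κ * ∑ m, v m ^ 2 ≤ wquad (Finset.Icc 1 n) (kwt n K h τ) (lagReg n h τ x) v := by
      refine mul_sum_sq_le_wquad _ _ _ v fun hv0 hu1 => ?_
      rw [← dotProduct_Psi]
      refine hRE i t _ ⟨hu1, ?_⟩
      have hl0 : 0 ≤ (l2 v)⁻¹ := inv_nonneg.2 (l2_nonneg v)
      simp only [Pi.smul_apply, smul_eq_mul, abs_mul, abs_of_nonneg hl0]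
      have e1 : ∑ j, ((l2 v)⁻¹ * |v (.inl j)| + (l2 v)⁻¹ * |v (.inr j)|)
          = (l2 v)⁻¹ * ∑ m, |v m| := by
        rw [Fintype.sum_sum_type, ← Finset.sum_add_distrib, Finset.mul_sum]
        exact Finset.sum_congr rfl fun j _ => by ring
      have e2 : ((∑ j, if j ∈ JLoc A i (rt n t) then (l2 v)⁻¹ * |v (.inl j)| else 0)
          + ∑ j, if j ∈ JLoc' A i (rt n t) then (l2 v)⁻¹ * |v (.inr j)| else 0)
          = (l2 v)⁻¹ * ∑ m ∈ pairSupp (JLoc A i τ) (JLoc' A i τ), |v m| := by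
        rw [sum_pairSupp, mul_add, Finset.mul_sum, Finset.mul_sum]
        simp only [mul_ite, mul_zero, hτ]
      rw [e1, e2]
      have h2 : ∑ m ∈ S, |v m| ≤ ∑ m ∈ pairSupp (JLoc A i τ) (JLoc' A i τ), |v m| := by
        refine Finset.sum_le_sum_of_subset_of_nonneg ?_ fun _ _ _ => abs_nonneg _
        rintro (j | j) hj
        · exact inl_mem_pairSupp.2 (inl_mem_pairSupp.1 hj)
        · exact inr_mem_pairSupp.2 (inr_mem_pairSupp.1 hj).1
      have h3 := mul_le_mul_of_nonneg_left (hv.trans (mul_le_mul_of_nonneg_left h2 (by norm_num)))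
        hl0
      linarith
    have h2 := P.wquad_ge τ v
    -- The factor 18 is 3² from the cone times 2 from |S| ≤ 2s.
    have h3 : (∑ m, |v m|) ^ 2 ≤ 18 * sparsity n A * ∑ m, v m ^ 2 := by
      have h4 : 0 ≤ ∑ m, v m ^ 2 := Finset.sum_nonneg fun _ _ => sq_nonneg _
      calc (∑ m, |v m|) ^ 2 ≤ (3 * ∑ m ∈ S, |v m|) ^ 2 :=
            pow_le_pow_left₀ (Finset.sum_nonneg fun _ _ => abs_nonneg _) hv 2
        _ = 9 * (∑ m ∈ S, |v m|) ^ 2 := by ring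
        _ ≤ 9 * (S.card * ∑ m, v m ^ 2) := by gcongr; exact sq_sum_abs_le_card S v
        _ ≤ 9 * (2 * sparsity n A * ∑ m, v m ^ 2) := by gcongr
        _ = _ := by ring
    have h5 := mul_le_mul_of_nonneg_right h3 P.gramErr_nonneg
    have h6 : 0 ≤ ∑ m, v m ^ 2 := Finset.sum_nonneg fun _ _ => sq_nonneg _
    have h7 := mul_le_mul_of_nonneg_right hgram h6
    nlinarith
  have hmain := lasso_error (Finset.Icc 2 n) (kwt n K h τ) (fun t => xhat t i) (lagReg n h τ xhat)
    (half_pos hκ) hlam S θ₀ θ hsupp (fun m => (P.abs_score_le i t.2 m).trans hscore) hmin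
    (fun t _ => P.kwt_nonneg τ t) hRE'
  calc ∑ j, (atil i t j - A τ i j) ^ 2 ≤ ∑ m, (θ m - θ₀ m) ^ 2 := by
        rw [Fintype.sum_sum_type]
        have : 0 ≤ ∑ j, (θ (.inr j) - θ₀ (.inr j)) ^ 2 := Finset.sum_nonneg fun _ _ => sq_nonneg _
        simp only [hθ, hθ₀, localParam, Sum.elim_inl] at this ⊢
        linarith
    _ ≤ S.card * (4 / 3 * lam) ^ 2 / (κ / 2) ^ 2 := hmain
    _ ≤ _ := by gcongr

/-- A coefficient with vanishing derivative on the grid is nearly constant on it. -/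
theorem abs_A_sub_le (P : RegPath n A K h L δ B M G a x xhat e) {i j : Fin d}
    (hj : j ∉ J' n A i) {t : ℕ} (ht : t ∈ Finset.Icc 1 n) :
    |A (rt n t) i j - A (rt n 1) i j| ≤ M / n := by
  have hn : (0 : ℝ) < n := by exact_mod_cast P.one_le_n
  have hM := P.M_nonneg
  -- The derivative vanishes at the grid points only, so a step of length 1/n may still add up to
  -- M/n²; at most n steps give M/n.
  have key : ∀ k : ℕ, k + 1 ≤ n → |A (rt n (k + 1)) i j - A (rt n 1) i j| ≤ k * (M / n ^ 2) := by
    intro k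
    induction k with
    | zero => intro _; simp
    | succ k ih =>
      intro hk
      have h1 := ih (by omega)
      have hmem : k + 1 ∈ Finset.Icc 1 n := Finset.mem_Icc.2 ⟨by omega, by omega⟩
      have h2 := abs_taylor_le (P.smooth i j) (P.bound i j)
        (P.rt_mem (Finset.mem_Icc.2 ⟨by omega, hk⟩ : k + 1 + 1 ∈ Finset.Icc 1 n)) (P.rt_mem hmem)
      have h3 : derivWithin (fun u => A u i j) (Icc 0 1) (rt n (k + 1)) = 0 := by
        by_contra hc
        exact hj (mem_iUnion.2 ⟨⟨k + 1, hmem⟩, hc⟩)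
      have h4 : rt n (k + 1 + 1) - rt n (k + 1) = 1 / n := by
        rw [rt, rt]; push_cast; ring
      rw [h3, h4, zero_mul, sub_zero] at h2
      have h5 : M * (1 / (n : ℝ)) ^ 2 = M / n ^ 2 := by ring
      rw [h5] at h2
      have h6 := abs_sub_le (A (rt n (k + 1 + 1)) i j) (A (rt n (k + 1)) i j) (A (rt n 1) i j)
      push_cast
      linarith
  obtain ⟨h1, h2⟩ := Finset.mem_Icc.1 ht
  have h3 := key (t - 1) (by omega)
  rw [Nat.sub_add_cancel h1] at h3
  refine h3.trans ?_
  have h4 : ((t - 1 : ℕ) : ℝ) ≤ n := by exact_mod_cast (by omega : t - 1 ≤ n)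
  calc ((t - 1 : ℕ) : ℝ) * (M / n ^ 2) ≤ n * (M / n ^ 2) := by gcongr
    _ = M / n := by field_simp

open scoped Classical in
/-- The group LASSO with SCAD weights: with probability tending to one its penalty acts on the
complement of the true supports only. -/
theorem groupObj_eq (P : RegPath n A K h L δ B M G a x xhat e) {lam r : ℝ} (hlam : 0 < lam)
    {pre : Grid n → Fin d → ℝ} {i : Fin d} (hr : 0 ≤ r)
    (hpre : ∀ t : Grid n, ∑ j, (pre t j - A (rt n t) i j) ^ 2 ≤ r ^ 2) (hrn : √n * r ≤ lam / 2)
    (hMn : M ≤ √n * (lam / 2))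
    (hsig : (∀ j ∈ J n A i, (scadA + 1) * lam ≤ l2 fun t : Grid n => A (rt n t) i j) ∧
      ∀ j ∈ J' n A i, (scadA + 1) * lam ≤ devNorm fun t : Grid n => A (rt n t) i j)
    (p : (Grid n → Fin d → ℝ) × (Grid n → Fin d → ℝ)) :
    groupObj n K h lam xhat pre i p = groupLS (Finset.Icc 2 n) (fun t : Grid n => kwt n K h (rt n t))
      (fun _ t => xhat t i) (fun t : Grid n => lagReg n h (rt n t) xhat) lam
      (pairSupp (J n A i) (J' n A i)) (fun t => Sum.elim (p.1 t) (fun j => h * p.2 t j)) := by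
  have hn := P.one_le_n
  have hn0 : (0 : ℝ) < n := by exact_mod_cast hn
  have hdist : ∀ j, l2 (fun t : Grid n => pre t j - A (rt n t) i j) ≤ lam / 2 := fun j => by
    refine (l2_le_of_abs_le hr fun t => ?_).trans (by rwa [card_grid])
    refine abs_le_of_sq_le_sq (le_trans ?_ (hpre t)) hr
    exact Finset.single_le_sum (f := fun j => (pre t j - A (rt n t) i j) ^ 2)
      (fun _ _ => sq_nonneg _) (Finset.mem_univ j)
  -- On the support the preliminary norm is at least (a₀ + 1)λ − λ/2 ≥ a₀λ, where the SCAD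
  -- derivative is zero; off it the norm is at most λ/2, where the derivative is λ.
  have hw : ∀ j, scadDeriv lam (l2 fun t => pre t j) = if j ∈ J n A i then 0 else lam := by
    intro j
    split_ifs with hj
    · refine scadDeriv_of_ge hlam ?_
      have h1 := l2_le_add (fun t : Grid n => A (rt n t) i j) (fun t => pre t j)
      rw [l2_sub_comm] at h1
      linarith [hsig.1 j hj, hdist j]
    · refine scadDeriv_of_le ?_
      have h1 := hdist j
      have e1 : (fun t : Grid n => pre t j - A (rt n t) i j) = fun t => pre t j := by
        ext t; rw [A_eq_zero hj t.2, sub_zero]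
      rw [e1] at h1
      linarith
  have hv : ∀ j, scadDeriv lam (devNorm fun t => pre t j) = if j ∈ J' n A i then 0 else lam := by
    intro j
    split_ifs with hj
    · refine scadDeriv_of_ge hlam ?_
      have h1 := devNorm_le_add hn (fun t : Grid n => A (rt n t) i j) (fun t => pre t j)
      rw [l2_sub_comm] at h1
      linarith [hsig.2 j hj, hdist j]
    -- Off J'_i the true path need not be constant, only within M/n of its first value: λ/2 is spent
    -- on this and λ/2 on the preliminary error.
    · refine scadDeriv_of_le ?_
      have h1 := devNorm_le_add hn (fun t => pre t j) (fun t : Grid n => A (rt n t) i j)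
      have h2 := devNorm_le_l2_sub hn (fun t : Grid n => A (rt n t) i j) (A (rt n 1) i j)
      have h3 := l2_le_of_abs_le (v := fun t : Grid n => A (rt n t) i j - A (rt n 1) i j)
        (c := M / n) (by have := P.M_nonneg; positivity) (fun t => P.abs_A_sub_le hj t.2)
      have h4 : √(Fintype.card (Grid n)) * (M / n) ≤ lam / 2 := by
        rw [card_grid]
        calc √n * (M / n) ≤ √n * (√n * (lam / 2) / n) := by gcongr
          _ = (√n * √n) * (lam / 2) / n := by ring
          _ = lam / 2 := by rw [Real.mul_self_sqrt hn0.le]; field_simp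
      linarith [hdist j]
  rw [groupObj, groupLS, Fintype.sum_sum_type, add_assoc]
  congr 1
  · exact Finset.sum_congr rfl fun t _ => loss_eq_wls n K P.h_pos.ne' _ _ _ _ _
  · congr 1
    · refine Finset.sum_congr rfl fun j _ => ?_
      rw [hw]
      by_cases hj : j ∈ J n A i <;> simp [inl_mem_pairSupp, hj]
    · refine Finset.sum_congr rfl fun j _ => ?_
      rw [hv]
      by_cases hj : j ∈ J' n A i <;> simp [inr_mem_pairSupp, hj]

/-- The oracle property of the weighted group LASSO. -/
theorem oracle (P : RegPath n A K h L δ B M G a x xhat e) {κ lam r : ℝ} (hκ : 0 < κ)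
    (hlam : 0 < lam)
    (hSE : ∀ i, ∀ t : Grid n, ∀ u ∈ SuppSphere (J n A i) (J' n A i),
      κ ≤ u ⬝ᵥ (Psi n K h x (rt n t) *ᵥ u))
    (hgram : 18 * sparsity n A * gramErr n h L δ B G ≤ κ / 2)
    {pre : Fin d → Grid n → Fin d → ℝ} (hr : 0 ≤ r)
    (hpre : ∀ i, ∀ t : Grid n, ∑ j, (pre i t j - A (rt n t) i j) ^ 2 ≤ r ^ 2)
    (hrn : √n * r ≤ lam / 2) (hMn : M ≤ √n * (lam / 2))
    (hsig : ∀ i, (∀ j ∈ J n A i, (scadA + 1) * lam ≤ l2 fun t : Grid n => A (rt n t) i j) ∧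
      ∀ j ∈ J' n A i, (scadA + 1) * lam ≤ devNorm fun t : Grid n => A (rt n t) i j)
    {γ : ℝ} (hγ : γ = scoreConst B M G a * rate n A h L δ)
    (hlam' : 2 * (√n * (γ + 12 * G * B ^ 2 * L * (2 * sparsity n A * γ / (κ / 2)))) < lam)
    (i : Fin d) :
    ∃ p : (Grid n → Fin d → ℝ) × (Grid n → Fin d → ℝ),
      (∀ p', IsMinimiser (groupObj n K h lam xhat (pre i) i) univ p' ↔ p' = p) ∧
      (∀ p', IsMinimiser (groupObj n K h lam xhat (pre i) i) (oracleClass n A i) p' ↔ p' = p) ∧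
      (∀ t : Grid n, ∑ j, (p.1 t j - A (rt n t) i j) ^ 2
        ≤ 2 * sparsity n A * γ ^ 2 / (κ / 2) ^ 2) ∧
      ∀ t : Grid n, ∑ j, |p.1 t j - A (rt n t) i j| ≤ 2 * sparsity n A * γ / (κ / 2) := by
  classical
  have hG := P.G_nonneg
  have hL := P.one_le_L
  have hγ0 : 0 ≤ γ := by rw [hγ]; exact mul_nonneg P.scoreConst_pos.le P.rate_nonneg
  -- Outside J_i the path is zero and has no variation, so the signal condition on slopes forces
  -- this inclusion; the joint support then has at most 2s elements.
  have hJ : J' n A i ⊆ J n A i := by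
    intro j hj
    by_contra hc
    have h1 := (hsig i).2 j hj
    have h2 := devNorm_le_l2 P.one_le_n (fun t : Grid n => A (rt n t) i j)
    have e1 : (fun t : Grid n => A (rt n t) i j) = fun _ => 0 := by
      ext t; rw [A_eq_zero hc t.2]
    rw [e1] at h1 h2
    have e2 : l2 (fun _ : Grid n => (0 : ℝ)) = 0 := by simp [l2]
    rw [scadA] at h1
    linarith
  set S := pairSupp (J n A i) (J' n A i) with hS
  have hcard : (S.card : ℝ) ≤ 2 * sparsity n A := card_pairSupp_le subset_rfl hJ
  have hRE : ∀ t : Grid n, ∀ v : Fin d ⊕ Fin d → ℝ, (∀ m ∉ S, v m = 0) →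
      κ / 2 * ∑ m, v m ^ 2
        ≤ wquad (Finset.Icc 2 n) (kwt n K h (rt n t)) (lagReg n h (rt n t) xhat) v := by
    intro t v hv
    have h1 : κ * ∑ m, v m ^ 2
        ≤ wquad (Finset.Icc 1 n) (kwt n K h (rt n t)) (lagReg n h (rt n t) x) v := by
      refine mul_sum_sq_le_wquad _ _ _ v fun hv0 hu1 => ?_
      rw [← dotProduct_Psi]
      refine hSE i t _ ⟨hu1, fun j hj => ?_, fun j hj => ?_⟩
      · simp [hv (.inl j) (by rwa [hS, inl_mem_pairSupp])]
      · simp [hv (.inr j) (by rwa [hS, inr_mem_pairSupp])]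
    have h2 := P.wquad_ge (rt n t) v
    have h6 : 0 ≤ ∑ m, v m ^ 2 := Finset.sum_nonneg fun _ _ => sq_nonneg _
    have h3 : (∑ m, |v m|) ^ 2 ≤ 18 * sparsity n A * ∑ m, v m ^ 2 := by
      have e1 : ∑ m, |v m| = ∑ m ∈ S, |v m| :=
        (Finset.sum_subset (Finset.subset_univ S) fun m _ hm => by rw [hv m hm, abs_zero]).symm
      rw [e1]
      calc (∑ m ∈ S, |v m|) ^ 2 ≤ S.card * ∑ m, v m ^ 2 := sq_sum_abs_le_card S v
        _ ≤ 2 * sparsity n A * ∑ m, v m ^ 2 := by gcongr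
        _ ≤ 18 * sparsity n A * ∑ m, v m ^ 2 := by gcongr; norm_num
    have h5 := mul_le_mul_of_nonneg_right h3 P.gramErr_nonneg
    have h7 := mul_le_mul_of_nonneg_right hgram h6
    nlinarith
  have hθ₀ : ∀ t : Grid n, ∀ m ∉ S, localParam n A h i (rt n t) m = 0 := by
    rintro t (j | j) hj
    · rw [hS, inl_mem_pairSupp] at hj
      simp only [localParam, Sum.elim_inl]
      exact A_eq_zero hj t.2
    · rw [hS, inr_mem_pairSupp] at hj
      simp only [localParam, Sum.elim_inr]
      have : dA A (rt n t) i j = 0 := by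
        by_contra hc
        exact hj (mem_iUnion.2 ⟨t, hc⟩)
      rw [this, mul_zero, ite_self]
  have hbd : 2 * (√(Fintype.card (Grid n)) *
      (γ + 12 * G * B ^ 2 * L * (S.card * γ / (κ / 2)))) < lam := by
    refine lt_of_le_of_lt ?_ hlam'
    rw [card_grid]
    gcongr
  obtain ⟨θ, h1, h2, h3, h4⟩ := groupLS_oracle (Finset.Icc 2 n)
    (fun t : Grid n => kwt n K h (rt n t)) (fun _ t => xhat t i)
    (fun t : Grid n => lagReg n h (rt n t) xhat) (half_pos hκ) hγ0 S
    (fun t : Grid n => localParam n A h i (rt n t)) hθ₀ (fun t s _ => P.kwt_nonneg _ s) hRE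
    (fun t m => by rw [hγ]; exact P.abs_score_le i t.2 m) (fun t m m' => P.abs_gram_le _ m m')
    (by positivity) hbd
  have hobj := P.groupObj_eq hlam hr (hpre i) hrn hMn (hsig i)
  set Q := groupLS (Finset.Icc 2 n) (fun t : Grid n => kwt n K h (rt n t)) (fun _ t => xhat t i)
    (fun t : Grid n => lagReg n h (rt n t) xhat) lam S with hQ
  -- The change of variables (α, β) ↦ (α, hβ) is a bijection that transports minimisers and the
  -- oracle class.
  set φ : (Grid n → Fin d → ℝ) × (Grid n → Fin d → ℝ) → (Grid n → Fin d ⊕ Fin d → ℝ) :=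
    fun p t => Sum.elim (p.1 t) (fun j => h * p.2 t j) with hφ
  set ψ : (Grid n → Fin d ⊕ Fin d → ℝ) → (Grid n → Fin d → ℝ) × (Grid n → Fin d → ℝ) :=
    fun θ => (fun t j => θ t (.inl j), fun t j => h⁻¹ * θ t (.inr j)) with hψ
  have hh0 := P.h_pos.ne'
  have hφψ : ∀ θ, φ (ψ θ) = θ := fun θ => by
    ext t (j | j)
    · simp [hφ, hψ]
    · simp [hφ, hψ, hh0]
  have hψφ : ∀ p, ψ (φ p) = p := fun p => by
    refine Prod.ext ?_ ?_
    · ext t j; simp [hφ, hψ]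
    · ext t j; simp [hφ, hψ, hh0]
  have hobj' : ∀ p, groupObj n K h lam xhat (pre i) i p = Q (φ p) := hobj
  have hiff : ∀ p, φ p = θ ↔ p = ψ θ := fun p =>
    ⟨fun h => by rw [← h, hψφ], fun h => by rw [h, hφψ]⟩
  have hcls : ∀ p, p ∈ oracleClass n A i ↔ φ p ∈ {p | ∀ t, ∀ m ∉ S, p t m = 0} := fun p => by
    constructor
    · rintro ⟨ha, hb⟩ t (j | j) hj
      · exact ha t j (by rwa [hS, inl_mem_pairSupp] at hj)
      · simp [hφ, hb t j (by rwa [hS, inr_mem_pairSupp] at hj)]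
    · intro hp
      refine ⟨fun t j hj => ?_, fun t j hj => ?_⟩
      · simpa [hφ] using hp t (.inl j) (by rwa [hS, inl_mem_pairSupp])
      · simpa [hφ, hh0] using hp t (.inr j) (by rwa [hS, inr_mem_pairSupp])
  refine ⟨ψ θ, fun p => ?_, fun p => ?_, fun t => ?_, fun t => ?_⟩
  · rw [← hiff, ← h1]
    simp only [IsMinimiser, hobj', mem_univ, true_and, true_imp_iff]
    exact ⟨fun hm q => by simpa [hφψ] using hm (ψ q), fun hm q => hm (φ q)⟩
  · rw [← hiff, ← h2]
    simp only [IsMinimiser, hobj']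
    rw [hcls]
    refine and_congr_right fun _ => ⟨fun hm q hq => ?_, fun hm q hq => hm (φ q) ((hcls q).1 hq)⟩
    have := hm (ψ q) ((hcls _).2 (by rwa [hφψ]))
    rwa [hφψ] at this
  · refine le_trans ?_ ((h3 t).trans ?_)
    · rw [Fintype.sum_sum_type]
      have : 0 ≤ ∑ j, (θ t (.inr j) - localParam n A h i (rt n t) (.inr j)) ^ 2 :=
        Finset.sum_nonneg fun _ _ => sq_nonneg _
      simp only [localParam, Sum.elim_inl] at this ⊢
      linarith
    · gcongr
  · refine le_trans ?_ ((h4 t).trans ?_)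
    · rw [Fintype.sum_sum_type]
      have : 0 ≤ ∑ j, |θ t (.inr j) - localParam n A h i (rt n t) (.inr j)| :=
        Finset.sum_nonneg fun _ _ => abs_nonneg _
      simp only [localParam, Sum.elim_inl] at this ⊢
      linarith
    · gcongr

/-- The VAR residuals approximate the innovations. -/
theorem abs_resid_sub_innov_le (P : RegPath n A K h L δ B M G a x xhat e) {c : ℝ}
    {ahat : Fin d → Grid n → Fin d → ℝ}
    (hahat : ∀ i t, ∑ j, |ahat i t j - A (rt n t) i j| ≤ c * (sparsity n A * rate n A h L δ))
    (t : Grid n) (ht : 2 ≤ t.1) (i : Fin d) :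
    |resid n xhat ahat t i - e t i|
      ≤ (1 + a + 2 * B * c) * (sparsity n A * rate n A h L δ * √L) := by
  have hs : (1 : ℝ) ≤ sparsity n A := by exact_mod_cast P.one_le_s
  have hL := P.one_le_sqrtL
  have hL1 := P.one_le_L
  have hB := P.one_le_B
  have hδ := P.δ_nonneg
  have ha := P.a_nonneg
  have hrate := P.rate_nonneg
  have ht1 : t.1 - 1 ∈ Finset.Icc 1 n := by
    have := Finset.mem_Icc.1 t.2
    rw [Finset.mem_Icc]; omega
  have e1 : resid n xhat ahat t i - e t i = (xhat t i - x t i)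
      - ∑ j, A (rt n t) i j * (xhat (t.1 - 1) j - x (t.1 - 1) j)
      - ∑ j, (ahat i t j - A (rt n t) i j) * xhat (t.1 - 1) j := by
    have h1 := P.recursion t t.2 i
    have h2 : ∑ j, ahat i t j * xhat (t.1 - 1) j
        = ∑ j, A (rt n t) i j * (xhat (t.1 - 1) j - x (t.1 - 1) j)
          + ∑ j, (ahat i t j - A (rt n t) i j) * xhat (t.1 - 1) j
          + ∑ j, A (rt n t) i j * x (t.1 - 1) j := by
      rw [← Finset.sum_add_distrib, ← Finset.sum_add_distrib]
      exact Finset.sum_congr rfl fun j _ => by ring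
    rw [resid]
    linarith
  have h2 : |∑ j, A (rt n t) i j * (xhat (t.1 - 1) j - x (t.1 - 1) j)|
      ≤ sparsity n A * (a * δ) := by
    refine sum_J_le (i := i) (by positivity) (fun j hj => by rw [A_eq_zero hj t.2, zero_mul])
      (fun j _ => ?_)
    rw [abs_mul]
    exact mul_le_mul (P.A_le t t.2 i j) (P.xhat_le _ ht1 j) (abs_nonneg _) ha
  have h3 : |∑ j, (ahat i t j - A (rt n t) i j) * xhat (t.1 - 1) j|
      ≤ 2 * (B * √L) * (c * (sparsity n A * rate n A h L δ)) := by
    refine (abs_dotProduct_le (fun j => ahat i t j - A (rt n t) i j) (fun j => xhat (t.1 - 1) j)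
      (fun j => P.xhat_abs_le ht1 j)).trans ?_
    gcongr
    exact hahat i t
  -- Since s and √L are at least 1, the bare path error sδ is dominated by ν† and merges with the
  -- contribution of the ℓ¹-error.
  have h4 : sparsity n A * δ ≤ sparsity n A * rate n A h L δ * √L := by
    have h5 : √L * (sparsity n A * δ) ≤ rate n A h L δ := by
      rw [rate]
      have : 0 ≤ L * (1 / √(n * h) + sparsity n A * h ^ 2) := by positivity
      linarith
    have h6 : sparsity n A * δ ≤ √L * (sparsity n A * δ) := by
      have : 0 ≤ sparsity n A * δ := by positivity
      nlinarith
    have h7 : rate n A h L δ ≤ sparsity n A * rate n A h L δ := by nlinarith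
    have h8 : sparsity n A * rate n A h L δ ≤ sparsity n A * rate n A h L δ * √L := by
      have : 0 ≤ sparsity n A * rate n A h L δ := by positivity
      nlinarith
    linarith
  have h1 : |xhat t i - x t i| ≤ sparsity n A * δ := (P.xhat_le t t.2 i).trans (by nlinarith)
  rw [e1]
  refine ((abs_sub _ _).trans (add_le_add (abs_sub _ _) le_rfl)).trans ?_
  refine (add_le_add (add_le_add h1 h2) h3).trans ?_
  have h9 := mul_le_mul_of_nonneg_left h4 ha
  linarith

end RegPath


/-! ### CLIME: entrywise, operator-norm and Frobenius errors. -/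

section Clime

variable {d : ℕ}

theorem symmetrise_symm (W : Matrix (Fin d) (Fin d) ℝ) (i j : Fin d) :
    symmetrise W i j = symmetrise W j i := by
  simp only [symmetrise, Matrix.of_apply]
  rcases lt_trichotomy i j with h | h | h
  · rw [if_pos h.le, if_neg (not_le.2 h)]
  · rw [h]
  · rw [if_neg (not_le.2 h), if_pos h.le]

theorem symmetrise_eq_or (W : Matrix (Fin d) (Fin d) ℝ) (i j : Fin d) :
    symmetrise W i j = W i j ∨ symmetrise W i j = W j i := by
  simp only [symmetrise, Matrix.of_apply]
  split_ifs <;> simp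

theorem abs_symmetrise_le (W : Matrix (Fin d) (Fin d) ℝ) (i j : Fin d) :
    |symmetrise W i j| ≤ |W i j| := by
  simp only [symmetrise, Matrix.of_apply]
  split_ifs with h1 h2 h3
  · exact le_rfl
  · exact (not_le.1 h2).le
  · exact h3
  · exact le_rfl

theorem abs_mul_apply_le (S W : Matrix (Fin d) (Fin d) ℝ) {η C : ℝ} (hη : 0 ≤ η) (i j : Fin d)
    (hS : ∀ k, |S i k| ≤ η) (hW : ∑ k, |W k j| ≤ C) : |(S * W) i j| ≤ η * C := by
  rw [Matrix.mul_apply]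
  calc |∑ k, S i k * W k j| ≤ ∑ k, |S i k * W k j| := Finset.abs_sum_le_sum_abs _ _
    _ ≤ ∑ k, η * |W k j| := by
        refine Finset.sum_le_sum fun k _ => ?_
        rw [abs_mul]
        exact mul_le_mul_of_nonneg_right (hS k) (abs_nonneg _)
    _ = η * ∑ k, |W k j| := by rw [Finset.mul_sum]
    _ ≤ _ := mul_le_mul_of_nonneg_left hW hη

/-- Columns of a CLIME solution have minimal `ℓ¹`-norm. -/
theorem clime_column_le {S W Om : Matrix (Fin d) (Fin d) ℝ} {lam : ℝ}
    (hW : IsMinimiser (fun W => ∑ i, ∑ j, |W i j|) (climeFeasible S lam) W)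
    (hOm : Om ∈ climeFeasible S lam) (j : Fin d) : ∑ i, |W i j| ≤ ∑ i, |Om i j| := by
  classical
  -- Constraint and objective decouple over columns, so exchanging one column of the solution for
  -- that of a feasible matrix keeps feasibility.
  set V : Matrix (Fin d) (Fin d) ℝ := Matrix.of fun i k => if k = j then Om i j else W i k with hV
  have hfeas : V ∈ climeFeasible S lam := by
    intro i k
    by_cases hk : k = j
    · subst hk
      have := hOm i k
      have e : (S * V - 1) i k = (S * Om - 1) i k := by
        simp [Matrix.mul_apply, hV]
      rw [e]; exact this
    · have := hW.1 i k
      have e : (S * V - 1) i k = (S * W - 1) i k := by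
        simp [Matrix.mul_apply, hV, hk]
      rw [e]; exact this
  have h1 := hW.2 V hfeas
  simp only at h1
  rw [Finset.sum_comm, Finset.sum_comm (f := fun i k => |V i k|)] at h1
  rw [← Finset.add_sum_erase _ _ (Finset.mem_univ j),
    ← Finset.add_sum_erase (a := j) _ (fun k => ∑ i, |V i k|) (Finset.mem_univ j)] at h1
  have e1 : ∑ k ∈ Finset.univ.erase j, ∑ i, |V i k| = ∑ k ∈ Finset.univ.erase j, ∑ i, |W i k| :=
    Finset.sum_congr rfl fun k hk => by simp [hV, Finset.ne_of_mem_erase hk]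
  have e2 : ∑ i, |V i j| = ∑ i, |Om i j| := by simp [hV]
  rw [e1, e2] at h1
  linarith

/-- Entrywise error and `ℓ¹`-norms of the symmetrised CLIME estimate. -/
theorem clime_entry {S Sg W : Matrix (Fin d) (Fin d) ℝ} {lam η C₂ : ℝ} (hSg : Sg.PosDef)
    (hη : 0 ≤ η) (hcol : ∀ j, ∑ i, |Sg⁻¹ i j| ≤ C₂) (hS : ∀ i j, |(S - Sg) i j| ≤ η)
    (hlam : η * C₂ ≤ lam) (hW : IsClime S lam W) :
    (∀ i j, |(symmetrise W - Sg⁻¹) i j| ≤ 2 * C₂ * lam) ∧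
      ∀ i, ∑ j, |symmetrise W i j| ≤ ∑ j, |Sg⁻¹ i j| := by
  have hdet : IsUnit Sg.det := hSg.det_pos.ne'.isUnit
  have hsymm : ∀ i j, Sg⁻¹ i j = Sg⁻¹ j i := fun i j => by
    have h1 := hSg.inv.isHermitian
    have := h1.apply j i
    simpa using this
  -- The excess S Σ⁻¹ − 1 = (S − Σ) Σ⁻¹ is at most ηC₂ ≤ λ entrywise, so the target is a competitor
  -- and controls the columns of W.
  have hfeas : Sg⁻¹ ∈ climeFeasible S lam := fun i j => by
    have e : S * Sg⁻¹ - 1 = (S - Sg) * Sg⁻¹ := by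
      rw [sub_mul, Matrix.mul_nonsing_inv _ hdet]
    rw [e]
    exact (abs_mul_apply_le _ _ hη i j (fun k => hS i k) (hcol j)).trans hlam
  have hmin := hW ⟨_, hfeas⟩
  have hcolW := clime_column_le hmin hfeas
  have hentry : ∀ i j, |(W - Sg⁻¹) i j| ≤ 2 * C₂ * lam := fun i j => by
    have hC2 : 0 ≤ C₂ := (Finset.sum_nonneg fun _ _ => abs_nonneg _).trans (hcol i)
    have hlam0 : 0 ≤ lam := (mul_nonneg hη hC2).trans hlam
    -- Both parts of the bracket are at most λ: the first because the columns of W have ℓ¹-norm at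
    -- most C₂, the second by feasibility. Symmetry of Σ⁻¹ turns the column bound into the row bound
    -- that the product needs.
    have e : W - Sg⁻¹ = Sg⁻¹ * ((Sg - S) * W + (S * W - 1)) := by
      have : (Sg - S) * W + (S * W - 1) = Sg * W - 1 := by rw [sub_mul]; abel
      rw [this, mul_sub, mul_one, ← Matrix.mul_assoc, Matrix.nonsing_inv_mul _ hdet, one_mul]
    have h1 : ∀ k, |((Sg - S) * W + (S * W - 1)) k j| ≤ 2 * lam := fun k => by
      rw [Matrix.add_apply]
      have h2 := abs_mul_apply_le (Sg - S) W hη k j (fun l => by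
        have := hS k l
        rw [Matrix.sub_apply, abs_sub_comm] at this
        rwa [Matrix.sub_apply]) ((hcolW j).trans (hcol j))
      have h3 := hmin.1 k j
      exact (abs_add_le _ _).trans (by linarith)
    rw [e, Matrix.mul_apply]
    calc |∑ k, Sg⁻¹ i k * ((Sg - S) * W + (S * W - 1)) k j|
        ≤ 2 * lam * ∑ k, |Sg⁻¹ i k| := abs_dotProduct_le _ _ h1
      _ ≤ 2 * lam * C₂ := by
          refine mul_le_mul_of_nonneg_left ?_ (by linarith)
          simpa only [hsymm i] using hcol i
      _ = _ := by ring
  refine ⟨fun i j => ?_, fun i => ?_⟩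
  · rw [Matrix.sub_apply]
    rcases symmetrise_eq_or W i j with h | h
    · rw [h]; exact hentry i j
    · rw [h, hsymm i j]; exact hentry j i
  · calc ∑ j, |symmetrise W i j| = ∑ j, |symmetrise W j i| :=
          Finset.sum_congr rfl fun j _ => by rw [symmetrise_symm]
      _ ≤ ∑ j, |W j i| := Finset.sum_le_sum fun j _ => abs_symmetrise_le W j i
      _ ≤ ∑ j, |Sg⁻¹ j i| := hcolW i
      _ = _ := Finset.sum_congr rfl fun j _ => by rw [hsymm]

/-- An estimate of a weakly sparse vector with small maximal error and no larger `ℓ¹`-norm has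
small `ℓ¹`-error. -/
theorem sum_abs_sub_le_of_sparse {ι : Type*} [Fintype ι] (v w : ι → ℝ) {a q ξ : ℝ} (ha : 0 < a)
    (hq0 : 0 ≤ q) (hq1 : q < 1) (hent : ∀ j, |v j - w j| ≤ a)
    (hl1 : ∑ j, |v j| ≤ ∑ j, |w j|)
    (hsp : ∑ j, (if w j = 0 then 0 else |w j| ^ q) ≤ ξ) :
    ∑ j, |v j - w j| ≤ 2 * (a ^ (1 - q) * ξ) := by
  classical
  -- The threshold is the maximal error a: where |w| ≥ a the error is at most a ≤ a^(1−q)|w|^q, and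
  -- where |w| < a the entry itself is at most a^(1−q)|w|^q.
  set Bg := Finset.univ.filter fun j => a ≤ |w j| with hBg
  have hsplit : ∀ f : ι → ℝ, ∑ j, f j = ∑ j ∈ Bg, f j + ∑ j ∈ Bgᶜ, f j := fun f =>
    (Finset.sum_add_sum_compl Bg f).symm
  -- Because v has no larger ℓ¹-norm, its excess mass on the small entries is paid for by its error
  -- on the large ones.
  have h1 : ∑ j ∈ Bgᶜ, |v j - w j| ≤ 2 * ∑ j ∈ Bgᶜ, |w j| + ∑ j ∈ Bg, |v j - w j| := by
    have h2 : ∑ j ∈ Bgᶜ, |v j - w j| ≤ ∑ j ∈ Bgᶜ, |v j| + ∑ j ∈ Bgᶜ, |w j| := by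
      rw [← Finset.sum_add_distrib]
      exact Finset.sum_le_sum fun j _ => abs_sub _ _
    have h3 : ∑ j ∈ Bg, |w j| - ∑ j ∈ Bg, |v j| ≤ ∑ j ∈ Bg, |v j - w j| := by
      rw [← Finset.sum_sub_distrib]
      refine Finset.sum_le_sum fun j _ => ?_
      rw [abs_sub_comm]
      exact abs_sub_abs_le_abs_sub _ _
    rw [hsplit (fun j => |v j|), hsplit (fun j => |w j|)] at hl1
    linarith
  have hb : ∑ j ∈ Bg, |v j - w j| ≤ ∑ j ∈ Bg, a ^ (1 - q) * (if w j = 0 then 0 else |w j| ^ q) := by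
    refine Finset.sum_le_sum fun j hj => ?_
    have hj' : a ≤ |w j| := (Finset.mem_filter.1 hj).2
    have hw : w j ≠ 0 := fun h => by rw [h, abs_zero] at hj'; linarith
    rw [if_neg hw]
    calc |v j - w j| ≤ a := hent j
      _ = a ^ (1 - q) * a ^ q := by
          rw [← Real.rpow_add ha]; simp
      _ ≤ a ^ (1 - q) * |w j| ^ q := by gcongr
  have hs : ∑ j ∈ Bgᶜ, |w j| ≤ ∑ j ∈ Bgᶜ, a ^ (1 - q) * (if w j = 0 then 0 else |w j| ^ q) := by
    refine Finset.sum_le_sum fun j hj => ?_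
    have hj' : |w j| < a := by
      by_contra! hc
      exact (Finset.mem_compl.1 hj) (Finset.mem_filter.2 ⟨Finset.mem_univ _, hc⟩)
    by_cases hw : w j = 0
    · simp [hw]
    · rw [if_neg hw]
      have hpos : 0 < |w j| := abs_pos.2 hw
      calc |w j| = |w j| ^ (1 - q) * |w j| ^ q := by
            rw [← Real.rpow_add hpos]; simp
        _ ≤ a ^ (1 - q) * |w j| ^ q := by
            gcongr
  have htot := hsplit (fun j => a ^ (1 - q) * (if w j = 0 then 0 else |w j| ^ q))
  rw [← Finset.mul_sum] at htot
  have hfin := mul_le_mul_of_nonneg_left hsp (Real.rpow_nonneg ha.le (1 - q))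
  rw [hsplit (fun j => |v j - w j|)]
  linarith

/-- Error bounds for the symmetrised CLIME estimate over the class of weakly sparse precision
matrices. -/
theorem clime_rates {S Sg W : Matrix (Fin d) (Fin d) ℝ} {lam η C₂ q ξ : ℝ} (hSg : Sg.PosDef)
    (hη : 0 ≤ η) (hC₂ : 0 < C₂) (hlam0 : 0 < lam) (hcol : ∀ j, ∑ i, |Sg⁻¹ i j| ≤ C₂)
    (hS : ∀ i j, |(S - Sg) i j| ≤ η) (hlam : η * C₂ ≤ lam) (hW : IsClime S lam W)
    (hq0 : 0 ≤ q) (hq1 : q < 1) (hξ : 0 ≤ ξ)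
    (hsp : ∀ i, ∑ j, (if Sg⁻¹ i j = 0 then 0 else |Sg⁻¹ i j| ^ q) ≤ ξ) :
    (∀ i j, |(symmetrise W - Sg⁻¹) i j| ≤ 2 * C₂ * lam) ∧
    opNorm (symmetrise W - Sg⁻¹) ≤ 2 * ((2 * C₂ * lam) ^ (1 - q) * ξ) ∧
    (1 / (d : ℝ)) * ∑ i, ∑ j, ((symmetrise W - Sg⁻¹) i j) ^ 2
      ≤ 2 * ((2 * C₂ * lam) ^ (2 - q) * ξ) := by
  obtain ⟨h1, h2⟩ := clime_entry hSg hη hcol hS hlam hW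
  set a := 2 * C₂ * lam with ha
  have ha0 : 0 < a := by positivity
  have hrow : ∀ i, ∑ j, |(symmetrise W - Sg⁻¹) i j| ≤ 2 * (a ^ (1 - q) * ξ) := fun i =>
    sum_abs_sub_le_of_sparse (symmetrise W i) (Sg⁻¹ i) ha0 hq0 hq1 (h1 i) (h2 i) (hsp i)
  have hsymm : ∀ i j, Sg⁻¹ i j = Sg⁻¹ j i := fun i j => by
    have := hSg.inv.isHermitian.apply j i
    simpa using this
  have hnn : 0 ≤ 2 * (a ^ (1 - q) * ξ) := by positivity
  refine ⟨h1, opNorm_le_of_row_sum _ (fun i j => ?_) hnn hrow, ?_⟩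
  · rw [Matrix.sub_apply, Matrix.sub_apply, symmetrise_symm, hsymm]
  -- Squares are bounded by the maximal entry times the row sum, which gains one power of a.
  · have h3 : ∑ i, ∑ j, ((symmetrise W - Sg⁻¹) i j) ^ 2
        ≤ ∑ _i : Fin d, a * (2 * (a ^ (1 - q) * ξ)) := by
      refine Finset.sum_le_sum fun i _ => ?_
      refine le_trans ?_ (mul_le_mul_of_nonneg_left (hrow i) ha0.le)
      rw [Finset.mul_sum]
      refine Finset.sum_le_sum fun j _ => ?_
      rw [← sq_abs, pow_two]
      exact mul_le_mul_of_nonneg_right (h1 i j) (abs_nonneg _)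
    rw [Finset.sum_const, Finset.card_univ, Fintype.card_fin, nsmul_eq_mul] at h3
    have e1 : a * (2 * (a ^ (1 - q) * ξ)) = 2 * (a ^ (2 - q) * ξ) := by
      have : a ^ (2 - q) = a * a ^ (1 - q) := by
        rw [show 2 - q = 1 + (1 - q) by ring, Real.rpow_add ha0, Real.rpow_one]
      rw [this]; ring
    rw [e1] at h3
    rcases Nat.eq_zero_or_pos d with hd | hd
    · subst hd
      simp only [Finset.univ_eq_empty, Finset.sum_empty, mul_zero]
      positivity
    · have hd0 : (0 : ℝ) < d := by exact_mod_cast hd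
      rw [one_div, inv_mul_eq_div, div_le_iff₀ hd0]
      linarith

end Clime

/-! ### Local linear weights: design, discretisation and covariance error. -/

section KernelSums

variable {K : ℝ → ℝ} {n : ℕ} {b : ℝ}

/-- Lagrange's identity for weighted sums. -/
theorem sum_mul_sum_sub_sq (I : Finset ℕ) (w z : ℕ → ℝ) :
    (∑ t ∈ I, w t) * (∑ t ∈ I, z t ^ 2 * w t) - (∑ t ∈ I, z t * w t) ^ 2
      = 1 / 2 * ∑ t ∈ I, ∑ r ∈ I, w t * w r * (z t - z r) ^ 2 := by
  have e : ∀ t r, w t * w r * (z t - z r) ^ 2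
      = (z t ^ 2 * w t) * w r + w t * (z r ^ 2 * w r) - 2 * ((z t * w t) * (z r * w r)) :=
    fun t r => by ring
  simp only [e, Finset.sum_sub_distrib, Finset.sum_add_distrib]
  rw [← Finset.sum_mul_sum, ← Finset.sum_mul_sum]
  simp only [← Finset.mul_sum, ← Finset.sum_mul]
  ring

/-- The local linear design is uniformly non-degenerate, also at the boundary. -/
theorem IsKernel.design_lower_bound (hK : IsKernel K) : ∃ c₀ N₀ : ℝ, 0 < c₀ ∧ ∀ (n : ℕ) (b : ℝ),
    0 < b → b ≤ 1 / 4 → N₀ ≤ n * b → 8 ≤ (n : ℝ) → ∀ τ ∈ Icc (0 : ℝ) 1,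
    c₀ * (n * b) ^ 2 ≤ kernSum n K b 0 τ * kernSum n K b 2 τ - kernSum n K b 1 τ ^ 2 := by
  obtain ⟨c₁, c₂, κ, hc1, hc12, hc2, hκ, hlow⟩ := hK.exists_lower_bound
  set ℓ := (c₂ - c₁) / 3 with hℓ
  have hℓ0 : 0 < ℓ := by rw [hℓ]; linarith
  -- The constant is ½·(ℓ/2)²·κ²·ℓ²: two blocks of at least nbℓ/2 times each, with kernel arguments
  -- at least ℓ apart. The threshold N₀ makes nbc₁ and nbℓ at least 2.
  refine ⟨κ ^ 2 * ℓ ^ 4 / 8, max (2 / c₁) (2 / ℓ), by positivity, ?_⟩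
  intro n b hb hb4 hnb hn8 τ hτ
  have hn : (0 : ℝ) < n := by linarith
  have hnb1 : 2 ≤ n * b * c₁ := by
    have := (le_max_left _ _).trans hnb
    rwa [div_le_iff₀ hc1] at this
  have hnb2 : 2 ≤ n * b * ℓ := by
    have := (le_max_right _ _).trans hnb
    rwa [div_le_iff₀ hℓ0] at this
  -- an interval of length `3 ℓ` on which the kernel is bounded below and time is available
  obtain ⟨p, hp, hp1, hp2⟩ : ∃ p : ℝ, (∀ z ∈ Icc p (p + 3 * ℓ), κ ≤ K z) ∧
      2 ≤ n * (τ + p * b) ∧ n * (τ + (p + 3 * ℓ) * b) ≤ n := by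
    have e3 : c₁ + 3 * ℓ = c₂ := by rw [hℓ]; ring
    -- In the left half of [0, 1] the interval to the right of τ is available, in the right half its
    -- mirror image. The bound b ≤ 1/4 keeps either inside [0, 1], and nbc₁ ≥ 2 or n ≥ 8 keeps it
    -- beyond time 2.
    by_cases hhalf : τ ≤ 1 / 2
    · refine ⟨c₁, fun z hz => hlow z (by rwa [e3] at hz), ?_, ?_⟩
      · nlinarith [hτ.1, mul_nonneg hn.le hτ.1]
      · rw [e3]
        have : τ + c₂ * b ≤ 1 := by nlinarith
        nlinarith
    · push Not at hhalf
      refine ⟨-c₂, fun z hz => ?_, ?_, ?_⟩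
      · rw [← hK.symm]
        exact hlow _ ⟨by linarith [hz.2], by linarith [hz.1]⟩
      · have : 1 / 4 ≤ τ + -c₂ * b := by nlinarith
        nlinarith
      · have : τ + (-c₂ + 3 * ℓ) * b ≤ 1 := by
          have : -c₂ + 3 * ℓ = -c₁ := by linarith
          rw [this]
          nlinarith [hτ.2, mul_pos hc1 hb]
        nlinarith
  set z : ℕ → ℝ := fun t => (rt n t - τ) / b with hz
  have hzt : ∀ t : ℕ, (t : ℝ) = n * (τ + z t * b) := fun t => by
    simp only [hz, rt]; field_simp; ring
  set T : ℝ → ℝ → Finset ℕ := fun u v => (Finset.Icc 2 n).filter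
    fun t : ℕ => n * (τ + u * b) ≤ t ∧ (t : ℝ) ≤ n * (τ + v * b) with hT
  have hmemT : ∀ u v t, t ∈ T u v → u ≤ z t ∧ z t ≤ v := fun u v t ht => by
    have h1 := (Finset.mem_filter.1 ht).2
    rw [hzt t] at h1
    constructor
    · have := le_of_mul_le_mul_left h1.1 hn
      nlinarith
    · have := le_of_mul_le_mul_left h1.2 hn
      nlinarith
  have hcard : ∀ u v, 2 ≤ n * (τ + u * b) → n * (τ + v * b) ≤ n → v - u = ℓ →
      n * b * ℓ / 2 ≤ ((T u v).card : ℝ) := fun u v hu hv huv => by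
    have h1 := le_card_filter hu hv
    have e : n * (τ + v * b) - n * (τ + u * b) = n * b * ℓ := by rw [← huv]; ring
    rw [e] at h1
    linarith
  have hnb0 : 0 < n * b := by positivity
  have hcard1 : n * b * ℓ / 2 ≤ ((T p (p + ℓ)).card : ℝ) :=
    hcard _ _ hp1 (le_trans (by nlinarith [mul_pos hnb0 hℓ0]) hp2) (by ring)
  have hcard2 : n * b * ℓ / 2 ≤ ((T (p + 2 * ℓ) (p + 3 * ℓ)).card : ℝ) :=
    hcard _ _ (hp1.trans (by nlinarith [mul_pos hnb0 hℓ0])) hp2 (by ring)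
  -- By Lagrange's identity the design determinant is a double sum of nonnegative terms, so
  -- restriction to the two blocks bounds it from below.
  have e0 : kernSum n K b 0 τ * kernSum n K b 2 τ - kernSum n K b 1 τ ^ 2
      = 1 / 2 * ∑ t ∈ Finset.Icc 2 n, ∑ r ∈ Finset.Icc 2 n,
          K (z t) * K (z r) * (z t - z r) ^ 2 := by
    rw [← sum_mul_sum_sub_sq]
    simp [kernSum, hz]
  rw [e0]
  have hpos : ∀ t r, 0 ≤ K (z t) * K (z r) * (z t - z r) ^ 2 := fun t r =>
    mul_nonneg (mul_nonneg (hK.nonneg _) (hK.nonneg _)) (sq_nonneg _)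
  have h1 : ∑ t ∈ T p (p + ℓ), ∑ r ∈ T (p + 2 * ℓ) (p + 3 * ℓ), κ * κ * ℓ ^ 2
      ≤ ∑ t ∈ Finset.Icc 2 n, ∑ r ∈ Finset.Icc 2 n, K (z t) * K (z r) * (z t - z r) ^ 2 := by
    calc _ ≤ ∑ t ∈ T p (p + ℓ), ∑ r ∈ T (p + 2 * ℓ) (p + 3 * ℓ),
          K (z t) * K (z r) * (z t - z r) ^ 2 := by
          refine Finset.sum_le_sum fun t ht => Finset.sum_le_sum fun r hr => ?_
          have ht' := hmemT _ _ _ ht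
          have hr' := hmemT _ _ _ hr
          have k1 := hp (z t) ⟨ht'.1, by linarith⟩
          have k2 := hp (z r) ⟨by linarith, hr'.2⟩
          have k3 : ℓ ^ 2 ≤ (z t - z r) ^ 2 := by
            rw [← neg_sq (z t - z r)]
            exact pow_le_pow_left₀ hℓ0.le (by linarith) 2
          exact mul_le_mul (mul_le_mul k1 k2 hκ.le (hK.nonneg _)) k3 (sq_nonneg _)
            (mul_nonneg (hK.nonneg _) (hK.nonneg _))
      _ ≤ ∑ t ∈ T p (p + ℓ), ∑ r ∈ Finset.Icc 2 n, K (z t) * K (z r) * (z t - z r) ^ 2 :=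
          Finset.sum_le_sum fun t _ => Finset.sum_le_sum_of_subset_of_nonneg
            (Finset.filter_subset _ _) fun r _ _ => hpos t r
      _ ≤ _ := Finset.sum_le_sum_of_subset_of_nonneg (Finset.filter_subset _ _)
            fun t _ _ => Finset.sum_nonneg fun r _ => hpos t r
  rw [Finset.sum_const, Finset.sum_const, nsmul_eq_mul, nsmul_eq_mul] at h1
  have h2 : n * b * ℓ / 2 * (n * b * ℓ / 2 * (κ * κ * ℓ ^ 2))
      ≤ ((T p (p + ℓ)).card : ℝ) * (((T (p + 2 * ℓ) (p + 3 * ℓ)).card : ℝ) *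
          (κ * κ * ℓ ^ 2)) :=
    mul_le_mul hcard1 (mul_le_mul_of_nonneg_right hcard2 (by positivity)) (by positivity)
      (Nat.cast_nonneg _)
  have h3 : κ ^ 2 * ℓ ^ 4 / 8 * (n * b) ^ 2
      = 1 / 2 * (n * b * ℓ / 2 * (n * b * ℓ / 2 * (κ * κ * ℓ ^ 2))) := by ring
  linarith

/-- From a grid of evaluation points to all `τ ∈ [0,1]`: the kernel is Lipschitz on `[-1,1]` and
may jump at the end points. -/
theorem abs_kernel_sum_le_of_grid {g : ℝ → ℝ} {G Lg Y x₀ : ℝ} (hg : ∀ x, |g x| ≤ G)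
    (hsupp : ∀ x, x ∉ Icc (-1 : ℝ) 1 → g x = 0)
    (hlip : ∀ x ∈ Icc (-1 : ℝ) 1, ∀ y ∈ Icc (-1 : ℝ) 1, |g x - g y| ≤ Lg * |x - y|) (hLg : 0 ≤ Lg)
    (hb : 0 < b) (hnb : 1 ≤ n * b) (y : ℕ → ℝ) (hY : ∀ t ∈ Finset.Icc 2 n, |y t| ≤ Y) (hY0 : 0 ≤ Y)
    (hgrid : ∀ r ≤ n, |∑ t ∈ Finset.Icc 2 n, g ((rt n t - rt n r) / b) * y t| ≤ x₀)
    {τ : ℝ} (hτ : τ ∈ Icc (0 : ℝ) 1) :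
    |∑ t ∈ Finset.Icc 2 n, g ((rt n t - τ) / b) * y t| ≤ x₀ + (3 * Lg + 6 * G) * Y := by
  have hG : 0 ≤ G := (abs_nonneg _).trans (hg 0)
  have hn : (0 : ℝ) < n := by
    by_contra! hc
    nlinarith [mul_nonpos_of_nonpos_of_nonneg hc hb.le]
  have hnb0 : 0 < n * b := by linarith
  -- The grid point just left of τ; it may be 0, which is why the grid bound includes r = 0. Kernel
  -- arguments move by at most 1/(nb).
  set r := ⌊n * τ⌋₊ with hr
  have hnτ : 0 ≤ n * τ := mul_nonneg hn.le hτ.1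
  have hr1 : (r : ℝ) ≤ n * τ := Nat.floor_le hnτ
  have hr2 : n * τ < r + 1 := Nat.lt_floor_add_one _
  have hrn : r ≤ n := by
    have : (r : ℝ) ≤ n := hr1.trans (by nlinarith [hτ.2])
    exact_mod_cast this
  set z : ℕ → ℝ := fun t => (rt n t - τ) / b with hz
  set z' : ℕ → ℝ := fun t => (rt n t - rt n r) / b with hz'
  set D := 1 / (n * b) with hD
  have hD0 : 0 < D := by positivity
  have hzz : ∀ t, z t ≤ z' t ∧ z' t ≤ z t + D := fun t => by
    have e1 : z' t - z t = (n * τ - r) / (n * b) := by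
      simp only [hz, hz', rt]; field_simp; ring
    have e2 : (n * τ - r) / (n * b) ≤ D := by
      rw [hD]; gcongr; linarith
    have e3 : 0 ≤ (n * τ - r) / (n * b) := div_nonneg (by linarith) hnb0.le
    constructor <;> linarith
  have hzt : ∀ t : ℕ, (t : ℝ) = n * (τ + z t * b) := fun t => by
    simp only [hz, rt]; field_simp; ring
  -- If both arguments lie in [−1, 1] the Lipschitz bound applies. If only one does, an end point
  -- has been crossed: z is within D of 1 or of −1, and the difference is at most G.
  have hpt : ∀ t, |g (z t) - g (z' t)| ≤ (if n * (τ + -1 * b) ≤ t ∧ (t : ℝ) ≤ n * (τ + 1 * b)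
        then Lg * D else 0)
      + (if n * (τ + (1 - D) * b) ≤ t ∧ (t : ℝ) ≤ n * (τ + (1 + D) * b) then G else 0)
      + (if n * (τ + (-1 - D) * b) ≤ t ∧ (t : ℝ) ≤ n * (τ + (-1 + D) * b) then G else 0) := by
    intro t
    obtain ⟨h1, h2⟩ := hzz t
    have hiff : ∀ u v : ℝ, (n * (τ + u * b) ≤ t ∧ (t : ℝ) ≤ n * (τ + v * b)) ↔
        (u ≤ z t ∧ z t ≤ v) := fun u v => by
      rw [hzt t, mul_le_mul_iff_right₀ hn, mul_le_mul_iff_right₀ hn, add_le_add_iff_left,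
        add_le_add_iff_left, mul_le_mul_iff_left₀ hb, mul_le_mul_iff_left₀ hb]
    simp only [hiff]
    have n1 : 0 ≤ if -1 ≤ z t ∧ z t ≤ 1 then Lg * D else 0 := by split_ifs <;> positivity
    have n2 : 0 ≤ if 1 - D ≤ z t ∧ z t ≤ 1 + D then G else 0 := by split_ifs <;> positivity
    have n3 : 0 ≤ if -1 - D ≤ z t ∧ z t ≤ -1 + D then G else 0 := by split_ifs <;> positivity
    by_cases ha : z t ∈ Icc (-1 : ℝ) 1
    · by_cases hb' : z' t ∈ Icc (-1 : ℝ) 1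
      · have h3 := hlip _ ha _ hb'
        have h4 : |z t - z' t| ≤ D := by rw [abs_sub_comm, abs_of_nonneg] <;> linarith
        have h5 := mul_le_mul_of_nonneg_left h4 hLg
        have h6 : -1 ≤ z t ∧ z t ≤ 1 := ha
        rw [if_pos h6]
        linarith
      · rw [hsupp _ hb', sub_zero]
        have h6 : 1 < z' t := by
          by_contra! hc
          exact hb' ⟨ha.1.trans h1, hc⟩
        rw [if_pos (⟨by linarith, by linarith [ha.2]⟩ : 1 - D ≤ z t ∧ z t ≤ 1 + D)] at n2 ⊢
        linarith [hg (z t)]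
    · rw [hsupp _ ha, zero_sub, abs_neg]
      by_cases hb' : z' t ∈ Icc (-1 : ℝ) 1
      · have h6 : z t < -1 := by
          by_contra! hc
          exact ha ⟨hc, h1.trans hb'.2⟩
        rw [if_pos (⟨by linarith [hb'.1], by linarith⟩ : -1 - D ≤ z t ∧ z t ≤ -1 + D)] at n3 ⊢
        linarith [hg (z' t)]
      · rw [hsupp _ hb', abs_zero]
        linarith
  have hcount : ∀ u v c : ℝ, u ≤ v → 0 ≤ c → ∑ t ∈ Finset.Icc 2 n,
      (if n * (τ + u * b) ≤ t ∧ (t : ℝ) ≤ n * (τ + v * b) then c else 0)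
        ≤ ((v - u) * (n * b) + 1) * c := fun u v c huv hc => by
    rw [← Finset.sum_filter, Finset.sum_const, nsmul_eq_mul]
    have h1 : n * (τ + u * b) ≤ n * (τ + v * b) := by gcongr
    have h2 := card_filter_le h1 (Finset.Icc 2 n)
    refine mul_le_mul_of_nonneg_right (h2.trans (le_of_eq ?_)) hc
    ring
  have hsum : ∑ t ∈ Finset.Icc 2 n, |g (z t) - g (z' t)| ≤ 3 * Lg + 6 * G := by
    refine (Finset.sum_le_sum fun t _ => hpt t).trans ?_
    rw [Finset.sum_add_distrib, Finset.sum_add_distrib]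
    have k1 := hcount (-1) 1 (Lg * D) (by norm_num) (by positivity)
    have k2 := hcount (1 - D) (1 + D) G (by linarith) hG
    have k3 := hcount (-1 - D) (-1 + D) G (by linarith) hG
    have e1 : D * (n * b) = 1 := by rw [hD]; field_simp
    have e2 : (1 - -1) * (n * b) + 1 ≤ 3 * (n * b) := by linarith
    have k4 : ((1 - -1) * (n * b) + 1) * (Lg * D) ≤ 3 * Lg := by
      calc ((1 - -1) * (n * b) + 1) * (Lg * D) ≤ 3 * (n * b) * (Lg * D) := by gcongr
        _ = 3 * Lg * (D * (n * b)) := by ring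
        _ = _ := by rw [e1, mul_one]
    -- An end-point window has width 2D in kernel units, hence at most 2D·nb + 1 = 3 times.
    have k5 : ((1 + D - (1 - D)) * (n * b) + 1) * G = 3 * G := by
      linear_combination (2 * G) * e1
    have k6 : ((-1 + D - (-1 - D)) * (n * b) + 1) * G = 3 * G := by
      linear_combination (2 * G) * e1
    linarith
  have hdiff : |∑ t ∈ Finset.Icc 2 n, g (z t) * y t - ∑ t ∈ Finset.Icc 2 n, g (z' t) * y t|
      ≤ (3 * Lg + 6 * G) * Y := by
    rw [← Finset.sum_sub_distrib]
    calc _ ≤ ∑ t ∈ Finset.Icc 2 n, |g (z t) * y t - g (z' t) * y t| :=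
          Finset.abs_sum_le_sum_abs _ _
      _ ≤ ∑ t ∈ Finset.Icc 2 n, |g (z t) - g (z' t)| * Y := by
          refine Finset.sum_le_sum fun t ht => ?_
          rw [← sub_mul, abs_mul]
          exact mul_le_mul_of_nonneg_left (hY t ht) (abs_nonneg _)
      _ ≤ _ := by
          rw [← Finset.sum_mul]
          exact mul_le_mul_of_nonneg_right hsum hY0
  have h1 := hgrid r hrn
  have h2 := abs_sub_abs_le_abs_sub (∑ t ∈ Finset.Icc 2 n, g (z t) * y t)
    (∑ t ∈ Finset.Icc 2 n, g (z' t) * y t)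
  simp only [hz, hz'] at h1 h2 hdiff ⊢
  linarith

theorem sum_grid_two_eq (f : ℕ → ℝ) :
    ∑ t : Grid n with 2 ≤ t.1, f t.1 = ∑ t ∈ Finset.Icc 2 n, f t := by
  have h1 : ∑ t : Grid n with 2 ≤ t.1, f t.1 = ∑ t ∈ (Finset.Icc 1 n).filter (2 ≤ ·), f t := by
    rw [Finset.sum_filter, Finset.sum_filter]
    exact Finset.sum_coe_sort (Finset.Icc 1 n) (fun t => if 2 ≤ t then f t else 0)
  rw [h1]
  congr 1
  ext t
  simp only [Finset.mem_filter, Finset.mem_Icc]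
  omega

set_option maxHeartbeats 1000000 in
/-- Entrywise error of the local linear covariance estimate at one point. -/
theorem abs_sigmaHat_sub_le {d : ℕ} {G S M c₀ ρ x₀ : ℝ} (hKG : ∀ x, |K x| ≤ G)
    (hK0 : ∀ x, 0 ≤ K x) (hKs : ∀ x, x ∉ Icc (-1 : ℝ) 1 → K x = 0) (hb : 0 < b)
    (hnb : 1 ≤ n * b) (hc₀ : 0 < c₀) {τ : ℝ} (hτ : τ ∈ Icc (0 : ℝ) 1)
    (hdes : c₀ * (n * b) ^ 2 ≤ kernSum n K b 0 τ * kernSum n K b 2 τ - kernSum n K b 1 τ ^ 2)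
    {Sig : ℝ → Matrix (Fin d) (Fin d) ℝ}
    (hsm : ∀ i j, ContDiffOn ℝ 2 (fun τ => Sig τ i j) (Icc 0 1))
    (hM : ∀ i j, ∀ τ ∈ Icc (0 : ℝ) 1,
      |iteratedDerivWithin 2 (fun u => Sig u i j) (Icc 0 1) τ| ≤ M)
    (hS : ∀ τ ∈ Icc (0 : ℝ) 1, ∀ i j, |Sig τ i j| ≤ S)
    {x e : ℕ → Fin d → ℝ} {ahat : Fin d → Grid n → Fin d → ℝ} (hρ0 : 0 ≤ ρ) (hρ1 : ρ ≤ 1)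
    (hres : ∀ t : Grid n, 2 ≤ t.1 → ∀ i, |resid n x ahat t i - e t i| ≤ ρ)
    (hx₀ : x₀ ≤ n * b)
    (hcov : ∀ i j, ∀ k < 2, |∑ t ∈ Finset.Icc 2 n, ((rt n t - τ) / b) ^ k * K ((rt n t - τ) / b) *
      (e t i * e t j - Sig (rt n t) i j)| ≤ x₀) (i j : Fin d) :
    |sigmaHat n K b x ahat τ i j - Sig τ i j|
      ≤ 6 * G / c₀ * ((6 * G + 3 * G * S + 1) * ρ + x₀ / (n * b) + 3 * G * M * b ^ 2) := by
  have hG : 0 ≤ G := (abs_nonneg _).trans (hKG 0)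
  have hS0 : 0 ≤ S := (abs_nonneg _).trans (hS τ hτ i j)
  have hM0 : 0 ≤ M := (abs_nonneg _).trans (hM i j τ hτ)
  have hnb0 : 0 < n * b := by linarith
  have hn : (0 : ℝ) < n := by
    by_contra! hc
    nlinarith [mul_nonpos_of_nonpos_of_nonneg hc hb.le]
  set I := Finset.Icc 2 n with hI
  set z : ℕ → ℝ := fun t => (rt n t - τ) / b with hz
  set w : ℕ → ℝ := fun t => llWeight n K b τ t with hw
  set s1 := kernSum n K b 1 τ with hs1
  set s2 := kernSum n K b 2 τ with hs2
  set s0 := kernSum n K b 0 τ with hs0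
  have hsumK : ∑ t ∈ I, K (z t) ≤ 3 * G * (n * b) := by
    have := sum_abs_kernel_le hKG hKs hb hnb τ I
    simpa only [abs_of_nonneg (hK0 _)] using this
  have hzK : ∀ (k : ℕ) t, |z t ^ k * K (z t)| ≤ K (z t) := fun k t => by
    by_cases h1 : z t ∈ Icc (-1 : ℝ) 1
    · rw [abs_mul, abs_of_nonneg (hK0 _), abs_pow]
      exact mul_le_of_le_one_left (hK0 _) (pow_le_one₀ (abs_nonneg _) (abs_le.2 h1))
    · rw [hKs _ h1, mul_zero, abs_zero]
  have hsk : ∀ k, |kernSum n K b k τ| ≤ 3 * G * (n * b) := fun k =>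
    (Finset.abs_sum_le_sum_abs _ _).trans
      ((Finset.sum_le_sum fun t _ => hzK k t).trans hsumK)
  have hwabs : ∀ t, |w t| ≤ 6 * G * (n * b) * K (z t) := fun t => by
    have h1 := hsk 1
    have h2 := hsk 2
    have h3 := hzK 1 t
    rw [pow_one] at h3
    have e1 : w t = K (z t) * s2 - z t * K (z t) * s1 := rfl
    rw [e1]
    refine (abs_sub _ _).trans ?_
    rw [abs_mul, abs_mul (z t * K (z t)), abs_of_nonneg (hK0 (z t))]
    have k1 : K (z t) * |s2| ≤ K (z t) * (3 * G * (n * b)) :=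
      mul_le_mul_of_nonneg_left h2 (hK0 _)
    have k2 : |z t * K (z t)| * |s1| ≤ K (z t) * (3 * G * (n * b)) :=
      mul_le_mul h3 h1 (abs_nonneg _) (hK0 _)
    linarith
  -- sums against the weights of terms that are bounded in average
  have hwsum : ∀ (f F : ℕ → ℝ), (∀ t ∈ I, z t ∈ Icc (-1 : ℝ) 1 → |f t| ≤ F t) →
      |∑ t ∈ I, w t * f t| ≤ 6 * G * (n * b) * ∑ t ∈ I, K (z t) * F t := fun f F hF => by
    rw [Finset.mul_sum]
    refine (Finset.abs_sum_le_sum_abs _ _).trans (Finset.sum_le_sum fun t ht => ?_)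
    rw [abs_mul]
    by_cases h1 : z t ∈ Icc (-1 : ℝ) 1
    · refine (mul_le_mul (hwabs t) (hF t ht h1) (abs_nonneg _) ?_).trans (le_of_eq (by ring))
      exact mul_nonneg (by positivity) (hK0 _)
    · have h2 := hwabs t
      rw [hKs _ h1, mul_zero] at h2
      have h3 : |w t| = 0 := le_antisymm h2 (abs_nonneg _)
      rw [h3, hKs _ h1]
      simp
  have hD : ∑ t ∈ I, w t = s0 * s2 - s1 ^ 2 := by
    have e1 : ∀ t, w t = K (z t) * s2 - z t * K (z t) * s1 := fun t => rfl
    simp only [e1, Finset.sum_sub_distrib, ← Finset.sum_mul]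
    simp only [hs0, hs1, kernSum, pow_zero, pow_one, one_mul]
    ring
  -- The weights annihilate linear functions centred at τ, so the first-order Taylor term of Σ drops
  -- out, also at the boundary.
  have hDz : ∑ t ∈ I, w t * z t = 0 := by
    have e1 : ∀ t, w t * z t = z t ^ 1 * K (z t) * s2 - z t ^ 2 * K (z t) * s1 := fun t => by
      have : w t = K (z t) * s2 - z t * K (z t) * s1 := rfl
      rw [this]; ring
    simp only [e1, Finset.sum_sub_distrib, ← Finset.sum_mul]
    simp only [hs2, hs1, kernSum]
    ring
  have hDpos : 0 < ∑ t ∈ I, w t := by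
    rw [hD]; exact lt_of_lt_of_le (by positivity) hdes
  -- residuals as a function on the integers
  set eh : ℕ → Fin d → ℝ := fun t i => if ht : t ∈ Finset.Icc 1 n then resid n x ahat ⟨t, ht⟩ i
    else 0 with heh
  have hehat : ∀ t ∈ I, ∀ i, |eh t i - e t i| ≤ ρ := fun t ht i => by
    have ht' := Finset.mem_Icc.1 ht
    have ht1 : t ∈ Finset.Icc 1 n := Finset.mem_Icc.2 ⟨by omega, ht'.2⟩
    simp only [heh, ht1, dif_pos]
    exact hres ⟨t, ht1⟩ ht'.1 i
  have hsig : sigmaHat n K b x ahat τ i j = (∑ t ∈ I, w t * (eh t i * eh t j)) / ∑ t ∈ I, w t := by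
    rw [hI, ← sum_grid_two_eq (fun t => w t * (eh t i * eh t j)), ← sum_grid_two_eq w, sigmaHat,
      Matrix.of_apply]
    congr 1
    refine Finset.sum_congr rfl fun t _ => ?_
    simp only [heh, t.2, dif_pos, hw]
    ring
  -- Residuals against innovations, sampling error, and second-order bias.
  have hsplit : ∑ t ∈ I, w t * (eh t i * eh t j) - (∑ t ∈ I, w t) * Sig τ i j
      = ∑ t ∈ I, w t * (eh t i * eh t j - e t i * e t j)
        + ∑ t ∈ I, w t * (e t i * e t j - Sig (rt n t) i j)
        + ∑ t ∈ I, w t * (Sig (rt n t) i j - Sig τ i j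
            - derivWithin (fun u => Sig u i j) (Icc 0 1) τ * (rt n t - τ)) := by
    have e1 : ∑ t ∈ I, w t * (derivWithin (fun u => Sig u i j) (Icc 0 1) τ * (rt n t - τ)) = 0 := by
      have e2 : ∀ t, w t * (derivWithin (fun u => Sig u i j) (Icc 0 1) τ * (rt n t - τ))
          = derivWithin (fun u => Sig u i j) (Icc 0 1) τ * b * (w t * z t) := fun t => by
        simp only [hz]; field_simp
      simp only [e2, ← Finset.mul_sum]
      rw [hDz, mul_zero]
    have e3 : ∑ t ∈ I, w t * (Sig (rt n t) i j - Sig τ i j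
            - derivWithin (fun u => Sig u i j) (Icc 0 1) τ * (rt n t - τ))
        = ∑ t ∈ I, w t * Sig (rt n t) i j - ∑ t ∈ I, w t * Sig τ i j := by
      rw [← Finset.sum_sub_distrib]
      refine (add_zero _).symm.trans ?_
      refine (congrArg (_ + ·) e1.symm).trans ?_
      rw [← Finset.sum_add_distrib]
      exact Finset.sum_congr rfl fun t _ => by ring
    rw [e3, Finset.sum_mul]
    simp only [mul_sub, Finset.sum_sub_distrib]
    ring
  -- Weighted squares of innovations are controlled by the covariance deviation x₀ ≤ nb and not by
  -- the maximal innovation, so the term proportional to ρ picks up no logarithm.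
  have hsq : ∀ l, ∑ t ∈ I, K (z t) * (e t l) ^ 2 ≤ (3 * G * S + 1) * (n * b) := fun l => by
    have h1 := (abs_le.1 (hcov l l 0 (by norm_num))).2
    have e1 : ∑ t ∈ I, K (z t) * (e t l) ^ 2
        = ∑ t ∈ I, z t ^ 0 * K (z t) * (e t l * e t l - Sig (rt n t) l l)
          + ∑ t ∈ I, K (z t) * Sig (rt n t) l l := by
      rw [← Finset.sum_add_distrib]
      exact Finset.sum_congr rfl fun t _ => by ring
    have h2 : ∑ t ∈ I, K (z t) * Sig (rt n t) l l ≤ 3 * G * (n * b) * S := by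
      refine le_trans (Finset.sum_le_sum (g := fun t => K (z t) * S) fun t ht => ?_) ?_
      · refine mul_le_mul_of_nonneg_left ((le_abs_self _).trans (hS _ ?_ l l)) (hK0 _)
        have h3 : (t : ℝ) ≤ n := by exact_mod_cast (Finset.mem_Icc.1 ht).2
        exact ⟨by rw [rt]; positivity, by rw [rt]; exact div_le_one_of_le₀ h3 hn.le⟩
      · rw [← Finset.sum_mul]
        exact mul_le_mul_of_nonneg_right hsumK hS0
    rw [e1]
    simp only [hz] at h1 h2 ⊢
    linarith
  have hA : |∑ t ∈ I, w t * (eh t i * eh t j - e t i * e t j)|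
      ≤ 6 * G * (n * b) * ((6 * G + 3 * G * S + 1) * ρ * (n * b)) := by
    refine (hwsum _ (fun t => ρ * (2 + e t i ^ 2 / 2 + e t j ^ 2 / 2)) fun t ht _ => ?_).trans ?_
    · have h1 := hehat t ht i
      have h2 := hehat t ht j
      have e1 : eh t i * eh t j - e t i * e t j = (eh t i - e t i) * (eh t j - e t j)
          + (eh t i - e t i) * e t j + e t i * (eh t j - e t j) := by ring
      rw [e1]
      have k0 : |(eh t i - e t i) * (eh t j - e t j)| ≤ ρ * 1 := by
        rw [abs_mul]; exact mul_le_mul h1 (h2.trans hρ1) (abs_nonneg _) hρ0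
      have k1 : |(eh t i - e t i) * e t j| ≤ ρ * |e t j| := by
        rw [abs_mul]; exact mul_le_mul_of_nonneg_right h1 (abs_nonneg _)
      have k2 : |e t i * (eh t j - e t j)| ≤ ρ * |e t i| := by
        rw [abs_mul, mul_comm]; exact mul_le_mul_of_nonneg_right h2 (abs_nonneg _)
      have k3 : |e t i| ≤ 1 / 2 + e t i ^ 2 / 2 := by
        nlinarith [sq_nonneg (|e t i| - 1), sq_abs (e t i)]
      have k4 : |e t j| ≤ 1 / 2 + e t j ^ 2 / 2 := by
        nlinarith [sq_nonneg (|e t j| - 1), sq_abs (e t j)]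
      have k5 := mul_le_mul_of_nonneg_left k3 hρ0
      have k6 := mul_le_mul_of_nonneg_left k4 hρ0
      refine ((abs_add_le _ _).trans (add_le_add (abs_add_le _ _) le_rfl)).trans ?_
      linarith
    · refine mul_le_mul_of_nonneg_left ?_ (by positivity)
      have e1 : ∑ t ∈ I, K (z t) * (ρ * (2 + e t i ^ 2 / 2 + e t j ^ 2 / 2))
          = ρ * (2 * ∑ t ∈ I, K (z t) + (∑ t ∈ I, K (z t) * e t i ^ 2) / 2
            + (∑ t ∈ I, K (z t) * e t j ^ 2) / 2) := by
        rw [Finset.mul_sum, Finset.sum_div, Finset.sum_div, ← Finset.sum_add_distrib,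
          ← Finset.sum_add_distrib, Finset.mul_sum]
        exact Finset.sum_congr rfl fun t _ => by ring
      rw [e1]
      have k1 := hsq i
      have k2 := hsq j
      have k3 : 2 * ∑ t ∈ I, K (z t) + (∑ t ∈ I, K (z t) * e t i ^ 2) / 2
            + (∑ t ∈ I, K (z t) * e t j ^ 2) / 2 ≤ (6 * G + 3 * G * S + 1) * (n * b) := by
        linarith
      exact (mul_le_mul_of_nonneg_left k3 hρ0).trans (le_of_eq (by ring))
  have hB : |∑ t ∈ I, w t * (e t i * e t j - Sig (rt n t) i j)| ≤ 6 * G * (n * b) * x₀ := by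
    have e1 : ∑ t ∈ I, w t * (e t i * e t j - Sig (rt n t) i j)
        = (∑ t ∈ I, z t ^ 0 * K (z t) * (e t i * e t j - Sig (rt n t) i j)) * s2
          - (∑ t ∈ I, z t ^ 1 * K (z t) * (e t i * e t j - Sig (rt n t) i j)) * s1 := by
      rw [Finset.sum_mul, Finset.sum_mul, ← Finset.sum_sub_distrib]
      refine Finset.sum_congr rfl fun t _ => ?_
      have : w t = K (z t) * s2 - z t * K (z t) * s1 := rfl
      rw [this]; ring
    rw [e1]
    refine (abs_sub _ _).trans ?_
    rw [abs_mul, abs_mul]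
    have hx0 : 0 ≤ x₀ := (abs_nonneg _).trans (hcov i j 0 (by norm_num))
    have k1 := mul_le_mul (hcov i j 0 (by norm_num)) (hsk 2) (abs_nonneg _) hx0
    have k2 := mul_le_mul (hcov i j 1 (by norm_num)) (hsk 1) (abs_nonneg _) hx0
    simp only [hz, hs1, hs2] at k1 k2 ⊢
    linarith
  have hC : |∑ t ∈ I, w t * (Sig (rt n t) i j - Sig τ i j
      - derivWithin (fun u => Sig u i j) (Icc 0 1) τ * (rt n t - τ))|
      ≤ 6 * G * (n * b) * (3 * G * (n * b) * (M * b ^ 2)) := by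
    refine (hwsum _ (fun _ => M * b ^ 2) fun t ht hzt => ?_).trans ?_
    · have h3 : (t : ℝ) ≤ n := by exact_mod_cast (Finset.mem_Icc.1 ht).2
      refine (abs_taylor_le (hsm i j) (hM i j)
        ⟨by rw [rt]; positivity, by rw [rt]; exact div_le_one_of_le₀ h3 hn.le⟩ hτ).trans ?_
      refine mul_le_mul_of_nonneg_left ?_ hM0
      have e1 : rt n t - τ = z t * b := by simp only [hz]; field_simp
      rw [e1, mul_pow]
      have : z t ^ 2 ≤ 1 := by rw [← sq_abs]; exact pow_le_one₀ (abs_nonneg _) (abs_le.2 hzt)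
      nlinarith [sq_nonneg b]
    · refine mul_le_mul_of_nonneg_left ?_ (by positivity)
      rw [← Finset.sum_mul]
      exact mul_le_mul_of_nonneg_right hsumK (by positivity)
  have hdiv : sigmaHat n K b x ahat τ i j - Sig τ i j
      = (∑ t ∈ I, w t * (eh t i * eh t j) - (∑ t ∈ I, w t) * Sig τ i j) / ∑ t ∈ I, w t := by
    rw [hsig, sub_div, mul_div_cancel_left₀ _ hDpos.ne']
  rw [hdiv, hsplit, abs_div, abs_of_pos hDpos, div_le_iff₀ hDpos]
  refine ((abs_add_le _ _).trans (add_le_add (abs_add_le _ _) le_rfl)).trans ?_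
  refine (add_le_add (add_le_add hA hB) hC).trans ?_
  have hx0 : 0 ≤ x₀ := (abs_nonneg _).trans (hcov i j 0 (by norm_num))
  have hfac : 0 ≤ 6 * G / c₀ * ((6 * G + 3 * G * S + 1) * ρ + x₀ / (n * b) + 3 * G * M * b ^ 2) := by
    positivity
  rw [← hD] at hdes
  refine le_trans (le_of_eq ?_) (mul_le_mul_of_nonneg_left hdes hfac)
  have e2 : 6 * G / c₀ * c₀ = 6 * G := div_mul_cancel₀ _ hc₀.ne'
  have e3 : x₀ / (n * b) * (n * b) = x₀ := div_mul_cancel₀ _ hnb0.ne'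
  generalize x₀ / (n * b) = y at e3 ⊢
  generalize (n : ℝ) * b = m at e3 ⊢
  generalize 6 * G / c₀ = g at e2 ⊢
  rw [← e3, ← e2]
  ring

end KernelSums


/-! ### Uniform deviation bounds along the sequence. -/

section Events

variable {Ω : ℕ → Type*} [∀ n, MeasurableSpace (Ω n)] {μ : ∀ n, Measure (Ω n)}
  {d : ℕ → ℕ}

theorem log_le_logND {n : ℕ} (hn : 1 ≤ n) (d : ℕ) : Real.log n ≤ logND n d := by
  have h : (0 : ℝ) < n := by exact_mod_cast hn
  exact Real.log_le_log h (le_max_left _ _)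

theorem tendsto_logND (d : ℕ → ℕ) : Tendsto (fun n => logND n (d n)) atTop atTop :=
  tendsto_atTop_mono' _ ((eventually_ge_atTop 1).mono fun n hn => log_le_logND hn (d n))
    (Real.tendsto_log_atTop.comp tendsto_natCast_atTop_atTop)

/-- Union bound over pairs of coordinates, time points and two exponents. -/
theorem WPA1.forall_of_exp {P : ∀ n, Fin (d n) → Fin (d n) → ℕ → ℕ → Ω n → Prop} {D : ℝ}
    (hD : 0 ≤ D) (hf : ∀ᶠ n in atTop, ∀ i j, ∀ r ≤ n, ∀ k < 2, μ n {ω | ¬ P n i j r k ω} ≤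
      ENNReal.ofReal (D * Real.exp (-(4 * logND n (d n))))) :
    WPA1 μ (fun n ω => ∀ i j, ∀ r ≤ n, ∀ k < 2, P n i j r k ω) := by
  have key : WPA1 μ (fun n ω => ∀ x : Fin (d n) × Fin (d n) × Fin (n + 1) × Fin 2,
      P n x.1 x.2.1 x.2.2.1 x.2.2.2 ω) := by
    refine WPA1.forall_of_card (fun n => D * Real.exp (-(4 * logND n (d n))))
      (hf.mono fun n hn x => hn _ _ _ (Nat.lt_succ_iff.1 x.2.2.1.2) _ x.2.2.2.2) ?_
    have hlim : Tendsto (fun n : ℕ => 4 * D / (n : ℝ)) atTop (𝓝 0) :=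
      tendsto_const_nhds.div_atTop tendsto_natCast_atTop_atTop
    refine squeeze_zero' (Eventually.of_forall fun n => by positivity) ?_ hlim
    filter_upwards [eventually_ge_atTop 1] with n hn
    have hn0 : (1 : ℝ) ≤ n := by exact_mod_cast hn
    set N : ℝ := max (n : ℝ) (d n : ℝ) with hN
    have h1 : (n : ℝ) ≤ N := le_max_left _ _
    have h2 : (d n : ℝ) ≤ N := le_max_right _ _
    have hN0 : 0 < N := by linarith
    -- The tail is N⁻⁴ with N = n ∨ d, against at most 4N³ index tuples.
    have e1 : Real.exp (-(4 * logND n (d n))) = (N ^ 4)⁻¹ := by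
      have := Real.exp_nat_mul (Real.log N) 4
      rw [Real.exp_log hN0] at this
      rw [Real.exp_neg, logND, ← hN, ← this, Nat.cast_ofNat]
    have e2 : (Fintype.card (Fin (d n) × Fin (d n) × Fin (n + 1) × Fin 2) : ℝ)
        = d n * (d n * ((n + 1) * 2)) := by
      simp
    rw [e1, e2]
    calc (d n : ℝ) * (d n * ((n + 1) * 2)) * (D * (N ^ 4)⁻¹)
        ≤ N * (N * ((N + N) * 2)) * (D * (N ^ 4)⁻¹) := by
          have : (n : ℝ) + 1 ≤ N + N := by linarith
          gcongr
      _ = 4 * D / N := by field_simp; ring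
      _ ≤ 4 * D / n := by gcongr
  exact key.mono (Eventually.of_forall fun n ω hω i j r hr k hk =>
    hω ⟨i, j, ⟨r, Nat.lt_succ_iff.2 hr⟩, ⟨k, hk⟩⟩)

/-- Sums of squared local polynomial kernel weights. -/
theorem sum_sq_kernel_le {K : ℝ → ℝ} {G : ℝ} (hKG : ∀ x, |K x| ≤ G)
    (hKs : ∀ x, x ∉ Icc (-1 : ℝ) 1 → K x = 0) {n : ℕ} {b : ℝ} (hb : 0 < b) (hnb : 1 ≤ n * b)
    (τ : ℝ) (I : Finset ℕ) (k : ℕ) :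
    ∑ t ∈ I, (((rt n t - τ) / b) ^ k * K ((rt n t - τ) / b)) ^ 2 ≤ 3 * G ^ 2 * (n * b) := by
  have hG : 0 ≤ G := (abs_nonneg _).trans (hKG 0)
  have h1 := sum_abs_kernel_le hKG hKs hb hnb τ I
  calc _ ≤ ∑ t ∈ I, G * |K ((rt n t - τ) / b)| := by
        refine Finset.sum_le_sum fun t _ => ?_
        by_cases h2 : (rt n t - τ) / b ∈ Icc (-1 : ℝ) 1
        · have h3 : |((rt n t - τ) / b) ^ k| ≤ 1 := by
            rw [abs_pow]; exact pow_le_one₀ (abs_nonneg _) (abs_le.2 h2)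
          rw [← sq_abs, abs_mul, sq]
          refine mul_le_mul ?_ (mul_le_of_le_one_left (abs_nonneg _) h3) (by positivity) hG
          exact (mul_le_of_le_one_left (abs_nonneg _) h3).trans (hKG _)
        · rw [hKs _ h2]; simp
    _ = G * ∑ t ∈ I, |K ((rt n t - τ) / b)| := by rw [Finset.mul_sum]
    _ ≤ G * (3 * G * (n * b)) := mul_le_mul_of_nonneg_left h1 hG
    _ = _ := by ring

variable [∀ n, IsProbabilityMeasure (μ n)] {A Sig : ∀ n, ℝ → Matrix (Fin (d n)) (Fin (d n)) ℝ}
  {ε : ∀ n, ℤ → Ω n → Fin (d n) → ℝ} {X : ∀ n, ℕ → Ω n → Fin (d n) → ℝ}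
  {ι₁ C₀ C₁ ρ CS M : ℝ}

/-- At level B√log(n∨d) the Gaussian-type tail is of order (n∨d)^(−cB²); B is chosen with cB² ≥ 4 to
survive the union bound. -/
theorem wpa1_abs_X_le (hVAR : ∀ᶠ n in atTop, IsTVVAR (μ n) n (A n) (Sig n) (ε n) (X n))
    (hreg : ∀ᶠ n in atTop, IsRegularVAR (μ n) n (A n) (Sig n) (ε n) ι₁ C₀ C₁ ρ CS M)
    (hι : 0 < ι₁) (hρ : 0 < ρ) (hρ1 : ρ < 1) :
    ∃ B : ℝ, 1 ≤ B ∧ WPA1 μ (fun n ω => ∀ t ≤ n, ∀ j, |X n t ω j| ≤ B * √(logND n (d n))) := by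
  set c := ι₁ * (1 - ρ) ^ 2 / ((max C₁ 1) ^ 2 * max CS 1) with hc
  have hc0 : 0 < c := by
    have : 0 < 1 - ρ := by linarith
    positivity
  refine ⟨4 / c + 1, by have : 0 < 4 / c := by positivity
                        linarith, ?_⟩
  have hB : 4 ≤ c * (4 / c + 1) ^ 2 := by
    have e : c * (4 / c + 1) ^ 2 = 4 * (4 / c) + 8 + c := by field_simp; ring
    have : 0 < 4 / c := by positivity
    rw [e]; linarith
  have := WPA1.forall_of_exp (μ := μ) (d := d) (D := max C₀ 0)
    (P := fun n i _ t _ ω => |X n t ω i| ≤ (4 / c + 1) * √(logND n (d n))) (le_max_right _ _) ?_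
  · exact this.mono (Eventually.of_forall fun n ω hω t ht j => hω j j t ht 0 (by norm_num))
  · filter_upwards [hVAR, hreg, (tendsto_logND d).eventually_ge_atTop 1] with n hV hR hL i _ t ht _ _
    have hC1 := hR.one_le_C₁ i
    have h1 := hR.lintegral_exp_X_le hV hι hρ hρ1 ht i
    rw [← max_eq_left hC1] at h1
    refine (measure_not_abs_le_of_sq (hV.aemeasurable ht i) hc0 (by positivity) h1).trans
      (ENNReal.ofReal_le_ofReal ?_)
    refine mul_le_mul (le_max_left _ _) (Real.exp_le_exp.2 ?_) (Real.exp_nonneg _) (le_max_right _ _)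
    rw [mul_pow, Real.sq_sqrt (by linarith), ← mul_assoc]
    exact neg_le_neg (mul_le_mul_of_nonneg_right hB (by linarith))

theorem wpa1_abs_innov_le (hVAR : ∀ᶠ n in atTop, IsTVVAR (μ n) n (A n) (Sig n) (ε n) (X n))
    (hreg : ∀ᶠ n in atTop, IsRegularVAR (μ n) n (A n) (Sig n) (ε n) ι₁ C₀ C₁ ρ CS M)
    (hι : 0 < ι₁) :
    ∃ B : ℝ, 1 ≤ B ∧ WPA1 μ (fun n ω => ∀ t ≤ n, ∀ j,
      |innov n (Sig n) (ε n) (t : ℤ) ω j| ≤ B * √(logND n (d n))) := by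
  set c := ι₁ / max CS 1 with hc
  have hc0 : 0 < c := by positivity
  refine ⟨4 / c + 1, by have : 0 < 4 / c := by positivity
                        linarith, ?_⟩
  have hB : 4 ≤ c * (4 / c + 1) ^ 2 := by
    have e : c * (4 / c + 1) ^ 2 = 4 * (4 / c) + 8 + c := by field_simp; ring
    have : 0 < 4 / c := by positivity
    rw [e]; linarith
  have := WPA1.forall_of_exp (μ := μ) (d := d) (D := max C₀ 0)
    (P := fun n i _ t _ ω => |innov n (Sig n) (ε n) (t : ℤ) ω i|
      ≤ (4 / c + 1) * √(logND n (d n))) (le_max_right _ _) ?_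
  · exact this.mono (Eventually.of_forall fun n ω hω t ht j => hω j j t ht 0 (by norm_num))
  · filter_upwards [hVAR, hreg, (tendsto_logND d).eventually_ge_atTop 1] with n hV hR hL i _ t ht _ _
    have h1 := hR.lintegral_exp_innov_le hι i (int_div_le_one (t := (t : ℤ)) (by exact_mod_cast ht))
    refine (measure_not_abs_le_of_sq (hV.measurable_innov _ i).aemeasurable hc0 (by positivity)
      h1).trans (ENNReal.ofReal_le_ofReal ?_)
    refine mul_le_mul (le_max_left _ _) (Real.exp_le_exp.2 ?_) (Real.exp_nonneg _) (le_max_right _ _)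
    rw [mul_pow, Real.sq_sqrt (by linarith), ← mul_assoc]
    exact neg_le_neg (mul_le_mul_of_nonneg_right hB (by linarith))

/-- The local scores are uniformly of order `log (n ∨ d) / √(n h)`. -/
theorem wpa1_abs_score_le (hVAR : ∀ᶠ n in atTop, IsTVVAR (μ n) n (A n) (Sig n) (ε n) (X n))
    (hreg : ∀ᶠ n in atTop, IsRegularVAR (μ n) n (A n) (Sig n) (ε n) ι₁ C₀ C₁ ρ CS M)
    (hι : 0 < ι₁) (hρ : 0 < ρ) (hρ1 : ρ < 1) {K : ℝ → ℝ} (hK : IsKernel K) {h : ℕ → ℝ}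
    (hh : ∀ᶠ n in atTop, 0 < h n) (hnh : ∀ᶠ n : ℕ in atTop, 1 ≤ n * h n) :
    ∃ B : ℝ, 1 ≤ B ∧ WPA1 μ (fun n ω => ∀ i j, ∀ r ≤ n, ∀ k < 2,
      |∑ t ∈ Finset.Icc 2 n, kwt n K (h n) (rt n r) t * ((rt n t - rt n r) / h n) ^ k *
        X n (t - 1) ω j * innov n (Sig n) (ε n) (t : ℤ) ω i|
      ≤ B * (logND n (d n) / √(n * h n))) := by
  obtain ⟨B₀, hB₀, hX⟩ := wpa1_abs_X_le hVAR hreg hι hρ hρ1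
  obtain ⟨G, hG, hKG⟩ := hK.exists_bound
  set v := 4 * (8 * (max C₀ 1) / (ι₁ / max CS 1)) * B₀ ^ 2 * (3 * G ^ 2) with hv
  have hv0 : 0 < v := by positivity
  -- This gives B² ≥ 4v, so that the Chernoff exponent is at least 4 log(n∨d). The truncation level
  -- contributes the logarithm by which the score exceeds √log(n∨d)/√(nh).
  set B := 4 * v + 1 with hB
  have hB1 : 1 ≤ B := by linarith
  refine ⟨B, hB1, ?_⟩
  have key := WPA1.forall_of_exp (μ := μ) (d := d) (D := 2)
    (P := fun n i j r k ω => |∑ t ∈ Finset.Icc 2 n,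
      (kwt n K (h n) (rt n r) t * ((rt n t - rt n r) / h n) ^ k) *
        max (-(B₀ * √(logND n (d n)))) (min (B₀ * √(logND n (d n))) (X n (t - 1) ω j)) *
          innov n (Sig n) (ε n) (t : ℤ) ω i| ≤ B * (logND n (d n) / √(n * h n))) (by norm_num) ?_
  -- Where the lagged values respect their bound, the truncation is inactive.
  · refine (key.and hX).mono (Eventually.of_forall fun n ω hω i j r hr k hk => ?_)
    refine le_trans (le_of_eq ?_) (hω.1 i j r hr k hk)
    congr 1
    refine Finset.sum_congr rfl fun t ht => ?_
    have h1 := abs_le.1 (hω.2 (t - 1) (by have := (Finset.mem_Icc.1 ht).2; omega) j)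
    rw [min_eq_right h1.2, max_eq_right h1.1]
  · filter_upwards [hVAR, hreg, hh, hnh, (tendsto_logND d).eventually_ge_atTop 1]
      with n hV hR hhn hnhn hL i j r hr k hk
    set L := logND n (d n) with hLd
    have hL0 : 0 < L := by linarith
    have hC0 := hR.one_le_C₀ hι i
    have hnh0 : 0 < n * h n := by linarith
    have hn : (0 : ℝ) < n := by
      by_contra! hc
      nlinarith [mul_nonpos_of_nonpos_of_nonneg hc hhn.le]
    have hw : ∑ t ∈ Finset.Icc 2 n, (kwt n K (h n) (rt n r) t * ((rt n t - rt n r) / h n) ^ k) ^ 2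
        ≤ 3 * G ^ 2 / (n * h n) := by
      have h1 := sum_sq_kernel_le hKG hK.supp hhn hnhn (rt n r) (Finset.Icc 2 n) k
      have e1 : ∑ t ∈ Finset.Icc 2 n,
          (kwt n K (h n) (rt n r) t * ((rt n t - rt n r) / h n) ^ k) ^ 2
          = (∑ t ∈ Finset.Icc 2 n, (((rt n t - rt n r) / h n) ^ k *
              K ((rt n t - rt n r) / h n)) ^ 2) / (n * h n) ^ 2 := by
        rw [Finset.sum_div]
        refine Finset.sum_congr rfl fun t _ => ?_
        rw [kwt, Kh, ← div_pow]
        congr 1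
        field_simp
      rw [e1, div_le_div_iff₀ (by positivity) hnh0]
      nlinarith
    have h2 := hR.score_tail hV hι i j _ (x := B * (L / √(n * h n))) (by positivity) hw
      (by positivity : 0 < B₀ * √L) (by positivity)
    refine h2.trans (ENNReal.ofReal_le_ofReal ?_)
    refine mul_le_mul_of_nonneg_left (Real.exp_le_exp.2 (neg_le_neg ?_)) (by norm_num)
    rw [le_div_iff₀ (by positivity)]
    have e2 : (B * (L / √(n * h n))) ^ 2 = B ^ 2 * L ^ 2 / (n * h n) := by
      rw [mul_pow, div_pow, Real.sq_sqrt hnh0.le]; ring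
    have e3 : 4 * L * (4 * (8 * C₀ / (ι₁ / max CS 1)) * (B₀ * √L) ^ 2 * (3 * G ^ 2 / (n * h n)))
        = 4 * v * L ^ 2 / (n * h n) := by
      rw [hv, max_eq_left hC0, mul_pow, Real.sq_sqrt hL0.le]; ring
    rw [e2, e3]
    gcongr
    nlinarith

/-- The kernel-weighted empirical covariances of the innovations concentrate at the rate
`√(n b log (n ∨ d))`, at the grid points. -/
theorem wpa1_abs_cov_le (hVAR : ∀ᶠ n in atTop, IsTVVAR (μ n) n (A n) (Sig n) (ε n) (X n))
    (hreg : ∀ᶠ n in atTop, IsRegularVAR (μ n) n (A n) (Sig n) (ε n) ι₁ C₀ C₁ ρ CS M)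
    (hι : 0 < ι₁) {K : ℝ → ℝ} (hK : IsKernel K) {b : ℕ → ℝ}
    (hb : ∀ᶠ n in atTop, 0 < b n) (hnb : ∀ᶠ n : ℕ in atTop, 1 ≤ n * b n)
    (hLb : Tendsto (fun n : ℕ => logND n (d n) / (n * b n)) atTop (𝓝 0)) :
    ∃ B : ℝ, 1 ≤ B ∧ WPA1 μ (fun n ω => ∀ i j, ∀ r ≤ n, ∀ k < 2,
      |∑ t ∈ Finset.Icc 2 n, ((rt n t - rt n r) / b n) ^ k * K ((rt n t - rt n r) / b n) *
        (innov n (Sig n) (ε n) (t : ℤ) ω i * innov n (Sig n) (ε n) (t : ℤ) ω j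
          - Sig n (rt n t) i j)|
      ≤ B * √(n * b n * logND n (d n))) := by
  obtain ⟨G, hG, hKG⟩ := hK.exists_bound
  set c := ι₁ / max CS 1 with hc
  have hc0 : 0 < c := by positivity
  set V := 8 * (Real.exp ι₁ * max C₀ 1) / c ^ 2 with hV
  have hV0 : 0 < V := by positivity
  -- With θ = √(L/(nb)) the Chernoff exponent is 3VG²L − (3VG² + 4)L = −4L; this θ is eventually
  -- admissible because L/(nb) → 0.
  refine ⟨V * (3 * G ^ 2) + 4, by nlinarith [mul_pos hV0 (pow_pos hG 2)], ?_⟩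
  refine WPA1.forall_of_exp (D := 2) (by norm_num) ?_
  have hθ : ∀ᶠ n : ℕ in atTop, √(logND n (d n) / (n * b n)) * G ≤ c / 2 := by
    have h1 : Tendsto (fun n : ℕ => √(logND n (d n) / (n * b n)) * G) atTop (𝓝 (√0 * G)) :=
      (hLb.sqrt).mul_const G
    rw [Real.sqrt_zero, zero_mul] at h1
    exact h1.eventually_le_const (by positivity)
  filter_upwards [hVAR, hreg, hb, hnb, hθ, (tendsto_logND d).eventually_ge_atTop 1]
    with n hVn hR hbn hnbn hθn hL i j r hr k hk
  set L := logND n (d n) with hLd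
  have hL0 : 0 < L := by linarith
  have hC0 := hR.one_le_C₀ hι i
  have hnb0 : 0 < n * b n := by linarith
  have hwG : ∀ t, |((rt n t - rt n r) / b n) ^ k * K ((rt n t - rt n r) / b n)| ≤ G := fun t => by
    by_cases h2 : (rt n t - rt n r) / b n ∈ Icc (-1 : ℝ) 1
    · rw [abs_mul, abs_pow]
      exact (mul_le_of_le_one_left (abs_nonneg _)
        (pow_le_one₀ (abs_nonneg _) (abs_le.2 h2))).trans (hKG _)
    · rw [hK.supp _ h2, mul_zero, abs_zero]; exact hG.le
  refine (hR.cov_tail hVn hι i j _ (sum_sq_kernel_le hKG hK.supp hbn hnbn (rt n r)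
    (Finset.Icc 2 n) k) hwG (θ := √(L / (n * b n))) (by positivity) hθn).trans
      (ENNReal.ofReal_le_ofReal ?_)
  refine mul_le_mul_of_nonneg_left (Real.exp_le_exp.2 ?_) (by norm_num)
  have e1 : √(L / (n * b n)) ^ 2 * (n * b n) = L := by
    rw [Real.sq_sqrt (by positivity), div_mul_cancel₀ _ hnb0.ne']
  have e2 : √(L / (n * b n)) * √(n * b n * L) = L := by
    rw [← Real.sqrt_mul (by positivity)]
    have : L / (n * b n) * (n * b n * L) = L ^ 2 := by
      rw [← mul_assoc, div_mul_cancel₀ _ hnb0.ne', sq]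
    rw [this, Real.sqrt_sq hL0.le]
  have e3 : 8 * (Real.exp ι₁ * C₀) / (ι₁ / max CS 1) ^ 2 = V := by
    rw [hV, max_eq_left hC0, hc]
  rw [e3]
  have e4 : V * √(L / (n * b n)) ^ 2 * (3 * G ^ 2 * (n * b n))
      - √(L / (n * b n)) * ((V * (3 * G ^ 2) + 4) * √(n * b n * L))
      = V * (3 * G ^ 2) * (√(L / (n * b n)) ^ 2 * (n * b n))
        - (V * (3 * G ^ 2) + 4) * (√(L / (n * b n)) * √(n * b n * L)) := by ring
  rw [e4, e1, e2]
  linarith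

end Events


/-! ### Consequences of the rate conditions. -/

section Asymptotics

variable {Ω : ℕ → Type*} [∀ n, MeasurableSpace (Ω n)] {μ : ∀ n, Measure (Ω n)}
  {d : ℕ → ℕ} {A Sig : ∀ n, ℝ → Matrix (Fin (d n)) (Fin (d n)) ℝ}
  {ε : ∀ n, ℤ → Ω n → Fin (d n) → ℝ} {X Xhat : ∀ n, ℕ → Ω n → Fin (d n) → ℝ}
  {K : ℝ → ℝ} {h lam1 : ℕ → ℝ} {ι₁ C₀ C₁ ρ CS M : ℝ}

theorem deltaX_nonneg {Ω : Type*} {n d : ℕ} (X Xhat : ℕ → Ω → Fin d → ℝ) (ω : Ω) :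
    0 ≤ deltaX n X Xhat ω :=
  Real.iSup_nonneg fun _ => abs_nonneg _

theorem abs_sub_le_deltaX {Ω : Type*} {n d : ℕ} (X Xhat : ℕ → Ω → Fin d → ℝ) (ω : Ω) {t : ℕ}
    (ht : t ∈ Finset.Icc 1 n) (j : Fin d) : |Xhat t ω j - X t ω j| ≤ deltaX n X Xhat ω :=
  le_ciSup (f := fun p : Grid n × Fin d => |Xhat p.1 ω p.2 - X p.1 ω p.2|)
    (Set.finite_range _).bddAbove (⟨t, ht⟩, j)

theorem zetaDag_eq_rate {Ω : Type*} {n d : ℕ} (A : ℝ → Matrix (Fin d) (Fin d) ℝ) (h : ℝ)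
    (X Xhat : ℕ → Ω → Fin d → ℝ) (ω : Ω) :
    zetaDag n A h X Xhat ω = RegPath.rate n A h (logND n d) (deltaX n X Xhat ω) := rfl

/-- Positivity of h comes from nh/L² → ∞, and h ≤ 1 from s h² L → 0 with s, L ≥ 1. -/
theorem eventually_bandwidth
    (hh1 : Tendsto (fun n : ℕ => n * h n / logND n (d n) ^ 2) atTop atTop)
    (hh2 : Tendsto (fun n : ℕ => sparsity n (A n) * h n ^ 2 * logND n (d n)) atTop (𝓝 0))
    (hs1 : ∀ᶠ n in atTop, 1 ≤ sparsity n (A n)) :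
    ∀ᶠ n : ℕ in atTop, 1 ≤ logND n (d n) ∧ 0 < h n ∧ h n ≤ 1 ∧ logND n (d n) ^ 2 ≤ n * h n := by
  filter_upwards [(tendsto_logND d).eventually_ge_atTop 1, hh1.eventually_ge_atTop 1,
    hh2.eventually_le_const one_pos, hs1] with n hL h1 h2 hs
  have hs' : (1 : ℝ) ≤ sparsity n (A n) := by exact_mod_cast hs
  rw [one_le_div (by positivity)] at h1
  have h3 : 0 < n * h n := lt_of_lt_of_le (by positivity) h1
  have hpos : 0 < h n := by
    by_contra! hc
    have := mul_nonpos_of_nonneg_of_nonpos (Nat.cast_nonneg (α := ℝ) n) hc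
    linarith
  refine ⟨hL, hpos, ?_, h1⟩
  have h4 : h n ^ 2 ≤ sparsity n (A n) * h n ^ 2 * logND n (d n) := by
    have : (1 : ℝ) * 1 ≤ sparsity n (A n) * logND n (d n) := by gcongr
    nlinarith [sq_nonneg (h n)]
  by_contra! hc
  nlinarith

/-- The transition matrix is the first Wold coefficient, so the decay condition bounds it. -/
theorem abs_A_le {Ω : Type*} [MeasurableSpace Ω] {μ : Measure Ω} {d n : ℕ}
    {A Sig : ℝ → Matrix (Fin d) (Fin d) ℝ} {ε : ℤ → Ω → Fin d → ℝ}
    (hR : IsRegularVAR μ n A Sig ε ι₁ C₀ C₁ ρ CS M) {t : ℕ} (ht : t ≤ n) (i j : Fin d) :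
    |A (rt n t) i j| ≤ C₁ * ρ := by
  have h1 := hR.decay t ht 1
  have e1 : Phi n A t 1 = A (rt n t) := by simp [Phi, rt]
  rw [e1, pow_one] at h1
  exact (abs_entry_le_opNorm _ i j).trans h1

/-- With probability tending to one all stochastic terms obey their bounds. -/
theorem exists_wpa1_regPath [∀ n, IsProbabilityMeasure (μ n)]
    (hVAR : ∀ᶠ n in atTop, IsTVVAR (μ n) n (A n) (Sig n) (ε n) (X n))
    (hreg : ∀ᶠ n in atTop, IsRegularVAR (μ n) n (A n) (Sig n) (ε n) ι₁ C₀ C₁ ρ CS M)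
    (hι : 0 < ι₁) (hρ : 0 < ρ) (hρ1 : ρ < 1) (hK : IsKernel K)
    (hh1 : Tendsto (fun n : ℕ => n * h n / logND n (d n) ^ 2) atTop atTop)
    (hh2 : Tendsto (fun n : ℕ => sparsity n (A n) * h n ^ 2 * logND n (d n)) atTop (𝓝 0))
    (hs1 : ∀ᶠ n in atTop, 1 ≤ sparsity n (A n))
    (hdelta : SmallOP μ (fun n ω =>
      √(logND n (d n)) * sparsity n (A n) * deltaX n (X n) (Xhat n) ω) (fun _ => 1)) :
    ∃ B M' G a : ℝ, WPA1 μ (fun n ω => RegPath n (A n) K (h n) (logND n (d n))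
      (deltaX n (X n) (Xhat n) ω) B M' G a (fun t => X n t ω) (fun t => Xhat n t ω)
      (fun t => innov n (Sig n) (ε n) (t : ℤ) ω)) := by
  have hband := eventually_bandwidth hh1 hh2 hs1
  obtain ⟨B₁, hB₁, hX⟩ := wpa1_abs_X_le hVAR hreg hι hρ hρ1
  obtain ⟨B₂, hB₂, hE⟩ := wpa1_abs_innov_le hVAR hreg hι
  obtain ⟨B₃, hB₃, hS⟩ := wpa1_abs_score_le hVAR hreg hι hρ hρ1 hK (h := h)
    (hband.mono fun n hn => hn.2.1) (hband.mono fun n hn => by nlinarith [hn.1, hn.2.2.2])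
  obtain ⟨G, hG, hKG⟩ := hK.exists_bound
  have hrec : WPA1 μ (fun n ω => ∀ t, 1 ≤ t → t ≤ n →
      X n t ω = A n (rt n t) *ᵥ X n (t - 1) ω + innov n (Sig n) (ε n) t ω) :=
    WPA1.of_ae (hVAR.mono fun n hV => by
      rw [ae_all_iff]
      intro t
      by_cases ht : 1 ≤ t ∧ t ≤ n
      · filter_upwards [hV.recursion t ht.1 ht.2] with ω hω _ _ using hω
      · exact Eventually.of_forall fun ω h1 h2 => absurd ⟨h1, h2⟩ ht)
  refine ⟨max B₁ (max B₂ B₃), max M 0, G, |C₁ * ρ|, ?_⟩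
  refine ((((hX.and hE).and hS).and hrec).and (hdelta 1 one_pos)).mono ?_
  filter_upwards [hband, hreg, hs1] with n hn hR hs ω hω
  obtain ⟨⟨⟨⟨hXω, hEω⟩, hSω⟩, hrecω⟩, hδω⟩ := hω
  obtain ⟨hL, hh0, hhle, hLnh⟩ := hn
  have hs' : (1 : ℝ) ≤ sparsity n (A n) := by exact_mod_cast hs
  have hδ0 := deltaX_nonneg (n := n) (X n) (Xhat n) ω
  have hLs : 1 ≤ √(logND n (d n)) := Real.one_le_sqrt.2 hL
  refine
    { one_le_s := hs
      h_pos := hh0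
      h_le := hhle
      one_le_nh := by nlinarith
      one_le_L := hL
      one_le_B := hB₁.trans (le_max_left _ _)
      a_nonneg := abs_nonneg _
      M_nonneg := le_max_right _ _
      K_le := hKG
      K_nonneg := hK.nonneg
      K_supp := hK.supp
      smooth := hR.smoothA
      bound := fun i j τ hτ => (hR.boundA i j τ hτ).trans (le_max_left _ _)
      A_le := fun t ht i j => (abs_A_le hR (Finset.mem_Icc.1 ht).2 i j).trans (le_abs_self _)
      x_le := fun t ht j => (hXω t ht j).trans ?_
      e_le := fun t ht j => (hEω t (Finset.mem_Icc.1 ht).2 j).trans ?_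
      recursion := fun t ht i => ?_
      δ_nonneg := hδ0
      δ_le := ?_
      xhat_le := fun t ht j => abs_sub_le_deltaX _ _ ω ht j
      score_le := fun i j r hr k hk => (hSω i j r (Finset.mem_Icc.1 hr).2 k hk).trans ?_ }
  · exact mul_le_mul_of_nonneg_right (le_max_left _ _) (Real.sqrt_nonneg _)
  · exact mul_le_mul_of_nonneg_right ((le_max_left _ _).trans (le_max_right _ _))
      (Real.sqrt_nonneg _)
  · have ht' := Finset.mem_Icc.1 ht
    exact congrFun (hrecω t ht'.1 ht'.2) i
  · have h1 : (1 : ℝ) * 1 ≤ √(logND n (d n)) * sparsity n (A n) := by gcongr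
    have h2 := (le_abs_self _).trans hδω
    nlinarith
  · exact mul_le_mul_of_nonneg_right ((le_max_right _ _).trans (le_max_right _ _)) (by positivity)

/-- The first tuning parameter dominates the rate `ζ`. -/
theorem eventually_zeta_le [∀ n, IsProbabilityMeasure (μ n)]
    (hlam1 : SmallOP μ (fun n ω => zetaDag n (A n) (h n) (X n) (Xhat n) ω) lam1) {η : ℝ}
    (hη : 0 < η) : ∀ᶠ n in atTop, zeta n (A n) (h n) ≤ η * lam1 n := by
  -- Since ζ is not random, a single outcome at which ζ† is small enough suffices.
  filter_upwards [(hlam1 η hη).exists] with n ⟨ω, hω⟩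
  refine le_trans ?_ ((le_abs_self _).trans hω)
  rw [zetaDag]
  have := deltaX_nonneg (n := n) (X n) (Xhat n) ω
  have : 0 ≤ √(logND n (d n)) * sparsity n (A n) * deltaX n (X n) (Xhat n) ω := by positivity
  linarith

theorem zeta_ge {d n : ℕ} {A : ℝ → Matrix (Fin d) (Fin d) ℝ} {h : ℝ} (hL : 0 ≤ logND n d) :
    logND n d / √(n * h) ≤ zeta n A h := by
  rw [zeta, mul_add, mul_one_div]
  have : 0 ≤ logND n d * (sparsity n A * h ^ 2) := by positivity
  linarith

/-- The parameter λ₁ dominates ζ ≥ L/√(nh) > 0. -/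
theorem eventually_lam1_pos [∀ n, IsProbabilityMeasure (μ n)]
    (hh1 : Tendsto (fun n : ℕ => n * h n / logND n (d n) ^ 2) atTop atTop)
    (hh2 : Tendsto (fun n : ℕ => sparsity n (A n) * h n ^ 2 * logND n (d n)) atTop (𝓝 0))
    (hs1 : ∀ᶠ n in atTop, 1 ≤ sparsity n (A n))
    (hlam1 : SmallOP μ (fun n ω => zetaDag n (A n) (h n) (X n) (Xhat n) ω) lam1) :
    ∀ᶠ n in atTop, 0 < lam1 n := by
  filter_upwards [eventually_bandwidth hh1 hh2 hs1, eventually_zeta_le hlam1 one_pos]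
    with n ⟨hL, hh0, _, hLnh⟩ hz
  have h1 := (zeta_ge (A := A n) (h := h n) (by linarith : 0 ≤ logND n (d n))).trans hz
  have h2 : 0 < n * h n := lt_of_lt_of_le (by positivity) hLnh
  have h3 : 0 < logND n (d n) / √(n * h n) := by positivity
  linarith

/-- The chain sL/(nh) ≤ s(L/√(nh))² ≤ sζ² ≤ sλ₁² ≤ (√s λ₁/h)² uses L ≥ 1 and h ≤ 1. It disposes of
the part of the Gram error due to the time t = 1. -/
theorem tendsto_sparsity_mul_log_div [∀ n, IsProbabilityMeasure (μ n)]
    (hh1 : Tendsto (fun n : ℕ => n * h n / logND n (d n) ^ 2) atTop atTop)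
    (hh2 : Tendsto (fun n : ℕ => sparsity n (A n) * h n ^ 2 * logND n (d n)) atTop (𝓝 0))
    (hs1 : ∀ᶠ n in atTop, 1 ≤ sparsity n (A n))
    (hlam1 : SmallOP μ (fun n ω => zetaDag n (A n) (h n) (X n) (Xhat n) ω) lam1)
    (hlam1' : Tendsto (fun n => √(sparsity n (A n)) * lam1 n / h n) atTop (𝓝 0)) :
    Tendsto (fun n : ℕ => sparsity n (A n) * (logND n (d n) / (n * h n))) atTop (𝓝 0) := by
  have h0 : Tendsto (fun n => (√(sparsity n (A n)) * lam1 n / h n) ^ 2) atTop (𝓝 0) := by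
    simpa using hlam1'.pow 2
  refine squeeze_zero' ?_ ?_ h0
  · filter_upwards [eventually_bandwidth hh1 hh2 hs1] with n ⟨hL, hh0, _, hLnh⟩
    positivity
  · filter_upwards [eventually_bandwidth hh1 hh2 hs1, eventually_zeta_le hlam1 one_pos]
      with n ⟨hL, hh0, hhle, hLnh⟩ hz
    set L := logND n (d n)
    have h1 := (zeta_ge (A := A n) (h := h n) (by linarith : 0 ≤ logND n (d n))).trans hz
    have h2 : 0 < n * h n := lt_of_lt_of_le (by positivity) hLnh
    have h3 : (L / √(n * h n)) ^ 2 ≤ lam1 n ^ 2 := by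
      rw [one_mul] at h1
      exact pow_le_pow_left₀ (by positivity) h1 2
    rw [div_pow, Real.sq_sqrt h2.le] at h3
    have h4 : L / (n * h n) ≤ L ^ 2 / (n * h n) := by
      gcongr; nlinarith
    have h5 : lam1 n ^ 2 ≤ (lam1 n / h n) ^ 2 := by
      rw [div_pow, le_div_iff₀ (by positivity)]
      have : h n ^ 2 ≤ 1 := pow_le_one₀ hh0.le hhle
      nlinarith [sq_nonneg (lam1 n)]
    rw [mul_div_assoc, mul_pow, Real.sq_sqrt (Nat.cast_nonneg _)]
    exact mul_le_mul_of_nonneg_left (h4.trans (h3.trans h5)) (Nat.cast_nonneg _)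

/-- The error of the estimated Gram matrix is negligible. -/
theorem wpa1_gramErr_le
    (hdelta : SmallOP μ (fun n ω =>
      √(logND n (d n)) * sparsity n (A n) * deltaX n (X n) (Xhat n) ω) (fun _ => 1))
    (hsL : Tendsto (fun n : ℕ => sparsity n (A n) * (logND n (d n) / (n * h n))) atTop (𝓝 0))
    {B G c : ℝ} (hB : 0 ≤ B) (hG : 0 ≤ G) (hc : 0 < c) :
    WPA1 μ (fun n ω => 18 * sparsity n (A n) *
      RegPath.gramErr n (h n) (logND n (d n)) (deltaX n (X n) (Xhat n) ω) B G ≤ c) := by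
  set D := 18 * 9 * G * B + 18 * G * B ^ 2 + 1 with hD
  have hD0 : 0 < D := by positivity
  have h1 : 0 < c / (2 * D) := by positivity
  refine (hdelta _ h1).mono ?_
  filter_upwards [hsL.eventually_le_const h1] with n hn ω hω
  have h2 := (le_abs_self _).trans hω
  rw [mul_one] at h2
  rw [RegPath.gramErr]
  have e1 : 18 * (sparsity n (A n) : ℝ) * (9 * G * B * (√(logND n (d n)) *
        deltaX n (X n) (Xhat n) ω) + G * B ^ 2 * (logND n (d n) / (n * h n)))
      = 18 * 9 * G * B * (√(logND n (d n)) * sparsity n (A n) * deltaX n (X n) (Xhat n) ω)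
        + 18 * G * B ^ 2 * (sparsity n (A n) * (logND n (d n) / (n * h n))) := by ring
  rw [e1]
  have k1 : 18 * 9 * G * B * (√(logND n (d n)) * sparsity n (A n) * deltaX n (X n) (Xhat n) ω)
      ≤ D * (c / (2 * D)) := by
    refine (mul_le_mul_of_nonneg_left h2 (by positivity)).trans
      (mul_le_mul_of_nonneg_right ?_ h1.le)
    have : 0 ≤ 18 * G * B ^ 2 := by positivity
    linarith
  have k2 : 18 * G * B ^ 2 * (sparsity n (A n) * (logND n (d n) / (n * h n)))
      ≤ D * (c / (2 * D)) := by
    refine (mul_le_mul_of_nonneg_left hn (by positivity)).trans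
      (mul_le_mul_of_nonneg_right ?_ h1.le)
    have : 0 ≤ 18 * 9 * G * B := by positivity
    linarith
  have k3 : D * (c / (2 * D)) = c / 2 := by field_simp
  linarith

end Asymptotics


/-! ### The three estimation stages with probability tending to one. -/

section Stages

variable {Ω : ℕ → Type*} [∀ n, MeasurableSpace (Ω n)] {μ : ∀ n, Measure (Ω n)}
  [∀ n, IsProbabilityMeasure (μ n)]
  {d : ℕ → ℕ} {A Sig : ∀ n, ℝ → Matrix (Fin (d n)) (Fin (d n)) ℝ}
  {ε : ∀ n, ℤ → Ω n → Fin (d n) → ℝ} {X Xhat : ∀ n, ℕ → Ω n → Fin (d n) → ℝ}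
  {K : ℝ → ℝ} {h lam1 : ℕ → ℝ} {ι₁ C₀ C₁ ρ CS M : ℝ} {B M' G a : ℝ}
  {e : ∀ n, Ω n → ℕ → Fin (d n) → ℝ}

/-- Uniform rate of the time-varying LASSO. -/
theorem wpa1_lasso_rate
    (hP : WPA1 μ (fun n ω => RegPath n (A n) K (h n) (logND n (d n))
      (deltaX n (X n) (Xhat n) ω) B M' G a (fun t => X n t ω) (fun t => Xhat n t ω) (e n ω)))
    {κ : ℝ} (hκ : 0 < κ) (hRE : WPA1 μ (fun n ω => ∀ i, ∀ t : Grid n,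
      ∀ u ∈ Cone (JLoc (A n) i (rt n t)) (JLoc' (A n) i (rt n t)),
        κ ≤ u ⬝ᵥ (Psi n K (h n) (fun r => X n r ω) (rt n t) *ᵥ u)))
    (hgram : WPA1 μ (fun n ω => 18 * sparsity n (A n) *
      RegPath.gramErr n (h n) (logND n (d n)) (deltaX n (X n) (Xhat n) ω) B G ≤ κ / 2))
    (hlam0 : ∀ᶠ n in atTop, 0 < lam1 n)
    (hlam1 : SmallOP μ (fun n ω => zetaDag n (A n) (h n) (X n) (Xhat n) ω) lam1)
    {atil btil : ∀ n, Ω n → Fin (d n) → Grid n → Fin (d n) → ℝ}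
    (hlasso : ∀ᶠ n in atTop, ∀ ω,
      IsLasso n K (h n) (lam1 n) (fun t => Xhat n t ω) (atil n ω) (btil n ω)) :
    ∃ C : ℝ, 0 < C ∧ WPA1 μ (fun n ω => ∀ i, ∀ t : Grid n,
      ∑ j, (atil n ω i t j - A n (rt n t) i j) ^ 2 ≤ C * (sparsity n (A n) * lam1 n ^ 2)) := by
  -- The constants of `RegPath` depend neither on n nor on ω, so one good path reveals their signs.
  obtain ⟨n₀, ω₀, P₀⟩ := hP.exists.exists
  have hc := P₀.scoreConst_pos
  set c := RegPath.scoreConst B M' G a with hcd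
  refine ⟨2 * (4 / 3) ^ 2 / (κ / 2) ^ 2, by positivity, ?_⟩
  refine (((hP.and hRE).and hgram).and (hlam1 (1 / (6 * c)) (by positivity))).mono ?_
  filter_upwards [hlam0, hlasso] with n hl0 hl ω ⟨⟨⟨P, hREω⟩, hgω⟩, hlω⟩ i t
  have hs := (le_abs_self _).trans hlω
  rw [zetaDag_eq_rate] at hs
  have hs' : c * RegPath.rate n (A n) (h n) (logND n (d n)) (deltaX n (X n) (Xhat n) ω)
      ≤ lam1 n / 6 := by
    refine (mul_le_mul_of_nonneg_left hs hc.le).trans (le_of_eq ?_)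
    field_simp
  refine (P.lasso_rate hκ hl0 hREω hgω hs' (hl ω) i t).trans (le_of_eq ?_)
  ring

set_option maxHeartbeats 1000000 in
/-- The oracle property of the weighted group LASSO, with the rates of the oracle estimate. -/
theorem wpa1_oracle
    (hP : WPA1 μ (fun n ω => RegPath n (A n) K (h n) (logND n (d n))
      (deltaX n (X n) (Xhat n) ω) B M' G a (fun t => X n t ω) (fun t => Xhat n t ω) (e n ω)))
    {κ : ℝ} (hκ : 0 < κ) (hSE : WPA1 μ (fun n ω => ∀ i, ∀ t : Grid n,
      ∀ u ∈ SuppSphere (J n (A n) i) (J' n (A n) i),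
        κ ≤ u ⬝ᵥ (Psi n K (h n) (fun r => X n r ω) (rt n t) *ᵥ u)))
    (hgram : WPA1 μ (fun n ω => 18 * sparsity n (A n) *
      RegPath.gramErr n (h n) (logND n (d n)) (deltaX n (X n) (Xhat n) ω) B G ≤ κ / 2))
    (hlam0 : ∀ᶠ n in atTop, 0 < lam1 n)
    {atil : ∀ n, Ω n → Fin (d n) → Grid n → Fin (d n) → ℝ} {C : ℝ} (hC : 0 < C)
    (hpre : WPA1 μ (fun n ω => ∀ i, ∀ t : Grid n,
      ∑ j, (atil n ω i t j - A n (rt n t) i j) ^ 2 ≤ C * (sparsity n (A n) * lam1 n ^ 2)))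
    {lam2 : ℕ → ℝ}
    (hlam2 : SmallOP μ (fun n ω =>
        √n * sparsity n (A n) * logND n (d n) * zetaDag n (A n) (h n) (X n) (Xhat n) ω
          + √(n * sparsity n (A n)) * lam1 n) lam2)
    (hsig : ∀ᶠ n in atTop, ∀ i,
        (∀ j ∈ J n (A n) i,
          (scadA + 1) * lam2 n ≤ l2 fun t : Grid n => A n (rt n t) i j) ∧
        ∀ j ∈ J' n (A n) i,
          (scadA + 1) * lam2 n ≤ devNorm fun t : Grid n => A n (rt n t) i j) :
    ∃ c : ℝ, 0 < c ∧ WPA1 μ (fun n ω => ∀ i, ∃ p,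
      (∀ p', IsMinimiser
        (groupObj n K (h n) (lam2 n) (fun t => Xhat n t ω) (atil n ω i) i) univ p' ↔ p' = p) ∧
      (∀ p', IsMinimiser
        (groupObj n K (h n) (lam2 n) (fun t => Xhat n t ω) (atil n ω i) i)
          (oracleClass n (A n) i) p' ↔ p' = p) ∧
      (∀ t : Grid n, ∑ j, (p.1 t j - A n (rt n t) i j) ^ 2
        ≤ c * (sparsity n (A n) * zetaDag n (A n) (h n) (X n) (Xhat n) ω ^ 2)) ∧
      ∀ t : Grid n, ∑ j, |p.1 t j - A n (rt n t) i j|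
        ≤ c * (sparsity n (A n) * zetaDag n (A n) (h n) (X n) (Xhat n) ω)) := by
  obtain ⟨n₀, ω₀, P₀⟩ := hP.exists.exists
  have hc := P₀.scoreConst_pos
  have hG := P₀.G_nonneg
  have hM0 := P₀.M_nonneg
  set c := RegPath.scoreConst B M' G a with hcd
  set E := 2 * c * (1 + 12 * G * B ^ 2 * (2 / (κ / 2))) with hE
  have hE0 : 0 ≤ E := by positivity
  -- Small enough for three requirements on λ₂ at once: the preliminary error, the strict domination
  -- of the oracle score, and the drift of order M'/√n of nearly constant coefficients.
  set η := 1 / (2 * (√C + E + M' + 1)) with hη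
  have hη0 : 0 < η := by positivity
  have hηe : (√C + E + M' + 1) * η = 1 / 2 := by rw [hη]; field_simp
  have hη1 : √C * η ≤ 1 / 2 := by nlinarith [Real.sqrt_nonneg C]
  have hη2 : E * η < 1 / 2 := by nlinarith [Real.sqrt_nonneg C]
  have hη3 : M' * η ≤ 1 / 2 := by nlinarith [Real.sqrt_nonneg C]
  refine ⟨2 * c ^ 2 / (κ / 2) ^ 2 + 2 * c / (κ / 2), by positivity, ?_⟩
  refine ((((hP.and hSE).and hgram).and hpre).and (hlam2 η hη0)).mono ?_
  filter_upwards [hlam0, hsig] with n hl0 hsg ω ⟨⟨⟨⟨P, hSEω⟩, hgω⟩, hpreω⟩, hlω⟩ i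
  set L := logND n (d n) with hL
  set δ := deltaX n (X n) (Xhat n) ω with hδ
  have hz0 := P.rate_nonneg
  rw [zetaDag_eq_rate] at hlω ⊢
  set ζ := RegPath.rate n (A n) (h n) L δ with hζ
  set s : ℝ := (sparsity n (A n) : ℝ) with hs
  have hs1 : 1 ≤ s := by rw [hs]; exact_mod_cast P.one_le_s
  have hL1 := P.one_le_L
  have hn1 : (1 : ℝ) ≤ n := by exact_mod_cast P.one_le_n
  have hsn : 1 ≤ √(n : ℝ) := Real.one_le_sqrt.2 hn1
  have hnn1 : 0 ≤ √n * s * L * ζ := by positivity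
  have hpos2 : 0 < √(n * s) * lam1 n := by positivity
  have hl := (le_abs_self _).trans hlω
  have hl1 : √n * s * L * ζ ≤ η * lam2 n := by linarith
  have hl2 : √(n * s) * lam1 n ≤ η * lam2 n := by linarith
  have hlam2pos : 0 < lam2 n := by
    by_contra! hcon
    nlinarith [mul_nonneg hη0.le (neg_nonneg.2 hcon)]
  -- From ζ† ≥ L/√(nh) with h ≤ 1 ≤ L. It gives ηλ₂ ≥ 1, which covers the drift of nearly constant
  -- coefficients.
  have hnz : 1 ≤ √n * ζ := by
    have h1 : L / √(n * h n) ≤ ζ := by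
      have : 0 ≤ L * (s * h n ^ 2) + √L * s * δ := by
        have := P.δ_nonneg
        positivity
      rw [hζ, RegPath.rate, mul_add, mul_one_div]
      linarith
    have h2 : √(n * h n) ≤ √n := Real.sqrt_le_sqrt (by nlinarith [P.h_le])
    have h3 : 0 < √(n * h n) := Real.sqrt_pos.2 (by linarith [P.one_le_nh])
    rw [div_le_iff₀ h3] at h1
    nlinarith
  have hone : 1 ≤ η * lam2 n := by
    refine le_trans ?_ hl1
    have : (1 : ℝ) * 1 * 1 ≤ (√n * ζ) * s * L := by gcongr
    linarith
  obtain ⟨p, h1, h2, h3, h4⟩ := P.oracle (lam := lam2 n) (r := √C * (√s * lam1 n)) hκ hlam2pos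
    hSEω hgω (pre := atil n ω) (by positivity)
    (fun i t => (hpreω i t).trans (le_of_eq (by
      rw [mul_pow, mul_pow, Real.sq_sqrt hC.le, Real.sq_sqrt (by linarith)])))
    (by
      have e1 : √n * (√C * (√s * lam1 n)) = √C * (√(n * s) * lam1 n) := by
        rw [Real.sqrt_mul (by linarith)]; ring
      rw [e1]
      nlinarith [mul_le_mul_of_nonneg_left hl2 (Real.sqrt_nonneg C)])
    (by
      have k1 : M' * 1 ≤ M' * (η * lam2 n) := mul_le_mul_of_nonneg_left hone hM0
      have k2 : M' * η * lam2 n ≤ 1 / 2 * lam2 n := mul_le_mul_of_nonneg_right hη3 hlam2pos.le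
      have k3 : 1 * (lam2 n / 2) ≤ √n * (lam2 n / 2) :=
        mul_le_mul_of_nonneg_right hsn (by linarith)
      linarith)
    hsg rfl
    (by
      have hγ : 0 ≤ c * ζ := by positivity
      have hsL : 1 ≤ s * L := one_le_mul_of_one_le_of_one_le hs1 hL1
      have k1 : 2 * (√n * (c * ζ + 12 * G * B ^ 2 * L * (2 * s * (c * ζ) / (κ / 2))))
          ≤ E * (√n * s * L * ζ) := by
        have e1 : E * (√n * s * L * ζ) = 2 * (√n * (c * ζ * (s * L) + 12 * G * B ^ 2 * L *
            (2 * s * (c * ζ) / (κ / 2)))) := by rw [hE]; ring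
        rw [e1]
        exact mul_le_mul_of_nonneg_left (mul_le_mul_of_nonneg_left
          (add_le_add (le_mul_of_one_le_right hγ hsL) le_rfl) (Real.sqrt_nonneg _)) (by norm_num)
      have k2 : E * (√n * s * L * ζ) ≤ E * (η * lam2 n) := mul_le_mul_of_nonneg_left hl1 hE0
      have k3 : E * η * lam2 n < 1 / 2 * lam2 n + lam2 n / 2 := by nlinarith
      rw [← hcd]
      linarith) i
  refine ⟨p, h1, h2, fun t => (h3 t).trans ?_, fun t => (h4 t).trans ?_⟩
  · have e1 : 2 * s * (RegPath.scoreConst B M' G a * ζ) ^ 2 / (κ / 2) ^ 2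
        = 2 * c ^ 2 / (κ / 2) ^ 2 * (s * ζ ^ 2) := by rw [← hcd]; ring
    rw [e1]
    refine mul_le_mul_of_nonneg_right ?_ (by positivity)
    have : 0 ≤ 2 * c / (κ / 2) := by positivity
    linarith
  · have e1 : 2 * s * (RegPath.scoreConst B M' G a * ζ) / (κ / 2)
        = 2 * c / (κ / 2) * (s * ζ) := by rw [← hcd]; ring
    rw [e1]
    refine mul_le_mul_of_nonneg_right ?_ (by positivity)
    have : 0 ≤ 2 * c ^ 2 / (κ / 2) ^ 2 := by positivity
    linarith

/-- Product rule for Lipschitz functions, both factors being bounded on [−1, 1]. -/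
theorem abs_mul_kernel_sub_le {LK G : ℝ} (hG : ∀ x, |K x| ≤ G)
    (hlip : ∀ x ∈ Icc (-1 : ℝ) 1, ∀ y ∈ Icc (-1 : ℝ) 1, |K x - K y| ≤ LK * |x - y|) {k : ℕ}
    (hk : k < 2) : ∀ x ∈ Icc (-1 : ℝ) 1, ∀ y ∈ Icc (-1 : ℝ) 1,
      |x ^ k * K x - y ^ k * K y| ≤ (LK + G) * |x - y| := by
  intro x hx y hy
  have hG0 : 0 ≤ G := (abs_nonneg _).trans (hG 0)
  have h1 := hlip x hx y hy
  interval_cases k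
  · simp only [pow_zero, one_mul]
    rw [add_mul]
    linarith [mul_nonneg hG0 (abs_nonneg (x - y))]
  · have e1 : x ^ 1 * K x - y ^ 1 * K y = x * (K x - K y) + K y * (x - y) := by ring
    rw [e1]
    refine (abs_add_le _ _).trans ?_
    rw [abs_mul, abs_mul, add_mul]
    refine add_le_add ?_ (mul_le_mul_of_nonneg_right (hG y) (abs_nonneg _))
    exact (mul_le_of_le_one_left (abs_nonneg _) (abs_le.2 hx)).trans h1

set_option maxHeartbeats 1000000 in
/-- Uniform rate of the local linear covariance estimate. -/
theorem wpa1_sigmaHat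
    (hVAR : ∀ᶠ n in atTop, IsTVVAR (μ n) n (A n) (Sig n) (ε n) (X n))
    (hreg : ∀ᶠ n in atTop, IsRegularVAR (μ n) n (A n) (Sig n) (ε n) ι₁ C₀ C₁ ρ CS M)
    (hι : 0 < ι₁) (hK : IsKernel K)
    (hP : WPA1 μ (fun n ω => RegPath n (A n) K (h n) (logND n (d n))
      (deltaX n (X n) (Xhat n) ω) B M' G a (fun t => X n t ω) (fun t => Xhat n t ω)
      (fun t => innov n (Sig n) (ε n) (t : ℤ) ω)))
    {ahat : ∀ n, Ω n → Fin (d n) → Grid n → Fin (d n) → ℝ} {c : ℝ} (hc : 0 < c)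
    (hahat : WPA1 μ (fun n ω => ∀ i, ∀ t : Grid n, ∑ j, |ahat n ω i t j - A n (rt n t) i j|
        ≤ c * (sparsity n (A n) * zetaDag n (A n) (h n) (X n) (Xhat n) ω)))
    {b : ℕ → ℝ} (hlip : ∃ LK, LipschitzOnWith LK K (Icc (-1) 1))
    (hb : ∀ᶠ n in atTop, 0 < b n) (hb0 : Tendsto b atTop (𝓝 0))
    (hnb : Tendsto (fun n : ℕ => n * b n / logND n (d n) ^ 3) atTop atTop)
    (hnu : SmallOP μ (fun n ω => nuDag n (A n) (h n) (X n) (Xhat n) ω) (fun _ => 1)) :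
    ∃ C : ℝ, 0 < C ∧ WPA1 μ (fun n ω => ∀ τ ∈ Icc (0 : ℝ) 1, ∀ i j,
      |(sigmaHat n K (b n) (fun t => Xhat n t ω) (ahat n ω) τ - Sig n τ) i j|
        ≤ C * (nuDiamond n (d n) (b n) + nuDag n (A n) (h n) (X n) (Xhat n) ω)) := by
  obtain ⟨n₀, ω₀, P₀⟩ := hP.exists.exists
  have hG := P₀.G_nonneg
  have hB1 := P₀.one_le_B
  have ha := P₀.a_nonneg
  have hKG := P₀.K_le
  obtain ⟨LK, hLK⟩ := hlip
  have hlipK : ∀ x ∈ Icc (-1 : ℝ) 1, ∀ y ∈ Icc (-1 : ℝ) 1, |K x - K y| ≤ LK * |x - y| :=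
    fun x hx y hy => by simpa [Real.dist_eq] using hLK.dist_le_mul x hx y hy
  have hband : ∀ᶠ n : ℕ in atTop, 1 ≤ logND n (d n) ∧ logND n (d n) ^ 3 ≤ n * b n := by
    filter_upwards [(tendsto_logND d).eventually_ge_atTop 1, hnb.eventually_ge_atTop 1]
      with n hL h1
    rw [one_le_div (by positivity)] at h1
    exact ⟨hL, h1⟩
  have hnb1 : ∀ᶠ n : ℕ in atTop, 1 ≤ n * b n :=
    hband.mono fun n hn => (one_le_pow₀ hn.1).trans hn.2
  have hLb : Tendsto (fun n : ℕ => logND n (d n) / (n * b n)) atTop (𝓝 0) := by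
    refine squeeze_zero' ?_ ?_ hnb.inv_tendsto_atTop
    · filter_upwards [hband, hnb1] with n hn hn1
      have := hn.1
      positivity
    · filter_upwards [hband, hnb1] with n hn hn1
      rw [Pi.inv_apply, inv_div]
      gcongr
      exact le_self_pow₀ hn.1 (by norm_num)
  have hnbtop : Tendsto (fun n : ℕ => n * b n) atTop atTop := by
    refine tendsto_atTop_mono' _ ?_ hnb
    filter_upwards [hband, hnb1] with n hn hn1
    exact div_le_self (by linarith) (one_le_pow₀ hn.1)
  obtain ⟨Bc, hBc, hcov⟩ := wpa1_abs_cov_le hVAR hreg hι hK hb hnb1 hLb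
  obtain ⟨c₀, N₀, hc₀, hdes⟩ := hK.design_lower_bound
  set S := max CS 1 with hS
  have hS0 : 0 < S := by positivity
  set Lg : ℝ := LK + G with hLg
  have hLg0 : 0 ≤ Lg := by positivity
  -- The deviation at grid points plus the price of passing to arbitrary τ, the summands e_i e_j −
  -- Σ_ij being at most (B² + S)L.
  set Cx := Bc + (3 * Lg + 6 * G) * (B ^ 2 + S) with hCx
  have hCx0 : 0 < Cx := by positivity
  set Cr := 1 + a + 2 * B * c with hCr
  have hCr0 : 0 < Cr := by positivity
  set Cs := 6 * G / c₀ * ((6 * G + 3 * G * S + 1) * Cr + Cx + 3 * G * max M 0) + 1 with hCs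
  have hCs0 : 0 < Cs := by positivity
  refine ⟨Cs, hCs0, ?_⟩
  have hx1 : ∀ᶠ n : ℕ in atTop, Cx * √(logND n (d n) / (n * b n)) ≤ 1 := by
    have h1 := (hLb.sqrt).const_mul Cx
    rw [Real.sqrt_zero, mul_zero] at h1
    exact h1.eventually_le_const one_pos
  refine (((hP.and hahat).and hcov).and (hnu (1 / Cr) (by positivity))).mono ?_
  filter_upwards [hreg, hb, hb0.eventually_le_const (by norm_num : (0 : ℝ) < 1 / 4), hband, hnb1,
    hnbtop.eventually_ge_atTop N₀, eventually_ge_atTop 8, hx1]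
    with n hR hbn hb4 ⟨hL, hL3⟩ hnbn hN₀ hn8 hx1n ω ⟨⟨⟨P, hahatω⟩, hcovω⟩, hnuω⟩ τ hτ i j
  set L := logND n (d n) with hLd
  have hL0 : 0 < L := by linarith
  have hnb0 : 0 < n * b n := by linarith
  have hrate : ∀ i, ∀ t : Grid n, ∑ j, |ahat n ω i t j - A n (rt n t) i j|
      ≤ c * (sparsity n (A n) * RegPath.rate n (A n) (h n) L (deltaX n (X n) (Xhat n) ω)) := hahatω
  have hres := P.abs_resid_sub_innov_le hrate
  have enu : sparsity n (A n) * RegPath.rate n (A n) (h n) L (deltaX n (X n) (Xhat n) ω) * √L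
      = nuDag n (A n) (h n) (X n) (Xhat n) ω := rfl
  rw [enu] at hres
  set ν := nuDag n (A n) (h n) (X n) (Xhat n) ω with hν
  have hν0 : 0 ≤ ν := by
    rw [← enu]
    have := P.rate_nonneg
    positivity
  have hν1 : Cr * ν ≤ 1 := by
    have h1 := mul_le_mul_of_nonneg_left ((le_abs_self _).trans hnuω) hCr0.le
    refine h1.trans (le_of_eq ?_)
    field_simp
  have hSig : ∀ τ ∈ Icc (0 : ℝ) 1, ∀ i j, |Sig n τ i j| ≤ S := fun τ hτ i j =>
    (abs_entry_le_opNorm _ i j).trans ((hR.normSig τ hτ.2).trans (le_max_left _ _))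
  have hn0 : (0 : ℝ) < n := by
    have : (8 : ℝ) ≤ n := by exact_mod_cast hn8
    linarith
  have hsqrt : √(n * b n * L) = n * b n * √(L / (n * b n)) := by
    have e1 : n * b n * L = (n * b n) ^ 2 * (L / (n * b n)) := by field_simp
    rw [e1, Real.sqrt_mul (by positivity), Real.sqrt_sq hnb0.le]
  -- As L ≤ L³ ≤ nb, the discretisation cost of order L does not exceed the order of the deviation
  -- itself.
  have hLle : L ≤ √(n * b n * L) := by
    refine Real.le_sqrt_of_sq_le ?_
    have : L ≤ n * b n := (le_self_pow₀ hL (by norm_num)).trans hL3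
    nlinarith
  have hcov' : ∀ i j, ∀ k < 2, |∑ t ∈ Finset.Icc 2 n,
      ((rt n t - τ) / b n) ^ k * K ((rt n t - τ) / b n) *
        (innov n (Sig n) (ε n) (t : ℤ) ω i * innov n (Sig n) (ε n) (t : ℤ) ω j
          - Sig n (rt n t) i j)| ≤ Cx * √(n * b n * L) := fun i j k hk => by
    have h1 := abs_kernel_sum_le_of_grid (g := fun x => x ^ k * K x) (G := G) (Lg := Lg)
      (Y := B ^ 2 * L + S) (x₀ := Bc * √(n * b n * L))
      (fun x => by
        by_cases h2 : x ∈ Icc (-1 : ℝ) 1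
        · rw [abs_mul, abs_pow]
          exact (mul_le_of_le_one_left (abs_nonneg _)
            (pow_le_one₀ (abs_nonneg _) (abs_le.2 h2))).trans (hKG _)
        · rw [hK.supp _ h2, mul_zero, abs_zero]; exact hG)
      (fun x hx => by rw [hK.supp x hx, mul_zero])
      (abs_mul_kernel_sub_le hKG hlipK hk) hLg0 hbn hnbn
      (fun t => innov n (Sig n) (ε n) (t : ℤ) ω i * innov n (Sig n) (ε n) (t : ℤ) ω j
          - Sig n (rt n t) i j)
      (fun t ht => by
        have ht' := Finset.mem_Icc.1 ht
        have ht1 : t ∈ Finset.Icc 1 n := Finset.mem_Icc.2 ⟨by omega, ht'.2⟩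
        refine (abs_sub _ _).trans (add_le_add ?_ (hSig _ (P.rt_mem ht1) i j))
        have e1 : B ^ 2 * L = (B * √L) * (B * √L) := by
          rw [mul_mul_mul_comm, Real.mul_self_sqrt hL0.le]; ring
        rw [abs_mul, e1]
        exact mul_le_mul (P.e_le t ht1 i) (P.e_le t ht1 j) (abs_nonneg _) (by positivity))
      (by positivity) (fun r hr => hcovω i j r hr k hk) hτ
    refine h1.trans ?_
    have h2 : B ^ 2 * L + S ≤ (B ^ 2 + S) * √(n * b n * L) := by
      have : (B ^ 2 + S) * L ≤ (B ^ 2 + S) * √(n * b n * L) :=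
        mul_le_mul_of_nonneg_left hLle (by positivity)
      have : S * 1 ≤ S * L := mul_le_mul_of_nonneg_left hL hS0.le
      linarith
    have h3 := mul_le_mul_of_nonneg_left h2 (by positivity : 0 ≤ 3 * Lg + 6 * G)
    rw [hCx]
    linarith
  have hx₀ : Cx * √(n * b n * L) ≤ n * b n := by
    rw [hsqrt]
    calc Cx * (n * b n * √(L / (n * b n))) = n * b n * (Cx * √(L / (n * b n))) := by ring
      _ ≤ n * b n * 1 := mul_le_mul_of_nonneg_left hx1n hnb0.le
      _ = _ := mul_one _
  have hmain := abs_sigmaHat_sub_le (M := max M 0) hKG hK.nonneg hK.supp hbn hnbn hc₀ hτ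
    (hdes n (b n) hbn hb4 hN₀ (by exact_mod_cast hn8) τ hτ) hR.smoothSig
    (fun i j τ hτ => (hR.boundSig i j τ hτ).trans (le_max_left _ _)) hSig
    (by positivity : 0 ≤ Cr * ν) hν1 hres hx₀ hcov' i j
  rw [Matrix.sub_apply]
  refine hmain.trans ?_
  have e1 : Cx * √(n * b n * L) / (n * b n) = Cx * √(L / (n * b n)) := by
    rw [hsqrt]; field_simp
  rw [e1, nuDiamond, ← hLd]
  set u := √(L / (n * b n)) with hu
  have hu0 : 0 ≤ u := Real.sqrt_nonneg _
  have hbb : 0 ≤ b n ^ 2 := sq_nonneg _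
  have hMM : 0 ≤ max M 0 := le_max_right _ _
  set D := 6 * G / c₀ with hD
  have hD0 : 0 ≤ D := by positivity
  set F := (6 * G + 3 * G * S + 1) * Cr with hF
  have hF0 : 0 ≤ F := by positivity
  set H := 3 * G * max M 0 with hH
  have hH0 : 0 ≤ H := by positivity
  have e2 : (6 * G + 3 * G * S + 1) * (Cr * ν) = F * ν := by rw [hF]; ring
  have h5 : F * ν + Cx * u + H * b n ^ 2 ≤ (F + Cx + H) * (u + b n ^ 2 + ν) := by
    have : 0 ≤ F * (u + b n ^ 2) + Cx * (b n ^ 2 + ν) + H * (u + ν) := by positivity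
    linarith
  rw [e2]
  refine (mul_le_mul_of_nonneg_left h5 hD0).trans ?_
  rw [hCs]
  have : 0 ≤ u + b n ^ 2 + ν := by positivity
  linarith

end Stages

end TVNet

/-! ### Assembly of the three stages. -/

theorem proposition5p1
    -- probability spaces, dimensions, number of factors
    {Ω : ℕ → Type*} [∀ n, MeasurableSpace (Ω n)] (μ : ∀ n, Measure (Ω n))
    [∀ n, IsProbabilityMeasure (μ n)] (d k : ℕ → ℕ)
    -- transition and volatility functions, errors, idiosyncratic components
    (A Sig : ∀ n, ℝ → Matrix (Fin (d n)) (Fin (d n)) ℝ)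
    (ε : ∀ n, ℤ → Ω n → Fin (d n) → ℝ) (X : ∀ n, ℕ → Ω n → Fin (d n) → ℝ)
    -- observations, factors, estimated idiosyncratic components
    (Z : ∀ n, ℕ → Ω n → Fin (d n) → ℝ) (F : ∀ n, ℕ → Ω n → Fin (k n) → ℝ)
    (Xhat : ∀ n, ℕ → Ω n → Fin (d n) → ℝ)
    -- kernel, bandwidths, first tuning parameter, preliminary estimates
    (K : ℝ → ℝ) (h hs lam1 : ℕ → ℝ)
    (atil btil : ∀ n, Ω n → Fin (d n) → Grid n → Fin (d n) → ℝ)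
    -- the time-varying VAR(1) model and its regularity
    (hVAR : ∀ᶠ n in atTop, IsTVVAR (μ n) n (A n) (Sig n) (ε n) (X n))
    (hreg : ∃ ι₁ C₀ C₁ ρ CS M : ℝ, 0 < ι₁ ∧ 0 < ρ ∧ ρ < 1 ∧
      ∀ᶠ n in atTop, IsRegularVAR (μ n) n (A n) (Sig n) (ε n) ι₁ C₀ C₁ ρ CS M)
    -- the factor model, with constant or time-varying loadings
    (hfactor : ConstantLoadings μ d k X Z Xhat F ∨ VaryingLoadings μ d k K hs X Z Xhat F)
    -- kernel, bandwidth and sparsity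
    (hK : IsKernel K)
    (hh1 : Tendsto (fun n : ℕ => n * h n / logND n (d n) ^ 2) atTop atTop)
    (hh2 : Tendsto (fun n : ℕ => sparsity n (A n) * h n ^ 2 * logND n (d n)) atTop (𝓝 0))
    (hs1 : ∀ᶠ n in atTop, 1 ≤ sparsity n (A n))
    -- uniform restricted eigenvalue condition
    (hRE : ∃ κ₀ : ℝ, 0 < κ₀ ∧ WPA1 μ (fun n ω => ∀ i, ∀ t : Grid n,
      ∀ u ∈ Cone (JLoc (A n) i (rt n t)) (JLoc' (A n) i (rt n t)),
        κ₀ ≤ u ⬝ᵥ (Psi n K (h n) (fun r => X n r ω) (rt n t) *ᵥ u)))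
    -- the approximation error and the first tuning parameter
    (hdelta : SmallOP μ (fun n ω =>
      √(logND n (d n)) * sparsity n (A n) * deltaX n (X n) (Xhat n) ω) (fun _ => 1))
    (hlam1 : SmallOP μ (fun n ω => zetaDag n (A n) (h n) (X n) (Xhat n) ω) lam1)
    (hlam1' : Tendsto (fun n => √(sparsity n (A n)) * lam1 n / h n) atTop (𝓝 0))
    -- first stage: time-varying LASSO
    (hlasso : ∀ᶠ n in atTop, ∀ ω,
      IsLasso n K (h n) (lam1 n) (fun t => Xhat n t ω) (atil n ω) (btil n ω)) :
    -- (i)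
    BigOP μ (fun n (p : Fin (d n) × Grid n) ω =>
        ∑ j, (atil n ω p.1 p.2 j - A n (rt n p.2) p.1 j) ^ 2)
      (fun n _ => sparsity n (A n) * lam1 n ^ 2)
    ∧
    -- (ii)
    ∀ (lam2 : ℕ → ℝ) (ahat bhat : ∀ n, Ω n → Fin (d n) → Grid n → Fin (d n) → ℝ),
      -- the eigenvalue bound for vectors supported on the true index sets
      (∃ κ₁ : ℝ, 0 < κ₁ ∧ WPA1 μ (fun n ω => ∀ i, ∀ t : Grid n,
        ∀ u ∈ SuppSphere (J n (A n) i) (J' n (A n) i),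
          κ₁ ≤ u ⬝ᵥ (Psi n K (h n) (fun r => X n r ω) (rt n t) *ᵥ u))) →
      -- second tuning parameter
      SmallOP μ (fun n ω =>
        √n * sparsity n (A n) * logND n (d n) * zetaDag n (A n) (h n) (X n) (Xhat n) ω
          + √(n * sparsity n (A n)) * lam1 n) lam2 →
      -- minimal signal strength
      (∀ᶠ n in atTop, ∀ i,
        (∀ j ∈ J n (A n) i,
          (scadA + 1) * lam2 n ≤ l2 fun t : Grid n => A n (rt n t) i j) ∧
        ∀ j ∈ J' n (A n) i,
          (scadA + 1) * lam2 n ≤ devNorm fun t : Grid n => A n (rt n t) i j) →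
      -- second stage: weighted group LASSO
      (∀ᶠ n in atTop, ∀ ω i,
        IsMinimiser (groupObj n K (h n) (lam2 n) (fun t => Xhat n t ω) (atil n ω i) i) univ
          (ahat n ω i, bhat n ω i)) →
      -- oracle property: the minimiser exists, is unique and is the oracle estimate
      WPA1 μ (fun n ω => ∀ i, ∃ p,
        (∀ p', IsMinimiser
          (groupObj n K (h n) (lam2 n) (fun t => Xhat n t ω) (atil n ω i) i) univ p' ↔ p' = p) ∧
        ∀ p', IsMinimiser
          (groupObj n K (h n) (lam2 n) (fun t => Xhat n t ω) (atil n ω i) i)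
            (oracleClass n (A n) i) p' ↔ p' = p)
      ∧
      BigOP μ (fun n (i : Fin (d n)) ω =>
          (1 / (n : ℝ)) * ∑ t : Grid n, ∑ j, (ahat n ω i t j - A n (rt n t) i j) ^ 2)
        (fun n ω => sparsity n (A n) * zetaDag n (A n) (h n) (X n) (Xhat n) ω ^ 2)
      ∧
      -- (iii)
      ∀ (b : ℕ → ℝ) (q C₂ : ℝ) (ξ : ℕ → ℝ),
        (∃ LK, LipschitzOnWith LK K (Icc (-1) 1)) →
        (∀ᶠ n in atTop, 0 < b n) → Tendsto b atTop (𝓝 0) →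
        Tendsto (fun n : ℕ => n * b n / logND n (d n) ^ 3) atTop atTop →
        SmallOP μ (fun n ω => nuDag n (A n) (h n) (X n) (Xhat n) ω) (fun _ => 1) →
        0 ≤ q → q < 1 →
        (∀ᶠ n in atTop, InSparseClass q (ξ n) C₂ (fun τ => (Sig n τ)⁻¹)) →
        -- `λ₃ = C₃ (ν⋄ + ν†)` with a sufficiently large constant `C₃`
        ∃ Cbar : ℝ, 0 < Cbar ∧ ∀ C₃ ≥ Cbar,
          ∀ Omt : ∀ n, Ω n → ℝ → Matrix (Fin (d n)) (Fin (d n)) ℝ,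
            -- third stage: time-varying CLIME
            (∀ᶠ n in atTop, ∀ ω, ∀ τ ∈ Icc (0 : ℝ) 1,
              IsClime (sigmaHat n K (b n) (fun t => Xhat n t ω) (ahat n ω) τ)
                (C₃ * (nuDiamond n (d n) (b n) + nuDag n (A n) (h n) (X n) (Xhat n) ω))
                (Omt n ω τ)) →
            BigOP μ (fun n (p : Icc (0 : ℝ) 1 × Fin (d n) × Fin (d n)) ω =>
                (symmetrise (Omt n ω p.1) - (Sig n p.1)⁻¹) p.2.1 p.2.2)
              (fun n ω => nuDiamond n (d n) (b n) + nuDag n (A n) (h n) (X n) (Xhat n) ω)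
            ∧
            BigOP μ (fun n (τ : Icc (0 : ℝ) 1) ω =>
                opNorm (symmetrise (Omt n ω τ) - (Sig n τ)⁻¹))
              (fun n ω => ξ n *
                (nuDiamond n (d n) (b n) + nuDag n (A n) (h n) (X n) (Xhat n) ω) ^ (1 - q))
            ∧
            BigOP μ (fun n (τ : Icc (0 : ℝ) 1) ω =>
                (1 / (d n : ℝ)) *
                  ∑ i, ∑ j, ((symmetrise (Omt n ω τ) - (Sig n τ)⁻¹) i j) ^ 2)
              (fun n ω => ξ n *
                (nuDiamond n (d n) (b n) + nuDag n (A n) (h n) (X n) (Xhat n) ω) ^ (2 - q)) := by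
  obtain ⟨ι₁, C₀, C₁, ρ, CS, M, hι, hρ, hρ1, hreg⟩ := hreg
  obtain ⟨κ₀, hκ₀, hRE⟩ := hRE
  obtain ⟨B, M', G, a, hP⟩ := exists_wpa1_regPath hVAR hreg hι hρ hρ1 hK hh1 hh2 hs1 hdelta
  obtain ⟨n₀, ω₀, P₀⟩ := hP.exists.exists
  have hB : 0 ≤ B := zero_le_one.trans P₀.one_le_B
  have hsL := tendsto_sparsity_mul_log_div hh1 hh2 hs1 hlam1 hlam1'
  have hlam0 := eventually_lam1_pos hh1 hh2 hs1 hlam1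
  have hgram : ∀ κ : ℝ, 0 < κ → WPA1 μ (fun n ω => 18 * sparsity n (A n) *
      RegPath.gramErr n (h n) (logND n (d n)) (deltaX n (X n) (Xhat n) ω) B G ≤ κ / 2) :=
    fun κ hκ => wpa1_gramErr_le hdelta hsL hB P₀.G_nonneg (half_pos hκ)
  obtain ⟨C, hC, hpre⟩ := wpa1_lasso_rate hP hκ₀ hRE (hgram κ₀ hκ₀) hlam0 hlam1 hlasso
  refine ⟨BigOP.of_wpa1 C hC (hpre.mono (Eventually.of_forall fun n ω hω p => ?_)), ?_⟩
  · rw [abs_of_nonneg (Finset.sum_nonneg fun _ _ => sq_nonneg _)]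
    exact hω p.1 p.2
  intro lam2 ahat bhat hSE hlam2 hsig hgroup
  obtain ⟨κ₁, hκ₁, hSE⟩ := hSE
  obtain ⟨c, hc, horacle⟩ := wpa1_oracle hP hκ₁ hSE (hgram κ₁ hκ₁) hlam0 hC hpre hlam2 hsig
  -- The chosen minimiser is the only one, hence the oracle estimate, and inherits both of its error
  -- bounds.
  have hahat : WPA1 μ (fun n ω => ∀ i, ∀ t : Grid n,
      ∑ j, (ahat n ω i t j - A n (rt n t) i j) ^ 2
        ≤ c * (sparsity n (A n) * zetaDag n (A n) (h n) (X n) (Xhat n) ω ^ 2) ∧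
      ∑ j, |ahat n ω i t j - A n (rt n t) i j|
        ≤ c * (sparsity n (A n) * zetaDag n (A n) (h n) (X n) (Xhat n) ω)) := by
    refine horacle.mono (hgroup.mono fun n hn ω hω i t => ?_)
    obtain ⟨p, h1, -, h3, h4⟩ := hω i
    have hp := (h1 _).1 (hn ω i)
    rw [← hp] at h3 h4
    exact ⟨h3 t, h4 t⟩
  refine ⟨horacle.mono (Eventually.of_forall fun n ω hω i => ?_),
    BigOP.of_wpa1 c hc (hahat.mono ?_), ?_⟩
  · obtain ⟨p, h1, h2, -⟩ := hω i
    exact ⟨p, h1, h2⟩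
  · filter_upwards [eventually_ge_atTop 1] with n hn ω hω i
    have hn0 : (0 : ℝ) < n := by exact_mod_cast hn
    rw [abs_of_nonneg (by positivity), one_div, inv_mul_eq_div, div_le_iff₀ hn0]
    calc ∑ t : Grid n, ∑ j, (ahat n ω i t j - A n (rt n t) i j) ^ 2
        ≤ ∑ _t : Grid n,
          c * (sparsity n (A n) * zetaDag n (A n) (h n) (X n) (Xhat n) ω ^ 2) :=
          Finset.sum_le_sum fun t _ => (hω i t).1
      _ = _ := by
          rw [Finset.sum_const, Finset.card_univ, card_grid, nsmul_eq_mul, mul_comm]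
  intro b q C₂ ξ hlip hb hb0 hnb hnu hq0 hq1 hsparse
  obtain ⟨Cs, hCs, hsigma⟩ := wpa1_sigmaHat hVAR hreg hι hK hP hc
    (hahat.mono (Eventually.of_forall fun n ω hω i t => (hω i t).2)) hlip hb hb0 hnb hnu
  set D := max C₂ 1 with hD
  have hD0 : 0 < D := by positivity
  -- This makes λ₃ at least D times the error of the covariance estimate, which is the feasibility
  -- condition in `clime_rates`.
  refine ⟨Cs * D, by positivity, fun C₃ hC₃ Omt hOmt => ?_⟩
  have hC₃0 : 0 < C₃ := lt_of_lt_of_le (by positivity) hC₃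
  set m := 2 * D * C₃ with hm
  have hm0 : 0 < m := by positivity
  have hclime : WPA1 μ (fun n ω => ∀ τ ∈ Icc (0 : ℝ) 1,
      (∀ i j, |(symmetrise (Omt n ω τ) - (Sig n τ)⁻¹) i j|
        ≤ m * (nuDiamond n (d n) (b n) + nuDag n (A n) (h n) (X n) (Xhat n) ω)) ∧
      opNorm (symmetrise (Omt n ω τ) - (Sig n τ)⁻¹) ≤ 2 * m ^ (1 - q) *
        (ξ n * (nuDiamond n (d n) (b n) + nuDag n (A n) (h n) (X n) (Xhat n) ω) ^ (1 - q)) ∧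
      (1 / (d n : ℝ)) * ∑ i, ∑ j, ((symmetrise (Omt n ω τ) - (Sig n τ)⁻¹) i j) ^ 2
        ≤ 2 * m ^ (2 - q) *
        (ξ n * (nuDiamond n (d n) (b n) + nuDag n (A n) (h n) (X n) (Xhat n) ω) ^ (2 - q))) := by
    refine (hsigma.and hP).mono ?_
    filter_upwards [hreg, hb, hsparse, hOmt, hs1] with n hR hbn hsp hO hs ω ⟨hω, P⟩ τ hτ
    set ν := nuDiamond n (d n) (b n) + nuDag n (A n) (h n) (X n) (Xhat n) ω with hν
    have hν0 : 0 < ν := by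
      have h1 : 0 < nuDiamond n (d n) (b n) := by rw [nuDiamond]; positivity
      have h2 : 0 ≤ nuDag n (A n) (h n) (X n) (Xhat n) ω := by
        have := P.rate_nonneg
        rw [nuDag, zetaDag_eq_rate]
        positivity
      linarith
    obtain ⟨-, hcol, hrow⟩ := hsp τ hτ
    -- Sparsity at least 1 rules out d = 0, and then any row sum shows that ξ is nonnegative.
    have hξ : 0 ≤ ξ n := by
      rcases isEmpty_or_nonempty (Fin (d n)) with hE | ⟨⟨i⟩⟩
      · rw [sparsity, Finset.univ_eq_empty, Finset.sup_empty] at hs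
        exact absurd hs (by norm_num)
      · refine le_trans (Finset.sum_nonneg fun j _ => ?_) (hrow i)
        split_ifs <;> positivity
    obtain ⟨h1, h2, h3⟩ := clime_rates (lam := C₃ * ν) (hR.posSig τ hτ.2)
      (by positivity : 0 ≤ Cs * ν) hD0 (by positivity) (fun j => (hcol j).trans (le_max_left _ _))
      (hω τ hτ) (by nlinarith) (hO ω τ hτ) hq0 hq1 hξ hrow
    have e1 : 2 * D * (C₃ * ν) = m * ν := by rw [hm]; ring
    rw [e1] at h1 h2 h3
    rw [Real.mul_rpow hm0.le hν0.le] at h2 h3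
    exact ⟨h1, h2.trans (le_of_eq (by ring)), h3.trans (le_of_eq (by ring))⟩
  refine ⟨BigOP.of_wpa1 m hm0 (hclime.mono (Eventually.of_forall fun n ω hω p =>
      (hω p.1 p.1.2).1 _ _)),
    BigOP.of_wpa1 (2 * m ^ (1 - q)) (by positivity)
      (hclime.mono (Eventually.of_forall fun n ω hω τ => ?_)),
    BigOP.of_wpa1 (2 * m ^ (2 - q)) (by positivity)
      (hclime.mono (Eventually.of_forall fun n ω hω τ => ?_))⟩
  · rw [abs_of_nonneg (opNorm_nonneg _)]
    exact (hω τ τ.2).2.1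
  · rw [abs_of_nonneg (by positivity)]
    exact (hω τ τ.2).2.2
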